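/- Let $\tau_{11},\tau_{22},\tau_{12}\in\mathbb C$ with $\mathrm{Im}\,\tau_{11}>0$, $\mathrm{Im}\,\tau_{22}>0$, $(\mathrm{Im}\,\tau_{11})(\mathrm{Im}\,\tau_{22})-(\mathrm{Im}\,\tau_{12})^2>0$. For real $a,b,c,d$ put $$\vartheta\left[\begin{smallmatrix}a&c\\b&d\end{smallmatrix}\right](x,y)=\sum_{m,n\in\mathbb Z}\exp\Big\{\pi i\big(\tau_{11}(m+\tfrac a2)^2+\tau_{22}(n+\tfrac c2)^2+2\tau_{12}(m+\tfrac a2)(n+\tfrac c2)\big)+2\pi i\big((m+\tfrac a2)(x+\tfrac b2)+(n+\tfrac c2)(y+\tfrac d2)\big)\Big\},$$ and let $\Theta[\cdot]$ be the same series with $2\tau_{ij}$ in place of $\tau_{ij}$. Write $P_0,P_1,P_2,P_3$ for $\vartheta\left[\begin{smallmatrix}0&0\\b&d\end{smallmatrix}\right]$ with $(b,d)=(1,1),(0,1),(1,0),(0,0)$, and $S_0,S_1,S_2,S_3$ for $\vartheta\left[\begin{smallmatrix}1&1\\b&d\end{smallmatrix}\right]$ with the same $(b,d)$. Let $p=S_1/P_1$,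 $q=S_2/P_2$ as functions of $(u,v)\in\mathbb C^2$. Let $t,\mathsf u,\mathsf v,w$ be the constants $\Theta\left[\begin{smallmatrix}a&c\\0&0\end{smallmatrix}\right](0,0)$ with $(a,c)=(0,0),(1,0),(0,1),(1,1)$. Assume that $t^2-w^2$, $\mathsf u^2-\mathsf v^2$, $t\mathsf u\pm\mathsf vw$, $t\mathsf v\pm\mathsf uw$, $t^2+\mathsf u^2-\mathsf v^2-w^2$ and $t^2-\mathsf u^2+\mathsf v^2-w^2$ are all nonzero. Define $$E=\frac{t^2\mathsf u^2+t^2\mathsf v^2+\mathsf u^2w^2+\mathsf v^2w^2+4t\mathsf u\mathsf vw}{2(t\mathsf u+\mathsf vw)(t\mathsf v+\mathsf uw)},\qquad C=\frac{t^2\mathsf u^2+t^2\mathsf v^2+\mathsf u^2w^2+\mathsf v^2w^2-4t\mathsf u\mathsf vw}{2(t\mathsf u-\mathsf vw)(t\mathsf v-\mathsf uw)},$$ $$F=\frac{t^4+\mathsf u^4+\mathsf v^4+w^4-2t^2w^2-2\mathsf u^2\mathsf v^2}{(t^2+\mathsf u^2-\mathsf v^2-w^2)(t^2-\mathsf u^2+\mathsf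 v^2-w^2)},$$ $$D=\frac{(t^2-w^2)^2(\mathsf u^2-\mathsf v^2)^2\cdot\left(-\tfrac12 P_3P_0S_3S_0(0,0)\right)}{(t^2+\mathsf u^2-\mathsf v^2-w^2)(t^2-\mathsf u^2+\mathsf v^2-w^2)(t^2\mathsf u^2-\mathsf v^2w^2)(t^2\mathsf v^2-\mathsf u^2w^2)},$$ $$R=\frac{(t^2-w^2)^2(\mathsf u^2-\mathsf v^2)^2}{4(t^2\mathsf u^2-\mathsf v^2w^2)(t^2\mathsf v^2-\mathsf u^2w^2)},\quad b=\frac{CF-E}{R},\quad b_1=\frac DR,\quad E_1=\frac{C-E-D}{F-1},\quad E_2=\frac{C+E-D}{F+1},$$ $$m=\frac{E+1}{E-1},\quad m_1=\frac{E_1+1}{E_1-1},\quad m_2=\frac{E_2+1}{E_2-1},\qquad f_5(x)=x(1-x)(1-mx)(1-m_1x)(1-m_2x).$$ Put $\Theta_{\pm\pm}=\Theta\left[\begin{smallmatrix}\pm1/2&\pm1/2\\0&0\end{smallmatrix}\right]$, let $(\alpha,\gamma)$ be the gradient at $(0,0)$ of $\Theta_{++}-\Theta_{--}$ and $(\beta,\delta)$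 that of $\Theta_{+-}-\Theta_{-+}$, and let $$\mu=\frac{-i(\beta u+\delta v)}{\Theta_{+-}(0,0)},\qquad \nu=\frac{i(\alpha u+\gamma v)}{\Theta_{++}(0,0)}.$$ Then $m,m_1,m_2$ are pairwise distinct and different from $0$ and $1$ (so $y^2=f_5(x)$ has genus two), and there are constants $\kappa_1,\kappa_2$ with $$\kappa_1^2=4(b+b_1)\frac{(1-E)(1-E_1)}{(F+1)(1-E_2)},\qquad \kappa_2^2=4(b-b_1)\frac{(1-E)(1-E_2)}{(F-1)(1-E_1)}$$ such that, with $\hat\mu=\kappa_1\nu$ and $\hat\nu=\kappa_2\mu$, the following holds. The linear map $(u,v)\mapsto(U_1,U_2)=\Big(\dfrac{m_1\hat\mu-m_2\hat\nu}{m_1-m_2},\dfrac{\hat\mu-\hat\nu}{m_1-m_2}\Big)$ of $\mathbb C^2$ is invertible. Let $\Delta(s)^2=1-2Es^2+s^4$, let $V\subseteq\mathbb C^2$ be open, let $\Delta(p)\Delta(q)$ denote any holomorphic function on $V$ whose square is $\Delta(p)^2\Delta(q)^2$, and put $$x=\frac{E(1+p^2q^2)-(p^2+q^2)-\Delta(p)\Delta(q)}{(E+1)(pq+1)^2},\qquad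 x'=\frac{E(1+p^2q^2)-(p^2+q^2)+\Delta(p)\Delta(q)}{(E+1)(pq+1)^2}.$$ Suppose that $P_1,P_2,1+pq,\Delta(p)\Delta(q),f_5(x),f_5(x')$ have no zero on $V$. Then $x,x'$ are holomorphic on $V$, and for suitable holomorphic branches of $\sqrt{f_5(x)}$ and $\sqrt{f_5(x')}$ on $V$ $$\frac{(1-m_2x)\,dx}{\sqrt{f_5(x)}}+\frac{(1-m_2x')\,dx'}{\sqrt{f_5(x')}}=d\hat\mu,\qquad \frac{(1-m_1x)\,dx}{\sqrt{f_5(x)}}+\frac{(1-m_1x')\,dx'}{\sqrt{f_5(x')}}=d\hat\nu.$$ As functions of $(U_1,U_2)$, $x$ and $x'$ satisfy, for suitable holomorphic branches of the roots, the standard Jacobi inversion system $$\frac{dx}{\sqrt{f_5(x)}}+\frac{dx'}{\sqrt{f_5(x')}}=dU_1,\qquad \frac{x\,dx}{\sqrt{f_5(x)}}+\frac{x'\,dx'}{\sqrt{f_5(x')}}=dU_2,$$ and its symmetric functions $\wp_{22}(U_1,U_2):=x+x'$ and $\wp_{12}(U_1,U_2):=-xx'$ are $$\wp_{22}=\frac{2\left(E(1+p^2q^2)-(p^2+q^2)\right)}{(E+1)(1+pq)^2}=\frac{2E}{E+1}-\frac{2(p^2+q^2+2Epq)}{(E+1)(1+pq)^2},\qquad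 \wp_{12}=-\frac{E-1}{E+1}+\frac{4(E-1)pq}{(E+1)(1+pq)^2},$$ where $p,q$ are taken at the point $(u,v)$ that corresponds to $(U_1,U_2)$. -/

import Mathlib

open Complex

/-- A point of the Siegel upper half space of degree two: the entries of a symmetric complex
`2 × 2` matrix with positive definite imaginary part. -/
structure Period where
  τ₁₁ : ℂ
  τ₂₂ : ℂ
  τ₁₂ : ℂ
  im_pos₁₁ : 0 < τ₁₁.im
  im_pos₂₂ : 0 < τ₂₂.im
  im_det_pos : 0 < τ₁₁.im * τ₂₂.im - τ₁₂.im ^ 2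

/-- The two-variable theta series with characteristic `[a c; b d]` and period entries
`τ₁₁`, `τ₂₂`, `τ₁₂`, at the point `z = (x, y)`. -/
noncomputable def thetaSeries (τ₁₁ τ₂₂ τ₁₂ : ℂ) (a c b d : ℝ) (z : ℂ × ℂ) : ℂ :=
  ∑' k : ℤ × ℤ, exp
    (Real.pi * I * (τ₁₁ * ((k.1 : ℂ) + a / 2) ^ 2 + τ₂₂ * ((k.2 : ℂ) + c / 2) ^ 2
        + 2 * τ₁₂ * ((k.1 : ℂ) + a / 2) * ((k.2 : ℂ) + c / 2))
      + 2 * Real.pi * I * (((k.1 : ℂ) + a / 2) * (z.1 + b / 2)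
        + ((k.2 : ℂ) + c / 2) * (z.2 + d / 2)))

namespace Period

variable (τ : Period)

/-- The theta function `ϑ[a c; b d](u, v)` of the period matrix. -/
noncomputable def theta (a c b d : ℝ) (z : ℂ × ℂ) : ℂ :=
  thetaSeries τ.τ₁₁ τ.τ₂₂ τ.τ₁₂ a c b d z

/-- The theta function `Θ[a c; b d](u, v)` of twice the period matrix. -/
noncomputable def bigTheta (a c b d : ℝ) (z : ℂ × ℂ) : ℂ :=
  thetaSeries (2 * τ.τ₁₁) (2 * τ.τ₂₂) (2 * τ.τ₁₂) a c b d z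

noncomputable def P₀ (z : ℂ × ℂ) : ℂ := τ.theta 0 0 1 1 z
noncomputable def P₁ (z : ℂ × ℂ) : ℂ := τ.theta 0 0 0 1 z
noncomputable def P₂ (z : ℂ × ℂ) : ℂ := τ.theta 0 0 1 0 z
noncomputable def P₃ (z : ℂ × ℂ) : ℂ := τ.theta 0 0 0 0 z
noncomputable def S₀ (z : ℂ × ℂ) : ℂ := τ.theta 1 1 1 1 z
noncomputable def S₁ (z : ℂ × ℂ) : ℂ := τ.theta 1 1 0 1 z
noncomputable def S₂ (z : ℂ × ℂ) : ℂ := τ.theta 1 1 1 0 z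
noncomputable def S₃ (z : ℂ × ℂ) : ℂ := τ.theta 1 1 0 0 z

/-- `p = S₁ / P₁`. -/
noncomputable def p (z : ℂ × ℂ) : ℂ := τ.S₁ z / τ.P₁ z

/-- `q = S₂ / P₂`. -/
noncomputable def q (z : ℂ × ℂ) : ℂ := τ.S₂ z / τ.P₂ z

/-! The theta constants `t, u, v, w`. -/

noncomputable def t : ℂ := τ.bigTheta 0 0 0 0 (0, 0)
noncomputable def u : ℂ := τ.bigTheta 1 0 0 0 (0, 0)
noncomputable def v : ℂ := τ.bigTheta 0 1 0 0 (0, 0)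
noncomputable def w : ℂ := τ.bigTheta 1 1 0 0 (0, 0)

/-- None of the theta constants by which the parameters below are divided vanishes. -/
structure Nondegenerate : Prop where
  tw : τ.t ^ 2 - τ.w ^ 2 ≠ 0
  uv : τ.u ^ 2 - τ.v ^ 2 ≠ 0
  tuvw_add : τ.t * τ.u + τ.v * τ.w ≠ 0
  tuvw_sub : τ.t * τ.u - τ.v * τ.w ≠ 0
  tvuw_add : τ.t * τ.v + τ.u * τ.w ≠ 0
  tvuw_sub : τ.t * τ.v - τ.u * τ.w ≠ 0
  sq_one : τ.t ^ 2 + τ.u ^ 2 - τ.v ^ 2 - τ.w ^ 2 ≠ 0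
  sq_two : τ.t ^ 2 - τ.u ^ 2 + τ.v ^ 2 - τ.w ^ 2 ≠ 0

/-! The coefficients of the Kummer quartic relation between `P₁, S₁, P₂, S₂`. -/

noncomputable def E : ℂ :=
  (τ.t ^ 2 * τ.u ^ 2 + τ.t ^ 2 * τ.v ^ 2 + τ.u ^ 2 * τ.w ^ 2 + τ.v ^ 2 * τ.w ^ 2
      + 4 * τ.t * τ.u * τ.v * τ.w)
    / (2 * (τ.t * τ.u + τ.v * τ.w) * (τ.t * τ.v + τ.u * τ.w))

noncomputable def F : ℂ :=
  (τ.t ^ 4 + τ.u ^ 4 + τ.v ^ 4 + τ.w ^ 4 - 2 * τ.t ^ 2 * τ.w ^ 2 - 2 * τ.u ^ 2 * τ.v ^ 2)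
    / ((τ.t ^ 2 + τ.u ^ 2 - τ.v ^ 2 - τ.w ^ 2) * (τ.t ^ 2 - τ.u ^ 2 + τ.v ^ 2 - τ.w ^ 2))

noncomputable def C : ℂ :=
  (τ.t ^ 2 * τ.u ^ 2 + τ.t ^ 2 * τ.v ^ 2 + τ.u ^ 2 * τ.w ^ 2 + τ.v ^ 2 * τ.w ^ 2
      - 4 * τ.t * τ.u * τ.v * τ.w)
    / (2 * (τ.t * τ.u - τ.v * τ.w) * (τ.t * τ.v - τ.u * τ.w))

/-- The square root of `(t² + u² + v² + w²)(t² - u² - v² + w²)(t² w² - u² v²)` that occurs in `D`.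
Its sign is the one for which the Kummer quartic relation between `P₁, S₁, P₂, S₂` holds. -/
noncomputable def rootD : ℂ :=
  -(τ.P₃ (0, 0) * τ.P₀ (0, 0) * τ.S₃ (0, 0) * τ.S₀ (0, 0)) / 2

noncomputable def D : ℂ :=
  ((τ.t ^ 2 - τ.w ^ 2) ^ 2 * (τ.u ^ 2 - τ.v ^ 2) ^ 2 * τ.rootD)
    / ((τ.t ^ 2 + τ.u ^ 2 - τ.v ^ 2 - τ.w ^ 2) * (τ.t ^ 2 - τ.u ^ 2 + τ.v ^ 2 - τ.w ^ 2)
      * (τ.t ^ 2 * τ.u ^ 2 - τ.v ^ 2 * τ.w ^ 2) * (τ.t ^ 2 * τ.v ^ 2 - τ.u ^ 2 * τ.w ^ 2))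

/-- The square root of `(C² - 1)(E² - 1)` used in `b` and `b₁`. -/
noncomputable def rootCE : ℂ :=
  ((τ.t ^ 2 - τ.w ^ 2) ^ 2 * (τ.u ^ 2 - τ.v ^ 2) ^ 2)
    / (4 * (τ.t ^ 2 * τ.u ^ 2 - τ.v ^ 2 * τ.w ^ 2) * (τ.t ^ 2 * τ.v ^ 2 - τ.u ^ 2 * τ.w ^ 2))

noncomputable def b : ℂ := (τ.C * τ.F - τ.E) / τ.rootCE
noncomputable def b₁ : ℂ := τ.D / τ.rootCE

noncomputable def E₁ : ℂ := (τ.C - τ.E - τ.D) / (τ.F - 1)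
noncomputable def E₂ : ℂ := (τ.C + τ.E - τ.D) / (τ.F + 1)

noncomputable def m : ℂ := (τ.E + 1) / (τ.E - 1)
noncomputable def m₁ : ℂ := (τ.E₁ + 1) / (τ.E₁ - 1)
noncomputable def m₂ : ℂ := (τ.E₂ + 1) / (τ.E₂ - 1)

/-- The quintic `f₅(x) = x (1 - x)(1 - m x)(1 - m₁ x)(1 - m₂ x)`. -/
noncomputable def f₅ (x : ℂ) : ℂ :=
  x * (1 - x) * (1 - τ.m * x) * (1 - τ.m₁ * x) * (1 - τ.m₂ * x)

/-! The linear forms `μ` and `ν` in `(u, v)`. -/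

noncomputable def α : ℂ :=
  deriv (fun s : ℂ => τ.bigTheta (1 / 2) (1 / 2) 0 0 (s, 0)
    - τ.bigTheta (-1 / 2) (-1 / 2) 0 0 (s, 0)) 0
noncomputable def β : ℂ :=
  deriv (fun s : ℂ => τ.bigTheta (1 / 2) (-1 / 2) 0 0 (s, 0)
    - τ.bigTheta (-1 / 2) (1 / 2) 0 0 (s, 0)) 0
noncomputable def γ : ℂ :=
  deriv (fun s : ℂ => τ.bigTheta (1 / 2) (1 / 2) 0 0 (0, s)
    - τ.bigTheta (-1 / 2) (-1 / 2) 0 0 (0, s)) 0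
noncomputable def δ : ℂ :=
  deriv (fun s : ℂ => τ.bigTheta (1 / 2) (-1 / 2) 0 0 (0, s)
    - τ.bigTheta (-1 / 2) (1 / 2) 0 0 (0, s)) 0

/-- `μ(u, v) = -i (β u + δ v) / Θ[1/2 -1/2; 0 0](0, 0)`. -/
noncomputable def μ : ℂ × ℂ →L[ℂ] ℂ :=
  (-I / τ.bigTheta (1 / 2) (-1 / 2) 0 0 (0, 0)) •
    (τ.β • ContinuousLinearMap.fst ℂ ℂ ℂ + τ.δ • ContinuousLinearMap.snd ℂ ℂ ℂ)

/-- `ν(u, v) = i (α u + γ v) / Θ[1/2 1/2; 0 0](0, 0)`. -/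
noncomputable def ν : ℂ × ℂ →L[ℂ] ℂ :=
  (I / τ.bigTheta (1 / 2) (1 / 2) 0 0 (0, 0)) •
    (τ.α • ContinuousLinearMap.fst ℂ ℂ ℂ + τ.γ • ContinuousLinearMap.snd ℂ ℂ ℂ)

/-- `Δ(x)² = 1 - 2 E x² + x⁴`. -/
noncomputable def ΔSq (x : ℂ) : ℂ := 1 - 2 * τ.E * x ^ 2 + x ^ 4

/-- The function `x` of `p` and `q`, where `r` is the chosen branch of `Δ(p) Δ(q)`. -/
noncomputable def x (r : ℂ × ℂ → ℂ) (z : ℂ × ℂ) : ℂ :=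
  (τ.E * (1 + τ.p z ^ 2 * τ.q z ^ 2) - (τ.p z ^ 2 + τ.q z ^ 2) - r z)
    / ((τ.E + 1) * (τ.p z * τ.q z + 1) ^ 2)

/-- The function `x'` of `p` and `q`, where `r` is the chosen branch of `Δ(p) Δ(q)`. -/
noncomputable def x' (r : ℂ × ℂ → ℂ) (z : ℂ × ℂ) : ℂ :=
  (τ.E * (1 + τ.p z ^ 2 * τ.q z ^ 2) - (τ.p z ^ 2 + τ.q z ^ 2) + r z)
    / ((τ.E + 1) * (τ.p z * τ.q z + 1) ^ 2)

/-- `r` is a holomorphic branch of `Δ(p) Δ(q)` on the open set `V`, and on `V` all quantities by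
which the inversion system divides are nonzero. -/
structure IsBranch (V : Set (ℂ × ℂ)) (r : ℂ × ℂ → ℂ) : Prop where
  isOpen : IsOpen V
  differentiableOn : DifferentiableOn ℂ r V
  P₁_ne : ∀ z ∈ V, τ.P₁ z ≠ 0
  P₂_ne : ∀ z ∈ V, τ.P₂ z ≠ 0
  one_add_pq_ne : ∀ z ∈ V, τ.p z * τ.q z + 1 ≠ 0
  sq_eq : ∀ z ∈ V, r z ^ 2 = τ.ΔSq (τ.p z) * τ.ΔSq (τ.q z)
  ne_zero : ∀ z ∈ V, r z ≠ 0
  f₅_x_ne : ∀ z ∈ V, τ.f₅ (τ.x r z) ≠ 0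
  f₅_x'_ne : ∀ z ∈ V, τ.f₅ (τ.x' r z) ≠ 0

end Period

/-- On `V`, the functions `X`, `X'` and suitable holomorphic branches `y = √f(X)`, `y' = √f(X')`
satisfy, for both `i`, the identity of differentials
`g i X dX / √f(X) + g i X' dX' / √f(X') = ω i`. -/
def SolvesInversion (f : ℂ → ℂ) (g : Fin 2 → ℂ → ℂ) (ω : Fin 2 → ℂ × ℂ →L[ℂ] ℂ)
    (V : Set (ℂ × ℂ)) (X X' : ℂ × ℂ → ℂ) : Prop :=
  DifferentiableOn ℂ X V ∧ DifferentiableOn ℂ X' V ∧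
  ∃ y y' : ℂ × ℂ → ℂ, DifferentiableOn ℂ y V ∧ DifferentiableOn ℂ y' V ∧
    ∀ z ∈ V, y z ≠ 0 ∧ y' z ≠ 0 ∧ y z ^ 2 = f (X z) ∧ y' z ^ 2 = f (X' z) ∧
      ∀ i, (g i (X z) / y z) • fderiv ℂ X z + (g i (X' z) / y' z) • fderiv ℂ X' z = ω i

/-- `℘₂₂ = X + X'` for a solution `X, X'` of the inversion problem. -/
def wp₂₂ (X X' : ℂ × ℂ → ℂ) (U : ℂ × ℂ) : ℂ := X U + X' U

/-- `℘₁₂ = -X X'` for a solution `X, X'` of the inversion problem. -/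
def wp₁₂ (X X' : ℂ × ℂ → ℂ) (U : ℂ × ℂ) : ℂ := -(X U * X' U)

/-!
The addition theorem turns every square and every product of complementary pairs among the `Pᵢ` and
`Sᵢ` into a quadratic form in the theta functions of `2τ`, and eliminating those leaves a quartic
relation between `P₁, S₁, P₂, S₂` (a Kummer surface). Differentiating the addition theorem at
`w = 0` gives the Wronskians `P₁ dS₁ - S₁ dP₁` and `P₂ dS₂ - S₂ dP₂` as combinations of `μ` and `ν`
with the even coefficients `(S₃P₃ ± S₀P₀)/2`. Modulo the quartic, the coefficient of `ν` in `dx` has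
a square which factors through the linear factors of `f₅(x)` and `1 - m₁x'`; this produces a
holomorphic root of `f₅(x)` and both equations of the inversion system at once, the equation for
`x'` being the one for `x` with the opposite branch of `Δ(p)Δ(q)`.

The coordinates are invertible because `μ` and `ν` have no common zero. Along a common zero `e` the
ratios `p`, `q` and `P₂/P₁` are constant, so near the origin `P₁(z + w)P₁(z - w)` is constant in the
direction `e` up to the factor `P₁(z)²`; hence the logarithmic derivative of `P₁` in the direction
`e` satisfies the midpoint equation, so it is affine, and quasi-periodicity of `P₁` forces `e = 0`.
-/

namespace Period

/-- Twice the period matrix, so that `Θ` is the theta function `ϑ` of `τ.double`. -/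
noncomputable def double (τ : Period) : Period where
  τ₁₁ := 2 * τ.τ₁₁
  τ₂₂ := 2 * τ.τ₂₂
  τ₁₂ := 2 * τ.τ₁₂
  im_pos₁₁ := by simpa using τ.im_pos₁₁
  im_pos₂₂ := by simpa using τ.im_pos₂₂
  im_det_pos := by
    have := τ.im_det_pos
    simp only [mul_im, re_ofNat, im_ofNat, zero_mul, add_zero]
    nlinarith

variable (τ : Period) (a c b d : ℝ)

theorem bigTheta_eq_theta_double : τ.bigTheta a c b d = τ.double.theta a c b d := rfl

/-! ### Termwise differentiation of theta series -/

/-- The `k`-th term of the theta series. -/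
noncomputable def thetaTerm (z : ℂ × ℂ) (k : ℤ × ℤ) : ℂ :=
  exp (Real.pi * I * (τ.τ₁₁ * ((k.1 : ℂ) + a / 2) ^ 2 + τ.τ₂₂ * ((k.2 : ℂ) + c / 2) ^ 2
        + 2 * τ.τ₁₂ * ((k.1 : ℂ) + a / 2) * ((k.2 : ℂ) + c / 2))
      + 2 * Real.pi * I * (((k.1 : ℂ) + a / 2) * (z.1 + b / 2)
        + ((k.2 : ℂ) + c / 2) * (z.2 + d / 2)))

/-- The `ℓ¹` norm of the shifted lattice point `(k₁ + a / 2, k₂ + c / 2)`. -/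
noncomputable def shiftedNorm (k : ℤ × ℤ) : ℝ := |k.1 + a / 2| + |k.2 + c / 2|

/-- The linear form whose exponential is the dependence of the `k`-th term of the theta series on
`z`. -/
noncomputable def frequency (k : ℤ × ℤ) : ℂ × ℂ →L[ℂ] ℂ :=
  (2 * Real.pi * I) • (((k.1 : ℂ) + a / 2) • ContinuousLinearMap.fst ℂ ℂ ℂ
    + ((k.2 : ℂ) + c / 2) • ContinuousLinearMap.snd ℂ ℂ ℂ)

theorem theta_eq_tsum (z : ℂ × ℂ) : τ.theta a c b d z = ∑' k, τ.thetaTerm a c b d z k := rfl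

theorem exists_mul_sq_add_sq_le_im_quadraticForm : ∃ ε > 0, ∀ x y : ℝ,
    ε * (x ^ 2 + y ^ 2) ≤ τ.τ₁₁.im * x ^ 2 + τ.τ₂₂.im * y ^ 2 + 2 * τ.τ₁₂.im * x * y := by
  have h₁ := τ.im_pos₁₁
  have h₂ := τ.im_pos₂₂
  have hdet := τ.im_det_pos
  refine ⟨(τ.τ₁₁.im * τ.τ₂₂.im - τ.τ₁₂.im ^ 2) / (τ.τ₁₁.im + τ.τ₂₂.im), by positivity,
    fun x y => ?_⟩
  rw [div_mul_eq_mul_div, div_le_iff₀ (by positivity)]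
  nlinarith [sq_nonneg (τ.τ₁₁.im * x + τ.τ₁₂.im * y), sq_nonneg (τ.τ₁₂.im * x + τ.τ₂₂.im * y)]

theorem intCast_add_half_eq_ofReal (n : ℤ) (s : ℝ) :
    (n : ℂ) + s / 2 = ((n + s / 2 : ℝ) : ℂ) := by
  push_cast
  ring

theorem norm_thetaTerm (z : ℂ × ℂ) (k : ℤ × ℤ) :
    ‖τ.thetaTerm a c b d z k‖ = Real.exp (-Real.pi * (τ.τ₁₁.im * (k.1 + a / 2) ^ 2
      + τ.τ₂₂.im * (k.2 + c / 2) ^ 2 + 2 * τ.τ₁₂.im * (k.1 + a / 2) * (k.2 + c / 2))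
      - 2 * Real.pi * ((k.1 + a / 2) * z.1.im + (k.2 + c / 2) * z.2.im)) := by
  have hb : (b : ℂ) / 2 = ((b / 2 : ℝ) : ℂ) := by push_cast; ring
  have hd : (d : ℂ) / 2 = ((d / 2 : ℝ) : ℂ) := by push_cast; ring
  rw [thetaTerm, norm_exp, intCast_add_half_eq_ofReal, intCast_add_half_eq_ofReal, hb, hd]
  congr 1
  simp only [← ofReal_pow, add_re, mul_re, mul_im, add_im, ofReal_re, ofReal_im, I_re, I_im,
    re_ofNat, im_ofNat]
  ring

theorem exists_neg_mul_sq_add_mul_abs_le {A : ℝ} (hA : 0 < A) (B s : ℝ) : ∃ C : ℝ, ∀ x : ℝ,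
    -A * (x + s) ^ 2 + B * |x + s| ≤ C - |x| := by
  refine ⟨(B + 1) ^ 2 / (4 * A) + |s|, fun x => ?_⟩
  have habs : |x| ≤ |x + s| + |s| := by simpa using abs_sub (x + s) s
  have hsq : (B + 1) * |x + s| - A * (x + s) ^ 2 ≤ (B + 1) ^ 2 / (4 * A) := by
    rw [le_div_iff₀ (by positivity), ← sq_abs (x + s)]
    nlinarith [sq_nonneg (2 * A * |x + s| - (B + 1))]
  linarith

theorem exists_exp_mul_norm_thetaTerm_le (R M : ℝ) : ∃ C : ℝ, ∀ z : ℂ × ℂ, ‖z‖ ≤ R → ∀ k : ℤ × ℤ,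
    Real.exp (M * shiftedNorm a c k) * ‖τ.thetaTerm a c b d z k‖
      ≤ C * (Real.exp (-|(k.1 : ℝ)|) * Real.exp (-|(k.2 : ℝ)|)) := by
  obtain ⟨ε, hε, hquad⟩ := τ.exists_mul_sq_add_sq_le_im_quadraticForm
  have hA : 0 < Real.pi * ε := mul_pos Real.pi_pos hε
  obtain ⟨C₁, hC₁⟩ := exists_neg_mul_sq_add_mul_abs_le hA (2 * Real.pi * R + M) (a / 2)
  obtain ⟨C₂, hC₂⟩ := exists_neg_mul_sq_add_mul_abs_le hA (2 * Real.pi * R + M) (c / 2)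
  refine ⟨Real.exp (C₁ + C₂), fun z hz k => ?_⟩
  rw [norm_thetaTerm, shiftedNorm, ← Real.exp_add, ← Real.exp_add, ← Real.exp_add,
    Real.exp_le_exp]
  have him₁ : |z.1.im| ≤ R := (abs_im_le_norm _).trans ((norm_fst_le z).trans hz)
  have him₂ : |z.2.im| ≤ R := (abs_im_le_norm _).trans ((norm_snd_le z).trans hz)
  have bound₁ := hC₁ k.1
  have bound₂ := hC₂ k.2
  have hquad := mul_le_mul_of_nonneg_left (hquad (k.1 + a / 2) (k.2 + c / 2)) Real.pi_pos.le
  generalize (k.1 : ℝ) + a / 2 = x at *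
  generalize (k.2 : ℝ) + c / 2 = y at *
  have neg_mul_le : ∀ x w : ℝ, |w| ≤ R → -(x * w) ≤ R * |x| := fun x w hw => by
    refine (neg_le_abs _).trans ?_
    rw [abs_mul, mul_comm]
    exact mul_le_mul_of_nonneg_right hw (abs_nonneg _)
  have lin₁ := mul_le_mul_of_nonneg_left (neg_mul_le x _ him₁) Real.two_pi_pos.le
  have lin₂ := mul_le_mul_of_nonneg_left (neg_mul_le y _ him₂) Real.two_pi_pos.le
  nlinarith

theorem summable_exp_neg_abs_prod :
    Summable fun k : ℤ × ℤ => Real.exp (-|(k.1 : ℝ)|) * Real.exp (-|(k.2 : ℝ)|) := by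
  have hexp : Summable fun n : ℤ => Real.exp (-|(n : ℝ)|) := by
    apply Summable.of_nat_of_neg <;> simpa using Real.summable_exp_neg_nat
  exact hexp.mul_of_nonneg hexp (fun _ => (Real.exp_pos _).le) (fun _ => (Real.exp_pos _).le)

theorem hasFDerivAt_thetaTerm (z : ℂ × ℂ) (k : ℤ × ℤ) :
    HasFDerivAt (fun z => τ.thetaTerm a c b d z k)
      (τ.thetaTerm a c b d z k • frequency a c k) z := by
  have hfst : HasFDerivAt (fun z : ℂ × ℂ => z.1 + (b : ℂ) / 2) (.fst ℂ ℂ ℂ) z :=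
    hasFDerivAt_fst.add_const _
  have hsnd : HasFDerivAt (fun z : ℂ × ℂ => z.2 + (d : ℂ) / 2) (.snd ℂ ℂ ℂ) z :=
    hasFDerivAt_snd.add_const _
  exact ((((hfst.const_mul _).add (hsnd.const_mul _)).const_mul _).const_add _).cexp

theorem norm_frequency_le (k : ℤ × ℤ) :
    ‖frequency a c k‖ ≤ Real.exp (2 * Real.pi * shiftedNorm a c k) := by
  rw [frequency, shiftedNorm, intCast_add_half_eq_ofReal, intCast_add_half_eq_ofReal]
  generalize (k.1 : ℝ) + a / 2 = x
  generalize (k.2 : ℝ) + c / 2 = y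
  have hform : ‖(x : ℂ) • ContinuousLinearMap.fst ℂ ℂ ℂ + (y : ℂ) • ContinuousLinearMap.snd ℂ ℂ ℂ‖
      ≤ |x| + |y| := by
    refine (norm_add_le _ _).trans ?_
    rw [norm_smul, norm_smul, norm_real, norm_real, Real.norm_eq_abs, Real.norm_eq_abs]
    exact add_le_add
      (mul_le_of_le_one_right (abs_nonneg _) (ContinuousLinearMap.norm_fst_le ℂ ℂ ℂ))
      (mul_le_of_le_one_right (abs_nonneg _) (ContinuousLinearMap.norm_snd_le ℂ ℂ ℂ))
  have hnorm : ‖(2 * Real.pi * I : ℂ)‖ = 2 * Real.pi := by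
    simp [abs_of_pos Real.pi_pos]
  rw [norm_smul, hnorm]
  exact (mul_le_mul_of_nonneg_left hform Real.two_pi_pos.le).trans
    ((le_add_of_nonneg_right zero_le_one).trans (Real.add_one_le_exp _))

section Weighted

variable {τ a c} {F : Type*} [NormedAddCommGroup F] [NormedSpace ℂ F] [CompleteSpace F]
  {g : ℤ × ℤ → F} {M : ℝ}

theorem summable_thetaTerm_smul (hg : ∀ k, ‖g k‖ ≤ Real.exp (M * shiftedNorm a c k))
    (z : ℂ × ℂ) : Summable fun k => τ.thetaTerm a c b d z k • g k := by
  obtain ⟨C, hC⟩ := τ.exists_exp_mul_norm_thetaTerm_le a c b d ‖z‖ M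
  refine .of_norm_bounded (summable_exp_neg_abs_prod.mul_left C) fun k => ?_
  rw [norm_smul, mul_comm]
  exact (mul_le_mul_of_nonneg_right (hg k) (norm_nonneg _)).trans (hC z le_rfl k)

theorem hasFDerivAt_tsum_thetaTerm_smul (hg : ∀ k, ‖g k‖ ≤ Real.exp (M * shiftedNorm a c k))
    (z : ℂ × ℂ) :
    HasFDerivAt (fun z => ∑' k, τ.thetaTerm a c b d z k • g k)
      (∑' k, (τ.thetaTerm a c b d z k • frequency a c k).smulRight (g k)) z := by
  obtain ⟨C, hC⟩ := τ.exists_exp_mul_norm_thetaTerm_le a c b d (‖z‖ + 1) (2 * Real.pi + M)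
  refine hasFDerivAt_tsum_of_isPreconnected (x₀ := z) (s := Metric.ball 0 (‖z‖ + 1))
    (summable_exp_neg_abs_prod.mul_left C) Metric.isOpen_ball (convex_ball _ _).isPreconnected
    (fun k y _ => (τ.hasFDerivAt_thetaTerm a c b d y k).smul_const (g k)) (fun k y hy => ?_)
    (by simp) (summable_thetaTerm_smul b d hg z) (by simp)
  have hy : ‖y‖ ≤ ‖z‖ + 1 := (mem_ball_zero_iff.1 hy).le
  calc ‖(τ.thetaTerm a c b d y k • frequency a c k).smulRight (g k)‖
      = ‖frequency a c k‖ * ‖g k‖ * ‖τ.thetaTerm a c b d y k‖ := by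
        rw [ContinuousLinearMap.norm_smulRight_apply, norm_smul]
        ring
    _ ≤ Real.exp (2 * Real.pi * shiftedNorm a c k) * Real.exp (M * shiftedNorm a c k)
          * ‖τ.thetaTerm a c b d y k‖ := by
        gcongr
        exacts [norm_frequency_le a c k, hg k]
    _ = Real.exp ((2 * Real.pi + M) * shiftedNorm a c k) * ‖τ.thetaTerm a c b d y k‖ := by
        rw [← Real.exp_add, add_mul]
    _ ≤ _ := hC y hy k

end Weighted

theorem summable_norm_thetaTerm (z : ℂ × ℂ) : Summable fun k => ‖τ.thetaTerm a c b d z k‖ := by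
  simpa using (summable_thetaTerm_smul (τ := τ) (a := a) (c := c) (g := fun _ => (1 : ℂ)) (M := 0)
    b d (by simp) z).norm

theorem hasFDerivAt_theta (z : ℂ × ℂ) :
    HasFDerivAt (τ.theta a c b d) (∑' k, τ.thetaTerm a c b d z k • frequency a c k) z := by
  have h := hasFDerivAt_tsum_thetaTerm_smul (τ := τ) (a := a) (c := c) (g := fun _ => (1 : ℂ))
    (M := 0) b d (by simp) z
  have smulRight_one : ∀ L : ℂ × ℂ →L[ℂ] ℂ, L.smulRight 1 = L := fun L => by ext <;> simp
  simp only [smulRight_one, smul_eq_mul, mul_one] at h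
  exact h

theorem differentiable_theta : Differentiable ℂ (τ.theta a c b d) :=
  fun z => (τ.hasFDerivAt_theta a c b d z).differentiableAt

/- Mathlib has no Hartogs theorem, so the derivative is differentiated as a series as well. -/
theorem differentiable_fderiv_theta : Differentiable ℂ (fderiv ℂ (τ.theta a c b d)) := by
  rw [funext fun z => (τ.hasFDerivAt_theta a c b d z).fderiv]
  exact fun z =>
    (hasFDerivAt_tsum_thetaTerm_smul b d (norm_frequency_le a c) z).differentiableAt

/-! ### Symmetries of theta functions and the addition theorem -/

theorem theta_neg_eq_theta_neg (z : ℂ × ℂ) :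
    τ.theta a c b d (-z) = τ.theta (-a) (-c) (-b) (-d) z := by
  rw [theta_eq_tsum, theta_eq_tsum, ← (Equiv.neg (ℤ × ℤ)).tsum_eq]
  refine tsum_congr fun k => ?_
  simp only [thetaTerm, Equiv.neg_apply, Prod.fst_neg, Prod.snd_neg]
  congr 1
  push_cast
  ring

theorem theta_add_two_mul_char (m n : ℤ) :
    τ.theta (a + 2 * m) (c + 2 * n) b d = τ.theta a c b d := by
  funext z
  rw [theta_eq_tsum, theta_eq_tsum, ← (Equiv.subRight (m, n)).tsum_eq]
  refine tsum_congr fun k => ?_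
  simp only [thetaTerm, Equiv.subRight_apply, Prod.fst_sub, Prod.snd_sub]
  congr 1
  push_cast
  ring

theorem theta_add_two_mul_phase (m n : ℤ) (z : ℂ × ℂ) :
    τ.theta a c (b + 2 * m) (d + 2 * n) z
      = exp (Real.pi * I * a) ^ m * exp (Real.pi * I * c) ^ n * τ.theta a c b d z := by
  rw [theta_eq_tsum, theta_eq_tsum, ← tsum_mul_left]
  refine tsum_congr fun k => ?_
  rw [thetaTerm, thetaTerm, ← exp_int_mul, ← exp_int_mul, ← exp_add, ← exp_add,
    exp_eq_exp_iff_exists_int]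
  refine ⟨k.1 * m + k.2 * n, ?_⟩
  push_cast
  ring

theorem theta_add_int_mul_period (m n : ℤ) (z : ℂ × ℂ) :
    τ.theta a c b d (z + (τ.τ₁₁ * m + τ.τ₁₂ * n, τ.τ₁₂ * m + τ.τ₂₂ * n))
      = exp (-(Real.pi * I) * (τ.τ₁₁ * m ^ 2 + 2 * τ.τ₁₂ * m * n + τ.τ₂₂ * n ^ 2)
          - 2 * Real.pi * I * (m * (z.1 + b / 2) + n * (z.2 + d / 2)))
        * τ.theta a c b d z := by
  rw [theta_eq_tsum, theta_eq_tsum, ← tsum_mul_left, ← (Equiv.subRight (m, n)).tsum_eq]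
  refine tsum_congr fun k => ?_
  simp only [thetaTerm, Equiv.subRight_apply, Prod.fst_sub, Prod.snd_sub, Prod.fst_add,
    Prod.snd_add]
  rw [← exp_add]
  congr 1
  push_cast
  ring

theorem theta_zero_zero_add_int (m n : ℤ) (z : ℂ × ℂ) :
    τ.theta 0 0 b d (z + ((m : ℂ), (n : ℂ))) = τ.theta 0 0 b d z := by
  have hshift := τ.theta_add_two_mul_phase 0 0 b d m n z
  simp only [ofReal_zero, mul_zero, exp_zero, one_zpow, one_mul] at hshift
  rw [← hshift, theta_eq_tsum, theta_eq_tsum]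
  refine tsum_congr fun k => ?_
  simp only [thetaTerm, Prod.fst_add, Prod.snd_add]
  congr 1
  push_cast
  ring

theorem exp_pi_mul_I_mul_intCast (n : ℤ) : exp (Real.pi * I * ((n : ℝ) : ℂ)) = (-1) ^ n := by
  rw [ofReal_intCast, mul_comm, exp_int_mul, exp_pi_mul_I]

theorem theta_neg (a c b d : ℤ) (z : ℂ × ℂ) :
    τ.theta a c b d (-z) = (-1) ^ (a * b + c * d) * τ.theta a c b d z := by
  have hchar := τ.theta_add_two_mul_char (-a) (-c) (-b) (-d) a c
  have hphase := τ.theta_add_two_mul_phase a c (-b) (-d) b d z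
  rw [exp_pi_mul_I_mul_intCast, exp_pi_mul_I_mul_intCast, ← zpow_mul, ← zpow_mul,
    ← zpow_add₀ (neg_ne_zero.2 one_ne_zero)] at hphase
  ring_nf at hchar hphase ⊢
  have hsign : ((-1 : ℂ) ^ (a * b + c * d)) * (-1) ^ (a * b + c * d) = 1 := by
    rw [← mul_zpow]
    simp
  rw [theta_neg_eq_theta_neg, ← hchar, hphase, ← mul_assoc, hsign, one_mul]

theorem theta_zero_eq_zero_of_odd {a c b d : ℤ} (hodd : Odd (a * b + c * d)) :
    τ.theta a c b d 0 = 0 := by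
  have h := τ.theta_neg a c b d 0
  rw [hodd.neg_one_zpow, neg_zero] at h
  linear_combination h / 2

/-- The bijection `((n, n'), σ) ↦ (n + n' + σ, n - n')`: two integers have the same parity as their
sum up to `σ ∈ {0, 1}`. -/
def parityEquiv : (ℤ × ℤ) × Fin 2 ≃ ℤ × ℤ where
  toFun x := (x.1.1 + x.1.2 + (x.2 : ℕ), x.1.1 - x.1.2)
  invFun y := (((y.1 + y.2) / 2, (y.1 - y.2) / 2), if (y.1 + y.2) % 2 = 0 then 0 else 1)
  left_inv := by
    rintro ⟨⟨n, n'⟩, σ⟩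
    fin_cases σ
    · have h : (n + n' + 0 + (n - n')) % 2 = 0 := by lia
      simp only [Fin.zero_eta, Fin.isValue, Nat.cast_zero, h, if_true, Prod.mk.injEq, and_true]
      lia
    · have h : ¬ (n + n' + 1 + (n - n')) % 2 = 0 := by lia
      simp only [Fin.mk_one, Fin.isValue, Nat.cast_one, h, if_false, Prod.mk.injEq, and_true]
      lia
  right_inv := by
    rintro ⟨k, k'⟩
    by_cases h : (k + k') % 2 = 0
    · simp only [h, if_true, Fin.isValue, Fin.coe_ofNat_eq_mod, Nat.zero_mod, Nat.cast_zero,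
        Prod.mk.injEq]
      lia
    · simp only [h, if_false, Fin.isValue, Fin.coe_ofNat_eq_mod, Nat.mod_succ, Nat.cast_one,
        Prod.mk.injEq]
      lia

/-- `parityEquiv` in both coordinates of a pair of lattice points; it reindexes the product of two
theta series. -/
def parityEquivProd : (Fin 2 × Fin 2) × ((ℤ × ℤ) × (ℤ × ℤ)) ≃ (ℤ × ℤ) × (ℤ × ℤ) where
  toFun x :=
    (((parityEquiv ((x.2.1.1, x.2.2.1), x.1.1)).1, (parityEquiv ((x.2.1.2, x.2.2.2), x.1.2)).1),
      ((parityEquiv ((x.2.1.1, x.2.2.1), x.1.1)).2, (parityEquiv ((x.2.1.2, x.2.2.2), x.1.2)).2))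
  invFun y :=
    (((parityEquiv.symm (y.1.1, y.2.1)).2, (parityEquiv.symm (y.1.2, y.2.2)).2),
      (((parityEquiv.symm (y.1.1, y.2.1)).1.1, (parityEquiv.symm (y.1.2, y.2.2)).1.1),
        ((parityEquiv.symm (y.1.1, y.2.1)).1.2, (parityEquiv.symm (y.1.2, y.2.2)).1.2)))
  left_inv := fun x => by simp
  right_inv := fun y => by simp

theorem thetaTerm_mul_thetaTerm (a' c' b' d' : ℝ) (z w : ℂ × ℂ)
    (x : (Fin 2 × Fin 2) × ((ℤ × ℤ) × (ℤ × ℤ))) :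
    τ.thetaTerm a c b d (z + w) (parityEquivProd x).1
        * τ.thetaTerm a' c' b' d' (z - w) (parityEquivProd x).2
      = τ.double.thetaTerm ((a + a') / 2 + (x.1.1 : ℕ)) ((c + c') / 2 + (x.1.2 : ℕ))
          (b + b') (d + d') ((2 : ℂ) • z) x.2.1
        * τ.double.thetaTerm ((a - a') / 2 + (x.1.1 : ℕ)) ((c - c') / 2 + (x.1.2 : ℕ))
          (b - b') (d - d') ((2 : ℂ) • w) x.2.2 := by
  obtain ⟨⟨σ₁, σ₂⟩, ⟨n, n'⟩, ⟨l, l'⟩⟩ := x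
  simp only [thetaTerm, ← exp_add, parityEquivProd, parityEquiv, Equiv.coe_fn_mk, double,
    Prod.fst_add, Prod.snd_add, Prod.fst_sub, Prod.snd_sub, Prod.smul_fst, Prod.smul_snd,
    smul_eq_mul]
  congr 1
  push_cast
  ring

theorem theta_add_mul_theta_sub (a' c' b' d' : ℝ) (z w : ℂ × ℂ) :
    τ.theta a c b d (z + w) * τ.theta a' c' b' d' (z - w)
      = ∑ σ : Fin 2 × Fin 2,
        τ.bigTheta ((a + a') / 2 + (σ.1 : ℕ)) ((c + c') / 2 + (σ.2 : ℕ)) (b + b') (d + d')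
          ((2 : ℂ) • z)
        * τ.bigTheta ((a - a') / 2 + (σ.1 : ℕ)) ((c - c') / 2 + (σ.2 : ℕ)) (b - b') (d - d')
          ((2 : ℂ) • w) := by
  have hz := τ.summable_norm_thetaTerm a c b d (z + w)
  have hw := τ.summable_norm_thetaTerm a' c' b' d' (z - w)
  have hprod := (parityEquivProd.summable_iff.2 (hz.mul_norm hw)).of_norm
  rw [theta_eq_tsum, theta_eq_tsum, tsum_mul_tsum_of_summable_norm hz hw,
    ← parityEquivProd.tsum_eq]
  simp only [thetaTerm_mul_thetaTerm] at hprod ⊢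
  rw [hprod.tsum_prod, tsum_fintype]
  refine Finset.sum_congr rfl fun σ _ => ?_
  rw [bigTheta_eq_theta_double, bigTheta_eq_theta_double, theta_eq_tsum, theta_eq_tsum,
    tsum_mul_tsum_of_summable_norm (τ.double.summable_norm_thetaTerm _ _ _ _ _)
      (τ.double.summable_norm_thetaTerm _ _ _ _ _)]

theorem bigTheta_add_self_phase (b d : ℤ) (z : ℂ × ℂ) :
    τ.bigTheta a c (b + b) (d + d) z
      = exp (Real.pi * I * a) ^ b * exp (Real.pi * I * c) ^ d * τ.bigTheta a c 0 0 z := by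
  have hphase := τ.double.theta_add_two_mul_phase a c 0 0 b d z
  rwa [zero_add, zero_add, two_mul, two_mul] at hphase

theorem theta_add_mul_theta_sub_of_same_phase (a' c' : ℝ) (b d : ℤ) (z w : ℂ × ℂ) :
    τ.theta a c b d (z + w) * τ.theta a' c' b d (z - w)
      = ∑ σ : Fin 2 × Fin 2,
        exp (Real.pi * I * ((a + a') / 2 + (σ.1 : ℕ))) ^ b
          * exp (Real.pi * I * ((c + c') / 2 + (σ.2 : ℕ))) ^ d
          * τ.bigTheta ((a + a') / 2 + (σ.1 : ℕ)) ((c + c') / 2 + (σ.2 : ℕ)) 0 0 ((2 : ℂ) • z)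
          * τ.bigTheta ((a - a') / 2 + (σ.1 : ℕ)) ((c - c') / 2 + (σ.2 : ℕ)) 0 0
            ((2 : ℂ) • w) := by
  rw [theta_add_mul_theta_sub]
  refine Finset.sum_congr rfl fun σ _ => ?_
  rw [sub_self, sub_self, bigTheta_add_self_phase]
  push_cast
  rfl

/-- `Θ[0 0; 0 0](2z)`, whose value at `0` is the theta constant `t`. -/
noncomputable def X₀ (z : ℂ × ℂ) : ℂ := τ.bigTheta 0 0 0 0 ((2 : ℂ) • z)

/-- `Θ[1 0; 0 0](2z)`, whose value at `0` is the theta constant `u`. -/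
noncomputable def X₁ (z : ℂ × ℂ) : ℂ := τ.bigTheta 1 0 0 0 ((2 : ℂ) • z)

/-- `Θ[0 1; 0 0](2z)`, whose value at `0` is the theta constant `v`. -/
noncomputable def X₂ (z : ℂ × ℂ) : ℂ := τ.bigTheta 0 1 0 0 ((2 : ℂ) • z)

/-- `Θ[1 1; 0 0](2z)`, whose value at `0` is the theta constant `w`. -/
noncomputable def X₃ (z : ℂ × ℂ) : ℂ := τ.bigTheta 1 1 0 0 ((2 : ℂ) • z)

/-- `Θ[1 1; 1 1](2z)`, which together with `G₀` spans the products `P₀P₃`, `P₁P₂`, `S₀S₃`,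
`S₁S₂`. -/
noncomputable def G₁ (z : ℂ × ℂ) : ℂ := τ.bigTheta 1 1 1 1 ((2 : ℂ) • z)

/-- `Θ[0 0; 1 1](2z)`, the companion of `G₁`. -/
noncomputable def G₀ (z : ℂ × ℂ) : ℂ := τ.bigTheta 0 0 1 1 ((2 : ℂ) • z)

/-- `Θ[1/2 1/2; 0 0](2z)`; the function with characteristic `[-1/2 -1/2; 0 0]` is its reflection. -/
noncomputable def Θdiag (z : ℂ × ℂ) : ℂ := τ.bigTheta (1 / 2) (1 / 2) 0 0 ((2 : ℂ) • z)

/-- `Θ[1/2 -1/2; 0 0](2z)`; the function with characteristic `[-1/2 1/2; 0 0]` is its reflection. -/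
noncomputable def Θanti (z : ℂ × ℂ) : ℂ := τ.bigTheta (1 / 2) (-1 / 2) 0 0 ((2 : ℂ) • z)

theorem bigTheta_neg (z : ℂ × ℂ) : τ.bigTheta (-a) (-c) 0 0 z = τ.bigTheta a c 0 0 (-z) := by
  rw [bigTheta_eq_theta_double, bigTheta_eq_theta_double, theta_neg_eq_theta_neg, neg_zero]

theorem bigTheta_add_two_mul_char (m n : ℤ) :
    τ.bigTheta (a + 2 * m) (c + 2 * n) b d = τ.bigTheta a c b d :=
  τ.double.theta_add_two_mul_char a c b d m n

theorem bigTheta_three_halves_half (z : ℂ × ℂ) :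
    τ.bigTheta (3 / 2) (1 / 2) 0 0 ((2 : ℂ) • z) = τ.Θanti (-z) := by
  have hchar := τ.bigTheta_add_two_mul_char (-(1 / 2)) (-(-1 / 2)) 0 0 1 0
  have hneg := τ.bigTheta_neg (1 / 2) (-1 / 2) ((2 : ℂ) • z)
  rw [Θanti, smul_neg, ← hneg, ← hchar]
  norm_num

theorem bigTheta_half_three_halves (z : ℂ × ℂ) :
    τ.bigTheta (1 / 2) (3 / 2) 0 0 ((2 : ℂ) • z) = τ.Θanti z := by
  rw [Θanti, ← τ.bigTheta_add_two_mul_char (1 / 2) (-1 / 2) 0 0 0 1]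
  norm_num

theorem bigTheta_three_halves_three_halves (z : ℂ × ℂ) :
    τ.bigTheta (3 / 2) (3 / 2) 0 0 ((2 : ℂ) • z) = τ.Θdiag (-z) := by
  have hchar := τ.bigTheta_add_two_mul_char (-(1 / 2)) (-(1 / 2)) 0 0 1 1
  have hneg := τ.bigTheta_neg (1 / 2) (1 / 2) ((2 : ℂ) • z)
  rw [Θdiag, smul_neg, ← hneg, ← hchar]
  norm_num

theorem P_add_mul_P_sub (b d : ℤ) (z w : ℂ × ℂ) :
    τ.theta 0 0 b d (z + w) * τ.theta 0 0 b d (z - w)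
      = τ.X₀ z * τ.X₀ w + (-1) ^ b * (τ.X₁ z * τ.X₁ w) + (-1) ^ d * (τ.X₂ z * τ.X₂ w)
        + (-1) ^ b * (-1) ^ d * (τ.X₃ z * τ.X₃ w) := by
  rw [theta_add_mul_theta_sub_of_same_phase]
  simp only [Fintype.sum_prod_type, Fin.sum_univ_two, Fin.isValue, Fin.coe_ofNat_eq_mod,
    Nat.zero_mod, Nat.cast_zero, Nat.mod_succ, Nat.cast_one, ofReal_zero, add_zero, zero_div,
    zero_add, sub_self, mul_zero, exp_zero, one_zpow, mul_one, exp_pi_mul_I, X₀, X₁, X₂, X₃]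
  ring

theorem S_add_mul_S_sub (b d : ℤ) (z w : ℂ × ℂ) :
    τ.theta 1 1 b d (z + w) * τ.theta 1 1 b d (z - w)
      = τ.X₀ z * τ.X₃ w + (-1) ^ b * (τ.X₁ z * τ.X₂ w) + (-1) ^ d * (τ.X₂ z * τ.X₁ w)
        + (-1) ^ b * (-1) ^ d * (τ.X₃ z * τ.X₀ w) := by
  have h20 := τ.bigTheta_add_two_mul_char 0 1 0 0 1 0
  have h02 := τ.bigTheta_add_two_mul_char 1 0 0 0 0 1
  have h22 := τ.bigTheta_add_two_mul_char 0 0 0 0 1 1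
  have hexp : exp (Real.pi * I * 2) = 1 := by rw [← exp_two_pi_mul_I]; ring_nf
  rw [theta_add_mul_theta_sub_of_same_phase]
  simp only [Fintype.sum_prod_type, Fin.sum_univ_two, Fin.isValue, Fin.coe_ofNat_eq_mod,
    Nat.zero_mod, Nat.cast_zero, Nat.mod_succ, Nat.cast_one, ofReal_one, X₀, X₁, X₂, X₃]
  norm_num only [exp_pi_mul_I, mul_one, one_zpow, one_mul, hexp] at h20 h02 h22 ⊢
  rw [h20, h02, h22]
  ring

theorem S_add_mul_P_sub (b d : ℤ) (z w : ℂ × ℂ) :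
    τ.theta 1 1 b d (z + w) * τ.theta 0 0 b d (z - w)
      = I ^ b * I ^ d * (τ.Θdiag z * τ.Θdiag w)
        + (-I) ^ b * I ^ d * (τ.Θanti (-z) * τ.Θanti (-w))
        + I ^ b * (-I) ^ d * (τ.Θanti z * τ.Θanti w)
        + (-I) ^ b * (-I) ^ d * (τ.Θdiag (-z) * τ.Θdiag (-w)) := by
  have exp_half : exp (Real.pi * I * (1 / 2)) = I := by
    rw [mul_right_comm, mul_one_div, exp_pi_div_two_mul_I]
  have exp_three_halves : exp (Real.pi * I * (3 / 2)) = -I := by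
    rw [show (3 / 2 : ℂ) = 1 / 2 + 1 by norm_num, mul_add, exp_add, exp_half, mul_one,
      exp_pi_mul_I, mul_neg_one]
  rw [theta_add_mul_theta_sub_of_same_phase]
  simp only [Fintype.sum_prod_type, Fin.sum_univ_two, Fin.isValue, Fin.coe_ofNat_eq_mod,
    Nat.zero_mod, Nat.cast_zero, Nat.mod_succ, Nat.cast_one, ofReal_one, ofReal_zero]
  norm_num only [bigTheta_three_halves_half, bigTheta_half_three_halves,
    bigTheta_three_halves_three_halves, exp_half, exp_three_halves]
  rw [← Θdiag, ← Θdiag]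
  ring

theorem theta_mul_theta_complementary_phase (b d : ℤ) (z : ℂ × ℂ) :
    τ.theta a a b d z * τ.theta a a (1 - b) (1 - d) z
      = τ.G₀ 0 * τ.bigTheta a a 1 1 ((2 : ℂ) • z)
        + (-1) ^ b * (-1) ^ d * (τ.G₁ 0 * τ.bigTheta (a + 1) (a + 1) 1 1 ((2 : ℂ) • z)) := by
  have hphase : ∀ σ σ' : ℤ, τ.bigTheta σ σ' (b - (1 - b)) (d - (1 - d)) 0
      = (-1) ^ (σ * (b - 1) + σ' * (d - 1)) * τ.bigTheta σ σ' 1 1 0 := fun σ σ' => by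
    have h := τ.double.theta_add_two_mul_phase σ σ' 1 1 (b - 1) (d - 1) 0
    rw [exp_pi_mul_I_mul_intCast, exp_pi_mul_I_mul_intCast, ← zpow_mul, ← zpow_mul,
      ← zpow_add₀ (neg_ne_zero.2 one_ne_zero)] at h
    rw [bigTheta_eq_theta_double, bigTheta_eq_theta_double, ← h]
    push_cast
    ring_nf
  have h10 : τ.bigTheta 1 0 1 1 0 = 0 := by
    exact_mod_cast τ.double.theta_zero_eq_zero_of_odd (a := 1) (c := 0) (b := 1) (d := 1) (by simp)
  have h01 : τ.bigTheta 0 1 1 1 0 = 0 := by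
    exact_mod_cast τ.double.theta_zero_eq_zero_of_odd (a := 0) (c := 1) (b := 1) (d := 1) (by simp)
  have h := τ.theta_add_mul_theta_sub a a b d a a (1 - b) (1 - d) z 0
  have h₀₀ := hphase 0 0
  have h₁₀ := hphase 1 0
  have h₀₁ := hphase 0 1
  have h₁₁ := hphase 1 1
  have hsign : (-1 : ℂ) ^ (b - 1 + (d - 1)) = (-1) ^ b * (-1) ^ d := by
    rw [zpow_add₀ (by simp), zpow_sub_one₀ (by simp), zpow_sub_one₀ (by simp)]
    ring
  simp only [Int.cast_zero, Int.cast_one, h10, h01, zero_mul, zero_add, add_zero, one_mul,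
    zpow_zero, mul_zero, hsign] at h₀₀ h₁₀ h₀₁ h₁₁
  simp only [Fintype.sum_prod_type, Fin.sum_univ_two, add_zero, sub_zero, Fin.isValue,
    Fin.coe_ofNat_eq_mod, Nat.zero_mod, Nat.cast_zero, Nat.mod_succ, Nat.cast_one,
    add_self_div_two, sub_self, zero_div, zero_add, smul_zero, h₀₀, h₁₀, h₀₁, h₁₁, mul_zero,
    add_sub_cancel] at h
  rw [h, G₀, G₁, smul_zero]
  ring

theorem X₀_zero : τ.X₀ 0 = τ.t := by rw [X₀, smul_zero]; rfl

theorem X₁_zero : τ.X₁ 0 = τ.u := by rw [X₁, smul_zero]; rfl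

theorem X₂_zero : τ.X₂ 0 = τ.v := by rw [X₂, smul_zero]; rfl

theorem X₃_zero : τ.X₃ 0 = τ.w := by rw [X₃, smul_zero]; rfl

theorem P_sq (b d : ℤ) (z : ℂ × ℂ) : τ.theta 0 0 b d z ^ 2
    = τ.t * τ.X₀ z + (-1) ^ b * τ.u * τ.X₁ z + (-1) ^ d * τ.v * τ.X₂ z
      + (-1) ^ b * (-1) ^ d * τ.w * τ.X₃ z := by
  have h := τ.P_add_mul_P_sub b d z 0
  rw [add_zero, sub_zero, X₀_zero, X₁_zero, X₂_zero, X₃_zero] at h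
  linear_combination h

theorem S_sq (b d : ℤ) (z : ℂ × ℂ) : τ.theta 1 1 b d z ^ 2
    = τ.w * τ.X₀ z + (-1) ^ b * τ.v * τ.X₁ z + (-1) ^ d * τ.u * τ.X₂ z
      + (-1) ^ b * (-1) ^ d * τ.t * τ.X₃ z := by
  have h := τ.S_add_mul_S_sub b d z 0
  rw [add_zero, sub_zero, X₀_zero, X₁_zero, X₂_zero, X₃_zero] at h
  linear_combination h

theorem P₀_sq (z : ℂ × ℂ) : τ.P₀ z ^ 2
    = τ.t * τ.X₀ z - τ.u * τ.X₁ z - τ.v * τ.X₂ z + τ.w * τ.X₃ z := by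
  have h := τ.P_sq 1 1 z
  norm_num only at h
  rw [P₀]
  linear_combination h

theorem P₁_sq (z : ℂ × ℂ) : τ.P₁ z ^ 2
    = τ.t * τ.X₀ z + τ.u * τ.X₁ z - τ.v * τ.X₂ z - τ.w * τ.X₃ z := by
  have h := τ.P_sq 0 1 z
  norm_num only at h
  rw [P₁]
  linear_combination h

theorem P₂_sq (z : ℂ × ℂ) : τ.P₂ z ^ 2
    = τ.t * τ.X₀ z - τ.u * τ.X₁ z + τ.v * τ.X₂ z - τ.w * τ.X₃ z := by
  have h := τ.P_sq 1 0 z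
  norm_num only at h
  rw [P₂]
  linear_combination h

theorem P₃_sq (z : ℂ × ℂ) : τ.P₃ z ^ 2
    = τ.t * τ.X₀ z + τ.u * τ.X₁ z + τ.v * τ.X₂ z + τ.w * τ.X₃ z := by
  have h := τ.P_sq 0 0 z
  norm_num only at h
  rw [P₃]
  linear_combination h

theorem S₀_sq (z : ℂ × ℂ) : τ.S₀ z ^ 2
    = τ.w * τ.X₀ z - τ.v * τ.X₁ z - τ.u * τ.X₂ z + τ.t * τ.X₃ z := by
  have h := τ.S_sq 1 1 z
  norm_num only at h
  rw [S₀]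
  linear_combination h

theorem S₁_sq (z : ℂ × ℂ) : τ.S₁ z ^ 2
    = τ.w * τ.X₀ z + τ.v * τ.X₁ z - τ.u * τ.X₂ z - τ.t * τ.X₃ z := by
  have h := τ.S_sq 0 1 z
  norm_num only at h
  rw [S₁]
  linear_combination h

theorem S₂_sq (z : ℂ × ℂ) : τ.S₂ z ^ 2
    = τ.w * τ.X₀ z - τ.v * τ.X₁ z + τ.u * τ.X₂ z - τ.t * τ.X₃ z := by
  have h := τ.S_sq 1 0 z
  norm_num only at h
  rw [S₂]
  linear_combination h

theorem S₃_sq (z : ℂ × ℂ) : τ.S₃ z ^ 2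
    = τ.w * τ.X₀ z + τ.v * τ.X₁ z + τ.u * τ.X₂ z + τ.t * τ.X₃ z := by
  have h := τ.S_sq 0 0 z
  norm_num only at h
  rw [S₃]
  linear_combination h

theorem P₁_add_mul_P₁_sub (z w : ℂ × ℂ) : τ.P₁ (z + w) * τ.P₁ (z - w)
    = τ.X₀ z * τ.X₀ w + τ.X₁ z * τ.X₁ w - τ.X₂ z * τ.X₂ w - τ.X₃ z * τ.X₃ w := by
  have h := τ.P_add_mul_P_sub 0 1 z w
  norm_num only at h
  rw [P₁, P₁]
  linear_combination h

theorem S₀_add_mul_P₀_sub (z w : ℂ × ℂ) : τ.S₀ (z + w) * τ.P₀ (z - w)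
    = -(τ.Θdiag z * τ.Θdiag w) + τ.Θanti z * τ.Θanti w + τ.Θanti (-z) * τ.Θanti (-w)
      - τ.Θdiag (-z) * τ.Θdiag (-w) := by
  have h := τ.S_add_mul_P_sub 1 1 z w
  norm_num only [zpow_zero, zpow_one] at h
  rw [S₀, P₀, h]
  linear_combination (τ.Θdiag z * τ.Θdiag w - τ.Θanti z * τ.Θanti w - τ.Θanti (-z) * τ.Θanti (-w)
    + τ.Θdiag (-z) * τ.Θdiag (-w)) * I_sq

theorem S₁_add_mul_P₁_sub (z w : ℂ × ℂ) : τ.S₁ (z + w) * τ.P₁ (z - w)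
    = I * (τ.Θdiag z * τ.Θdiag w - τ.Θdiag (-z) * τ.Θdiag (-w)
      - (τ.Θanti z * τ.Θanti w - τ.Θanti (-z) * τ.Θanti (-w))) := by
  have h := τ.S_add_mul_P_sub 0 1 z w
  norm_num only [zpow_zero, zpow_one] at h
  rw [S₁, P₁, h]
  ring

theorem S₂_add_mul_P₂_sub (z w : ℂ × ℂ) : τ.S₂ (z + w) * τ.P₂ (z - w)
    = I * (τ.Θdiag z * τ.Θdiag w - τ.Θdiag (-z) * τ.Θdiag (-w)
      + (τ.Θanti z * τ.Θanti w - τ.Θanti (-z) * τ.Θanti (-w))) := by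
  have h := τ.S_add_mul_P_sub 1 0 z w
  norm_num only [zpow_zero, zpow_one] at h
  rw [S₂, P₂, h]
  ring

theorem S₃_add_mul_P₃_sub (z w : ℂ × ℂ) : τ.S₃ (z + w) * τ.P₃ (z - w)
    = τ.Θdiag z * τ.Θdiag w + τ.Θanti z * τ.Θanti w + τ.Θanti (-z) * τ.Θanti (-w)
      + τ.Θdiag (-z) * τ.Θdiag (-w) := by
  have h := τ.S_add_mul_P_sub 0 0 z w
  norm_num only [zpow_zero, zpow_one] at h
  rw [S₃, P₃, h]
  ring

theorem P₀_mul_P₃ (z : ℂ × ℂ) :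
    τ.P₀ z * τ.P₃ z = τ.G₀ 0 * τ.G₀ z + τ.G₁ 0 * τ.G₁ z := by
  have h := τ.theta_mul_theta_complementary_phase 0 1 1 z
  norm_num only at h
  rw [P₀, P₃, h, ← G₀, ← G₁]
  ring

theorem P₁_mul_P₂ (z : ℂ × ℂ) :
    τ.P₁ z * τ.P₂ z = τ.G₀ 0 * τ.G₀ z - τ.G₁ 0 * τ.G₁ z := by
  have h := τ.theta_mul_theta_complementary_phase 0 0 1 z
  norm_num only at h
  rw [P₁, P₂, h, ← G₀, ← G₁]
  ring

theorem S₀_mul_S₃ (z : ℂ × ℂ) :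
    τ.S₀ z * τ.S₃ z = τ.G₁ 0 * τ.G₀ z + τ.G₀ 0 * τ.G₁ z := by
  have h := τ.theta_mul_theta_complementary_phase 1 1 1 z
  have hchar := τ.bigTheta_add_two_mul_char 0 0 1 1 1 1
  norm_num only at h hchar
  rw [S₀, S₃, h, hchar, ← G₀, ← G₁]
  ring

theorem S₁_mul_S₂ (z : ℂ × ℂ) :
    τ.S₁ z * τ.S₂ z = τ.G₀ 0 * τ.G₁ z - τ.G₁ 0 * τ.G₀ z := by
  have h := τ.theta_mul_theta_complementary_phase 1 0 1 z
  have hchar := τ.bigTheta_add_two_mul_char 0 0 1 1 1 1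
  norm_num only at h hchar
  rw [S₁, S₂, h, hchar, ← G₀, ← G₁]
  ring

/-! ### Derivatives of `p` and `q` -/

theorem differentiable_P₀ : Differentiable ℂ τ.P₀ := τ.differentiable_theta _ _ _ _

theorem differentiable_P₁ : Differentiable ℂ τ.P₁ := τ.differentiable_theta _ _ _ _

theorem differentiable_P₂ : Differentiable ℂ τ.P₂ := τ.differentiable_theta _ _ _ _

theorem differentiable_P₃ : Differentiable ℂ τ.P₃ := τ.differentiable_theta _ _ _ _

theorem differentiable_S₀ : Differentiable ℂ τ.S₀ := τ.differentiable_theta _ _ _ _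

theorem differentiable_S₁ : Differentiable ℂ τ.S₁ := τ.differentiable_theta _ _ _ _

theorem differentiable_S₂ : Differentiable ℂ τ.S₂ := τ.differentiable_theta _ _ _ _

theorem differentiable_S₃ : Differentiable ℂ τ.S₃ := τ.differentiable_theta _ _ _ _

theorem differentiable_bigTheta : Differentiable ℂ (τ.bigTheta a c b d) :=
  τ.double.differentiable_theta a c b d

theorem differentiable_Θdiag : Differentiable ℂ τ.Θdiag :=
  (τ.differentiable_bigTheta _ _ _ _).comp (differentiable_id.const_smul (2 : ℂ))

theorem differentiable_Θanti : Differentiable ℂ τ.Θanti :=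
  (τ.differentiable_bigTheta _ _ _ _).comp (differentiable_id.const_smul (2 : ℂ))

theorem P₀_zero_sq : τ.P₀ 0 ^ 2 = τ.t ^ 2 - τ.u ^ 2 - τ.v ^ 2 + τ.w ^ 2 := by
  rw [P₀_sq, X₀_zero, X₁_zero, X₂_zero, X₃_zero]
  ring

theorem P₁_zero_sq : τ.P₁ 0 ^ 2 = τ.t ^ 2 + τ.u ^ 2 - τ.v ^ 2 - τ.w ^ 2 := by
  rw [P₁_sq, X₀_zero, X₁_zero, X₂_zero, X₃_zero]
  ring

theorem P₂_zero_sq : τ.P₂ 0 ^ 2 = τ.t ^ 2 - τ.u ^ 2 + τ.v ^ 2 - τ.w ^ 2 := by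
  rw [P₂_sq, X₀_zero, X₁_zero, X₂_zero, X₃_zero]
  ring

theorem P₃_zero_sq : τ.P₃ 0 ^ 2 = τ.t ^ 2 + τ.u ^ 2 + τ.v ^ 2 + τ.w ^ 2 := by
  rw [P₃_sq, X₀_zero, X₁_zero, X₂_zero, X₃_zero]
  ring

theorem S₀_zero_sq : τ.S₀ 0 ^ 2 = 2 * (τ.t * τ.w - τ.u * τ.v) := by
  rw [S₀_sq, X₀_zero, X₁_zero, X₂_zero, X₃_zero]
  ring

theorem S₃_zero_sq : τ.S₃ 0 ^ 2 = 2 * (τ.t * τ.w + τ.u * τ.v) := by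
  rw [S₃_sq, X₀_zero, X₁_zero, X₂_zero, X₃_zero]
  ring

/-- The even combination of `S₃ P₃` and `S₀ P₀` that is the coefficient of `ν` in `P₁² dp` and in
`P₂² dq`. -/
noncomputable def evenν (z : ℂ × ℂ) : ℂ := (τ.S₃ z * τ.P₃ z - τ.S₀ z * τ.P₀ z) / 2

/-- The even combination of `S₃ P₃` and `S₀ P₀` that is the coefficient of `μ` in `P₁² dp` and of
`-μ` in `P₂² dq`. -/
noncomputable def evenμ (z : ℂ × ℂ) : ℂ := (τ.S₃ z * τ.P₃ z + τ.S₀ z * τ.P₀ z) / 2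

theorem differentiable_evenν : Differentiable ℂ τ.evenν := by
  unfold evenν
  exact ((τ.differentiable_S₃.fun_mul τ.differentiable_P₃).fun_sub
    (τ.differentiable_S₀.fun_mul τ.differentiable_P₀)).mul_const _

theorem differentiable_evenμ : Differentiable ℂ τ.evenμ := by
  unfold evenμ
  exact ((τ.differentiable_S₃.fun_mul τ.differentiable_P₃).fun_add
    (τ.differentiable_S₀.fun_mul τ.differentiable_P₀)).mul_const _

theorem evenν_eq_Θdiag (z : ℂ × ℂ) :
    τ.evenν z = τ.Θdiag 0 * (τ.Θdiag z + τ.Θdiag (-z)) := by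
  have h₃ := τ.S₃_add_mul_P₃_sub z 0
  have h₀ := τ.S₀_add_mul_P₀_sub z 0
  rw [add_zero, sub_zero, neg_zero] at h₃ h₀
  rw [evenν, h₃, h₀]
  ring

theorem evenμ_eq_Θanti (z : ℂ × ℂ) :
    τ.evenμ z = τ.Θanti 0 * (τ.Θanti z + τ.Θanti (-z)) := by
  have h₃ := τ.S₃_add_mul_P₃_sub z 0
  have h₀ := τ.S₀_add_mul_P₀_sub z 0
  rw [add_zero, sub_zero, neg_zero] at h₃ h₀
  rw [evenμ, h₃, h₀]
  ring

theorem evenν_zero_mul_evenμ_zero : τ.evenν 0 * τ.evenμ 0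
    = (τ.t * τ.u + τ.v * τ.w) * (τ.t * τ.v + τ.u * τ.w) := by
  rw [evenν, evenμ]
  linear_combination (1 / 4 : ℂ) * (τ.S₃ 0 ^ 2 * τ.P₃_zero_sq
    + (τ.t ^ 2 + τ.u ^ 2 + τ.v ^ 2 + τ.w ^ 2) * τ.S₃_zero_sq - τ.S₀ 0 ^ 2 * τ.P₀_zero_sq
    - (τ.t ^ 2 - τ.u ^ 2 - τ.v ^ 2 + τ.w ^ 2) * τ.S₀_zero_sq)

section Nondegenerate

variable {τ}

theorem Nondegenerate.evenν_zero_mul_evenμ_zero_ne (h : τ.Nondegenerate) :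
    τ.evenν 0 * τ.evenμ 0 ≠ 0 := by
  rw [evenν_zero_mul_evenμ_zero]
  exact mul_ne_zero h.tuvw_add h.tvuw_add

theorem Nondegenerate.Θdiag_zero_ne (h : τ.Nondegenerate) : τ.Θdiag 0 ≠ 0 :=
  left_ne_zero_of_mul (τ.evenν_eq_Θdiag 0 ▸ left_ne_zero_of_mul h.evenν_zero_mul_evenμ_zero_ne)

theorem Nondegenerate.Θanti_zero_ne (h : τ.Nondegenerate) : τ.Θanti 0 ≠ 0 :=
  left_ne_zero_of_mul (τ.evenμ_eq_Θanti 0 ▸ right_ne_zero_of_mul h.evenν_zero_mul_evenμ_zero_ne)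

theorem Nondegenerate.P₁_zero_ne (h : τ.Nondegenerate) : τ.P₁ 0 ≠ 0 := by
  rw [← sq_eq_zero_iff.ne, P₁_zero_sq]
  exact h.sq_one

theorem Nondegenerate.P₂_zero_ne (h : τ.Nondegenerate) : τ.P₂ 0 ≠ 0 := by
  rw [← sq_eq_zero_iff.ne, P₂_zero_sq]
  exact h.sq_two

end Nondegenerate

section Calculus

variable {E : Type*} [NormedAddCommGroup E] [NormedSpace ℂ E] {f g : E → ℂ}

theorem deriv_sub_comp_neg_smul (hf : DifferentiableAt ℂ f 0) (e : E) :
    deriv (fun s : ℂ => f (s • e) - f (-(s • e))) 0 = 2 * fderiv ℂ f 0 e := by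
  have hline : HasDerivAt (fun s : ℂ => s • e) e 0 := by
    simpa only [id, one_smul] using (hasDerivAt_id (0 : ℂ)).smul_const e
  have hpos : HasFDerivAt f (fderiv ℂ f 0) ((0 : ℂ) • e) := by
    rw [zero_smul]
    exact hf.hasFDerivAt
  have hneg : HasFDerivAt f (fderiv ℂ f 0) (-((0 : ℂ) • e)) := by
    rw [zero_smul, neg_zero]
    exact hf.hasFDerivAt
  have h := (hpos.comp_hasDerivAt 0 hline).sub (hneg.comp_hasDerivAt 0 hline.neg)
  rw [map_neg, sub_neg_eq_add, ← two_mul] at h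
  exact h.deriv

theorem hasFDerivAt_add_mul_sub {z : E} (hf : DifferentiableAt ℂ f z)
    (hg : DifferentiableAt ℂ g z) :
    HasFDerivAt (fun w => f (z + w) * g (z - w)) (g z • fderiv ℂ f z - f z • fderiv ℂ g z) 0 := by
  have hf₀ : HasFDerivAt f (fderiv ℂ f z) (z + 0) := by simpa only [add_zero] using hf.hasFDerivAt
  have hg₀ : HasFDerivAt g (fderiv ℂ g z) (z - 0) := by simpa only [sub_zero] using hg.hasFDerivAt
  have h := (hf₀.comp 0 ((hasFDerivAt_id (𝕜 := ℂ) (0 : E)).const_add z)).mul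
    (hg₀.comp 0 ((hasFDerivAt_id (𝕜 := ℂ) (0 : E)).const_sub z))
  refine h.congr_fderiv ?_
  ext e
  simp [← sub_eq_neg_add]

theorem hasFDerivAt_mul_sub_mul_comp_neg (hf : DifferentiableAt ℂ f 0) (r s : ℂ) :
    HasFDerivAt (fun w => r * f w - s * f (-w)) ((r + s) • fderiv ℂ f 0) 0 := by
  have hneg : HasFDerivAt f (fderiv ℂ f 0) (-0) := by rw [neg_zero]; exact hf.hasFDerivAt
  have h := (hf.hasFDerivAt.const_mul r).sub
    ((hneg.comp 0 (hasFDerivAt_id (𝕜 := ℂ) (0 : E)).neg).const_mul s)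
  refine h.congr_fderiv ?_
  ext e
  simp [add_mul]

theorem wronskian_eq_of_add_mul_sub {A B : E → ℂ} {ε : ℂ} {z : E} (hf : DifferentiableAt ℂ f z)
    (hg : DifferentiableAt ℂ g z) (hA : DifferentiableAt ℂ A 0) (hB : DifferentiableAt ℂ B 0)
    (hfg : ∀ w, f (z + w) * g (z - w)
      = I * (A z * A w - A (-z) * A (-w) + ε * (B z * B w - B (-z) * B (-w)))) (e : E) :
    g z * fderiv ℂ f z e - f z * fderiv ℂ g z e
      = I * ((A z + A (-z)) * fderiv ℂ A 0 e + ε * ((B z + B (-z)) * fderiv ℂ B 0 e)) := by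
  have hleft := hasFDerivAt_add_mul_sub hf hg
  have hright := ((hasFDerivAt_mul_sub_mul_comp_neg hA (A z) (A (-z))).add
    ((hasFDerivAt_mul_sub_mul_comp_neg hB (B z) (B (-z))).const_mul ε)).const_mul I
  have h := DFunLike.congr_fun ((funext hfg ▸ hleft).unique hright) e
  simpa only [_root_.smul_apply, _root_.add_apply, _root_.sub_apply, smul_eq_mul] using h

theorem apply_prod_eq (φ : ℂ × ℂ →L[ℂ] ℂ) (e : ℂ × ℂ) :
    φ e = φ (1, 0) * e.1 + φ (0, 1) * e.2 := by
  conv_lhs => rw [show e = e.1 • ((1 : ℂ), (0 : ℂ)) + e.2 • ((0 : ℂ), (1 : ℂ)) by ext <;> simp]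
  rw [map_add, map_smul, map_smul, smul_eq_mul, smul_eq_mul, mul_comm, mul_comm e.2]

end Calculus

theorem deriv_bigTheta_sub_bigTheta_neg (e : ℂ × ℂ) :
    deriv (fun s : ℂ => τ.bigTheta a c 0 0 (s • e) - τ.bigTheta (-a) (-c) 0 0 (s • e)) 0
      = fderiv ℂ (fun z => τ.bigTheta a c 0 0 ((2 : ℂ) • z)) 0 e := by
  simp only [bigTheta_neg]
  rw [deriv_sub_comp_neg_smul (τ.differentiable_bigTheta a c 0 0 0), fderiv_comp_smul, smul_zero]
  rfl

theorem fderiv_Θdiag_zero_apply (e : ℂ × ℂ) :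
    fderiv ℂ τ.Θdiag 0 e = τ.α * e.1 + τ.γ * e.2 := by
  have h := fun e => τ.deriv_bigTheta_sub_bigTheta_neg (1 / 2) (1 / 2) e
  have h₁ := h (1, 0)
  have h₂ := h (0, 1)
  simp only [← neg_div, Prod.smul_mk, smul_eq_mul, mul_one, mul_zero] at h₁ h₂
  rw [apply_prod_eq, α, γ, h₁, h₂]
  rfl

theorem fderiv_Θanti_zero_apply (e : ℂ × ℂ) :
    fderiv ℂ τ.Θanti 0 e = τ.β * e.1 + τ.δ * e.2 := by
  have h := fun e => τ.deriv_bigTheta_sub_bigTheta_neg (1 / 2) (-1 / 2) e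
  have h₁ := h (1, 0)
  have h₂ := h (0, 1)
  simp only [← neg_div, neg_neg, Prod.smul_mk, smul_eq_mul, mul_one, mul_zero] at h₁ h₂
  rw [apply_prod_eq, β, δ, h₁, h₂]
  rfl

theorem Θdiag_zero : τ.Θdiag 0 = τ.bigTheta (1 / 2) (1 / 2) 0 0 (0, 0) := by
  rw [Θdiag, smul_zero, Prod.mk_zero_zero]

theorem Θanti_zero : τ.Θanti 0 = τ.bigTheta (1 / 2) (-1 / 2) 0 0 (0, 0) := by
  rw [Θanti, smul_zero, Prod.mk_zero_zero]

variable {τ}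

theorem Nondegenerate.Θdiag_zero_mul_ν (h : τ.Nondegenerate) (e : ℂ × ℂ) :
    τ.Θdiag 0 * τ.ν e = I * fderiv ℂ τ.Θdiag 0 e := by
  rw [fderiv_Θdiag_zero_apply, ν, ← Θdiag_zero]
  simp only [_root_.smul_apply, _root_.add_apply, smul_eq_mul, ContinuousLinearMap.coe_fst',
    ContinuousLinearMap.coe_snd']
  rw [← mul_assoc, mul_div_cancel₀ _ h.Θdiag_zero_ne]

theorem Nondegenerate.Θanti_zero_mul_μ (h : τ.Nondegenerate) (e : ℂ × ℂ) :
    τ.Θanti 0 * τ.μ e = -I * fderiv ℂ τ.Θanti 0 e := by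
  rw [fderiv_Θanti_zero_apply, μ, ← Θanti_zero]
  simp only [_root_.smul_apply, _root_.add_apply, smul_eq_mul, ContinuousLinearMap.coe_fst',
    ContinuousLinearMap.coe_snd']
  rw [← mul_assoc, mul_div_cancel₀ _ h.Θanti_zero_ne]

theorem Nondegenerate.wronskian₁ (h : τ.Nondegenerate) (z e : ℂ × ℂ) :
    τ.P₁ z * fderiv ℂ τ.S₁ z e - τ.S₁ z * fderiv ℂ τ.P₁ z e
      = τ.evenν z * τ.ν e + τ.evenμ z * τ.μ e := by
  have hw := wronskian_eq_of_add_mul_sub (ε := -1) (τ.differentiable_S₁ z)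
    (τ.differentiable_P₁ z) (τ.differentiable_Θdiag 0) (τ.differentiable_Θanti 0)
    (fun w => (τ.S₁_add_mul_P₁_sub z w).trans (by ring)) e
  rw [hw, evenν_eq_Θdiag, evenμ_eq_Θanti]
  linear_combination -(τ.Θdiag z + τ.Θdiag (-z)) * h.Θdiag_zero_mul_ν e
    - (τ.Θanti z + τ.Θanti (-z)) * h.Θanti_zero_mul_μ e

theorem Nondegenerate.wronskian₂ (h : τ.Nondegenerate) (z e : ℂ × ℂ) :
    τ.P₂ z * fderiv ℂ τ.S₂ z e - τ.S₂ z * fderiv ℂ τ.P₂ z e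
      = τ.evenν z * τ.ν e - τ.evenμ z * τ.μ e := by
  have hw := wronskian_eq_of_add_mul_sub (ε := 1) (τ.differentiable_S₂ z)
    (τ.differentiable_P₂ z) (τ.differentiable_Θdiag 0) (τ.differentiable_Θanti 0)
    (fun w => (τ.S₂_add_mul_P₂_sub z w).trans (by ring)) e
  rw [hw, evenν_eq_Θdiag, evenμ_eq_Θanti]
  linear_combination -(τ.Θdiag z + τ.Θdiag (-z)) * h.Θdiag_zero_mul_ν e
    + (τ.Θanti z + τ.Θanti (-z)) * h.Θanti_zero_mul_μ e

/-! ### The parameters of the quintic -/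

section Parameters

variable (τ) in
/-- Half the denominator of `E`. -/
noncomputable def denE : ℂ := (τ.t * τ.u + τ.v * τ.w) * (τ.t * τ.v + τ.u * τ.w)

variable (τ) in
/-- Half the denominator of `C`. -/
noncomputable def denC : ℂ := (τ.t * τ.u - τ.v * τ.w) * (τ.t * τ.v - τ.u * τ.w)

variable (τ) in
/-- The denominator of `F`. -/
noncomputable def denF : ℂ :=
  (τ.t ^ 2 + τ.u ^ 2 - τ.v ^ 2 - τ.w ^ 2) * (τ.t ^ 2 - τ.u ^ 2 + τ.v ^ 2 - τ.w ^ 2)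

variable (τ) in
/-- The numerator of `4 rootCE`. -/
noncomputable def numRootCE : ℂ := (τ.t ^ 2 - τ.w ^ 2) ^ 2 * (τ.u ^ 2 - τ.v ^ 2) ^ 2

variable (τ) in
/-- A quarter of the numerator of `b` over the denominator `denF`; thus `b` and `b₁` are
`4 numb / denF` and `4 rootD / denF`. -/
noncomputable def numb : ℂ :=
  τ.t * τ.w * (τ.t ^ 2 + τ.w ^ 2) + τ.u * τ.v * (τ.u ^ 2 + τ.v ^ 2)

variable (τ) in
theorem denF_eq : τ.denF = (τ.t ^ 2 - τ.w ^ 2) ^ 2 - (τ.u ^ 2 - τ.v ^ 2) ^ 2 := by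
  rw [denF]
  ring

variable (τ) in
theorem rootD_sq : τ.rootD ^ 2 = τ.numb ^ 2 - τ.denE ^ 2 := by
  rw [rootD, Prod.mk_zero_zero, div_pow, neg_sq, mul_pow, mul_pow, mul_pow, P₃_zero_sq, P₀_zero_sq,
    S₃_zero_sq, S₀_zero_sq, numb, denE]
  ring

theorem Nondegenerate.denE_ne (h : τ.Nondegenerate) : τ.denE ≠ 0 :=
  mul_ne_zero h.tuvw_add h.tvuw_add

theorem Nondegenerate.denC_ne (h : τ.Nondegenerate) : τ.denC ≠ 0 :=
  mul_ne_zero h.tuvw_sub h.tvuw_sub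

theorem Nondegenerate.denF_ne (h : τ.Nondegenerate) : τ.denF ≠ 0 :=
  mul_ne_zero h.sq_one h.sq_two

theorem Nondegenerate.numRootCE_ne (h : τ.Nondegenerate) : τ.numRootCE ≠ 0 :=
  mul_ne_zero (pow_ne_zero 2 h.tw) (pow_ne_zero 2 h.uv)

theorem Nondegenerate.E_mul_denE (h : τ.Nondegenerate) : τ.E * (2 * τ.denE)
    = (τ.u ^ 2 + τ.v ^ 2) * (τ.t ^ 2 + τ.w ^ 2) + 4 * (τ.t * τ.w) * (τ.u * τ.v) := by
  rw [denE, ← mul_assoc 2, E, div_mul_cancel₀ _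
    (mul_ne_zero (mul_ne_zero two_ne_zero h.tuvw_add) h.tvuw_add)]
  ring

theorem Nondegenerate.C_mul_denC (h : τ.Nondegenerate) : τ.C * (2 * τ.denC)
    = (τ.u ^ 2 + τ.v ^ 2) * (τ.t ^ 2 + τ.w ^ 2) - 4 * (τ.t * τ.w) * (τ.u * τ.v) := by
  rw [denC, ← mul_assoc 2, C, div_mul_cancel₀ _
    (mul_ne_zero (mul_ne_zero two_ne_zero h.tuvw_sub) h.tvuw_sub)]
  ring

theorem Nondegenerate.F_mul_denF (h : τ.Nondegenerate) :
    τ.F * τ.denF = (τ.t ^ 2 - τ.w ^ 2) ^ 2 + (τ.u ^ 2 - τ.v ^ 2) ^ 2 := by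
  rw [F, ← denF, div_mul_cancel₀ _ h.denF_ne]
  ring

theorem Nondegenerate.D_mul (h : τ.Nondegenerate) :
    τ.D * (τ.denF * τ.denE * τ.denC) = τ.numRootCE * τ.rootD := by
  have hden : (τ.t ^ 2 + τ.u ^ 2 - τ.v ^ 2 - τ.w ^ 2) * (τ.t ^ 2 - τ.u ^ 2 + τ.v ^ 2 - τ.w ^ 2)
      * (τ.t ^ 2 * τ.u ^ 2 - τ.v ^ 2 * τ.w ^ 2) * (τ.t ^ 2 * τ.v ^ 2 - τ.u ^ 2 * τ.w ^ 2)
      = τ.denF * τ.denE * τ.denC := by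
    rw [denF, denE, denC]
    ring
  rw [D, hden, ← numRootCE, div_mul_cancel₀]
  exact mul_ne_zero (mul_ne_zero h.denF_ne h.denE_ne) h.denC_ne

theorem Nondegenerate.rootCE_mul (h : τ.Nondegenerate) :
    τ.rootCE * (4 * (τ.denE * τ.denC)) = τ.numRootCE := by
  have hden : 4 * (τ.t ^ 2 * τ.u ^ 2 - τ.v ^ 2 * τ.w ^ 2)
      * (τ.t ^ 2 * τ.v ^ 2 - τ.u ^ 2 * τ.w ^ 2) = 4 * (τ.denE * τ.denC) := by
    rw [denE, denC]
    ring
  rw [rootCE, hden, ← numRootCE, div_mul_cancel₀]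
  exact mul_ne_zero (by norm_num) (mul_ne_zero h.denE_ne h.denC_ne)

theorem Nondegenerate.E_sq_sub_one_mul (h : τ.Nondegenerate) :
    (τ.E ^ 2 - 1) * (4 * τ.denE ^ 2) = τ.numRootCE := by
  have hE := congrArg (· ^ 2) h.E_mul_denE
  rw [numRootCE]
  rw [denE] at hE ⊢
  linear_combination hE

theorem Nondegenerate.C_sq_sub_one_mul (h : τ.Nondegenerate) :
    (τ.C ^ 2 - 1) * (4 * τ.denC ^ 2) = τ.numRootCE := by
  have hC := congrArg (· ^ 2) h.C_mul_denC
  rw [numRootCE]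
  rw [denC] at hC ⊢
  linear_combination hC

theorem Nondegenerate.F_sub_one_mul (h : τ.Nondegenerate) :
    (τ.F - 1) * τ.denF = 2 * (τ.u ^ 2 - τ.v ^ 2) ^ 2 := by
  linear_combination h.F_mul_denF - τ.denF_eq

theorem Nondegenerate.F_add_one_mul (h : τ.Nondegenerate) :
    (τ.F + 1) * τ.denF = 2 * (τ.t ^ 2 - τ.w ^ 2) ^ 2 := by
  linear_combination h.F_mul_denF + τ.denF_eq

theorem Nondegenerate.F_sq_sub_one_mul (h : τ.Nondegenerate) :
    (τ.F ^ 2 - 1) * τ.denF ^ 2 = 4 * τ.numRootCE := by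
  rw [numRootCE]
  linear_combination (τ.F + 1) * τ.denF * h.F_sub_one_mul
    + 2 * (τ.u ^ 2 - τ.v ^ 2) ^ 2 * h.F_add_one_mul

theorem Nondegenerate.CF_sub_E_mul (h : τ.Nondegenerate) :
    (τ.C * τ.F - τ.E) * (τ.denF * τ.denE * τ.denC) = τ.numRootCE * τ.numb := by
  have hE := h.E_mul_denE
  have hCF := congrArg₂ (· * ·) h.C_mul_denC h.F_mul_denF
  rw [denF_eq] at hCF ⊢
  rw [denC] at hCF ⊢
  rw [denE] at hE ⊢
  rw [numRootCE, numb]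
  linear_combination (τ.t * τ.u + τ.v * τ.w) * (τ.t * τ.v + τ.u * τ.w) / 2 * hCF
    - ((τ.t ^ 2 - τ.w ^ 2) ^ 2 - (τ.u ^ 2 - τ.v ^ 2) ^ 2)
      * ((τ.t * τ.u - τ.v * τ.w) * (τ.t * τ.v - τ.u * τ.w)) / 2 * hE

theorem Nondegenerate.CF_sub_E_sq_sub_D_sq (h : τ.Nondegenerate) :
    (τ.C * τ.F - τ.E) ^ 2 - τ.D ^ 2 = (τ.C ^ 2 - 1) * (τ.F ^ 2 - 1) := by
  have hden : (τ.denF * τ.denE * τ.denC) ^ 2 ≠ 0 :=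
    pow_ne_zero 2 (mul_ne_zero (mul_ne_zero h.denF_ne h.denE_ne) h.denC_ne)
  refine mul_right_cancel₀ hden ?_
  calc ((τ.C * τ.F - τ.E) ^ 2 - τ.D ^ 2) * (τ.denF * τ.denE * τ.denC) ^ 2
      = τ.numRootCE ^ 2 * τ.denE ^ 2 := by
        rw [sub_mul, ← mul_pow, ← mul_pow, h.CF_sub_E_mul, h.D_mul]
        linear_combination -τ.numRootCE ^ 2 * τ.rootD_sq
    _ = (τ.C ^ 2 - 1) * (τ.F ^ 2 - 1) * (τ.denF * τ.denE * τ.denC) ^ 2 := by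
        linear_combination -τ.denE ^ 2 * τ.numRootCE * h.C_sq_sub_one_mul
          - τ.denE ^ 2 * (τ.C ^ 2 - 1) * τ.denC ^ 2 * h.F_sq_sub_one_mul

theorem Nondegenerate.D_sq (h : τ.Nondegenerate) :
    τ.D ^ 2 = τ.C ^ 2 + τ.E ^ 2 + τ.F ^ 2 - 2 * τ.C * τ.E * τ.F - 1 := by
  linear_combination -h.CF_sub_E_sq_sub_D_sq

theorem Nondegenerate.E_sq_sub_one_ne (h : τ.Nondegenerate) : τ.E ^ 2 - 1 ≠ 0 :=
  left_ne_zero_of_mul (h.E_sq_sub_one_mul ▸ h.numRootCE_ne)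

theorem Nondegenerate.F_sq_sub_one_ne (h : τ.Nondegenerate) : τ.F ^ 2 - 1 ≠ 0 :=
  left_ne_zero_of_mul (h.F_sq_sub_one_mul ▸ mul_ne_zero (by norm_num) h.numRootCE_ne)

theorem sub_one_ne_zero_of_sq_sub_one_ne_zero {x : ℂ} (hx : x ^ 2 - 1 ≠ 0) : x - 1 ≠ 0 :=
  fun h => hx (by linear_combination (x + 1) * h)

theorem add_one_ne_zero_of_sq_sub_one_ne_zero {x : ℂ} (hx : x ^ 2 - 1 ≠ 0) : x + 1 ≠ 0 :=
  fun h => hx (by linear_combination (x - 1) * h)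

theorem Nondegenerate.E_sub_one_ne (h : τ.Nondegenerate) : τ.E - 1 ≠ 0 :=
  sub_one_ne_zero_of_sq_sub_one_ne_zero h.E_sq_sub_one_ne

theorem Nondegenerate.E_add_one_ne (h : τ.Nondegenerate) : τ.E + 1 ≠ 0 :=
  add_one_ne_zero_of_sq_sub_one_ne_zero h.E_sq_sub_one_ne

theorem Nondegenerate.F_sub_one_ne (h : τ.Nondegenerate) : τ.F - 1 ≠ 0 :=
  sub_one_ne_zero_of_sq_sub_one_ne_zero h.F_sq_sub_one_ne

theorem Nondegenerate.F_add_one_ne (h : τ.Nondegenerate) : τ.F + 1 ≠ 0 :=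
  add_one_ne_zero_of_sq_sub_one_ne_zero h.F_sq_sub_one_ne

theorem Nondegenerate.E₁_mul (h : τ.Nondegenerate) : τ.E₁ * (τ.F - 1) = τ.C - τ.E - τ.D :=
  div_mul_cancel₀ _ h.F_sub_one_ne

theorem Nondegenerate.E₂_mul (h : τ.Nondegenerate) : τ.E₂ * (τ.F + 1) = τ.C + τ.E - τ.D :=
  div_mul_cancel₀ _ h.F_add_one_ne

theorem Nondegenerate.rootCE_ne (h : τ.Nondegenerate) : τ.rootCE ≠ 0 :=
  left_ne_zero_of_mul (h.rootCE_mul ▸ h.numRootCE_ne)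

theorem Nondegenerate.b_mul_rootCE (h : τ.Nondegenerate) :
    τ.b * τ.rootCE = τ.C * τ.F - τ.E :=
  div_mul_cancel₀ _ h.rootCE_ne

theorem Nondegenerate.b₁_mul_rootCE (h : τ.Nondegenerate) : τ.b₁ * τ.rootCE = τ.D :=
  div_mul_cancel₀ _ h.rootCE_ne

theorem Nondegenerate.b_mul_denF (h : τ.Nondegenerate) : τ.b * τ.denF = 4 * τ.numb := by
  have hb := h.CF_sub_E_mul
  rw [← h.b_mul_rootCE] at hb
  refine mul_left_cancel₀ h.numRootCE_ne ?_
  linear_combination 4 * hb - τ.b * τ.denF * h.rootCE_mul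

theorem Nondegenerate.b₁_mul_denF (h : τ.Nondegenerate) : τ.b₁ * τ.denF = 4 * τ.rootD := by
  have hb₁ := h.D_mul
  rw [← h.b₁_mul_rootCE] at hb₁
  refine mul_left_cancel₀ h.numRootCE_ne ?_
  linear_combination 4 * hb₁ - τ.b₁ * τ.denF * h.rootCE_mul

theorem Nondegenerate.b_add_b₁_mul_b_sub_b₁ (h : τ.Nondegenerate) :
    (τ.b + τ.b₁) * (τ.b - τ.b₁) * (τ.E ^ 2 - 1) = τ.F ^ 2 - 1 := by
  have hden : τ.denF ^ 2 * (4 * τ.denE ^ 2) ≠ 0 :=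
    mul_ne_zero (pow_ne_zero 2 h.denF_ne) (mul_ne_zero (by norm_num) (pow_ne_zero 2 h.denE_ne))
  have hbb : (τ.b + τ.b₁) * (τ.b - τ.b₁) * τ.denF ^ 2 = 16 * τ.denE ^ 2 := by
    linear_combination (τ.b * τ.denF + 4 * τ.numb) * h.b_mul_denF
      - (τ.b₁ * τ.denF + 4 * τ.rootD) * h.b₁_mul_denF - 16 * τ.rootD_sq
  refine mul_right_cancel₀ hden ?_
  linear_combination (τ.E ^ 2 - 1) * (4 * τ.denE ^ 2) * hbb
    + 16 * τ.denE ^ 2 * h.E_sq_sub_one_mul - 4 * τ.denE ^ 2 * h.F_sq_sub_one_mul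

theorem Nondegenerate.b_add_b₁_mul_b_sub_b₁_ne (h : τ.Nondegenerate) :
    (τ.b + τ.b₁) * (τ.b - τ.b₁) ≠ 0 :=
  left_ne_zero_of_mul (h.b_add_b₁_mul_b_sub_b₁ ▸ h.F_sq_sub_one_ne)

theorem Nondegenerate.b_add_b₁_ne (h : τ.Nondegenerate) : τ.b + τ.b₁ ≠ 0 :=
  left_ne_zero_of_mul h.b_add_b₁_mul_b_sub_b₁_ne

theorem Nondegenerate.b_sub_b₁_ne (h : τ.Nondegenerate) : τ.b - τ.b₁ ≠ 0 :=
  right_ne_zero_of_mul h.b_add_b₁_mul_b_sub_b₁_ne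

theorem Nondegenerate.EF_sub_C_add_D_ne (h : τ.Nondegenerate) : τ.E * τ.F - τ.C + τ.D ≠ 0 := by
  have hprod : (τ.E * τ.F - τ.C + τ.D) * (τ.E * τ.F - τ.C - τ.D)
      = (τ.E ^ 2 - 1) * (τ.F ^ 2 - 1) := by
    linear_combination -h.D_sq
  exact left_ne_zero_of_mul (hprod ▸ mul_ne_zero h.E_sq_sub_one_ne h.F_sq_sub_one_ne)

theorem Nondegenerate.E_sub_E₁_ne (h : τ.Nondegenerate) : τ.E - τ.E₁ ≠ 0 := fun h₀ =>
  h.EF_sub_C_add_D_ne (by linear_combination (τ.F - 1) * h₀ + h.E₁_mul)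

theorem Nondegenerate.E_sub_E₂_ne (h : τ.Nondegenerate) : τ.E - τ.E₂ ≠ 0 := fun h₀ =>
  h.EF_sub_C_add_D_ne (by linear_combination (τ.F + 1) * h₀ + h.E₂_mul)

theorem Nondegenerate.E₂_sub_E₁_mul (h : τ.Nondegenerate) :
    (τ.E₂ - τ.E₁) * (τ.F + 1) = 2 * (τ.E - τ.E₁) := by
  refine mul_left_cancel₀ h.F_sub_one_ne ?_
  linear_combination (τ.F - 1) * h.E₂_mul - (τ.F + 1) * h.E₁_mul + 2 * h.E₁_mul

theorem Nondegenerate.E₂_sub_E₁_ne (h : τ.Nondegenerate) : τ.E₂ - τ.E₁ ≠ 0 :=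
  left_ne_zero_of_mul (h.E₂_sub_E₁_mul ▸ mul_ne_zero two_ne_zero h.E_sub_E₁_ne)

theorem Nondegenerate.F_mul_E₂_sub_E₁ (h : τ.Nondegenerate) :
    τ.F * (τ.E₂ - τ.E₁) = 2 * τ.E - τ.E₁ - τ.E₂ := by
  linear_combination h.E₂_sub_E₁_mul

theorem Nondegenerate.C_mul_E₂_sub_E₁ (h : τ.Nondegenerate) :
    τ.C * (τ.E₂ - τ.E₁) = 1 - τ.E₁ * τ.E₂ := by
  refine mul_left_cancel₀ h.F_sq_sub_one_ne ?_
  linear_combination τ.C * ((τ.F - 1) * h.E₂_mul - (τ.F + 1) * h.E₁_mul)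
    + τ.E₂ * (τ.F + 1) * h.E₁_mul + (τ.C - τ.E - τ.D) * h.E₂_mul + h.D_sq

theorem Nondegenerate.D_mul_E₂_sub_E₁ (h : τ.Nondegenerate) :
    τ.D * (τ.E₂ - τ.E₁) = τ.E₁ * τ.E₂ - τ.E * (τ.E₁ + τ.E₂) + 1 := by
  refine mul_left_cancel₀ h.F_sq_sub_one_ne ?_
  linear_combination τ.D * ((τ.F - 1) * h.E₂_mul - (τ.F + 1) * h.E₁_mul)
    - τ.E₂ * (τ.F + 1) * h.E₁_mul - (τ.C - τ.E - τ.D) * h.E₂_mul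
    + τ.E * ((τ.F + 1) * h.E₁_mul + (τ.F - 1) * h.E₂_mul) + h.D_sq

theorem Nondegenerate.E₁_sq_sub_one_mul (h : τ.Nondegenerate) :
    (τ.E₁ ^ 2 - 1) * (τ.F ^ 2 - 1) = -2 * (τ.E - τ.E₁) * ((τ.b - τ.b₁) * τ.rootCE) := by
  rw [sub_mul τ.b, h.b_mul_rootCE, h.b₁_mul_rootCE]
  refine mul_left_cancel₀ h.F_sub_one_ne ?_
  linear_combination ((τ.F + 1) * (τ.E₁ * (τ.F - 1) + τ.C - τ.E - τ.D)
    - 2 * (τ.C * τ.F - τ.E - τ.D)) * h.E₁_mul + (τ.F - 1) * h.D_sq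

theorem Nondegenerate.E₂_sq_sub_one_mul (h : τ.Nondegenerate) :
    (τ.E₂ ^ 2 - 1) * (τ.F ^ 2 - 1) = -2 * (τ.E - τ.E₂) * ((τ.b + τ.b₁) * τ.rootCE) := by
  rw [add_mul τ.b, h.b_mul_rootCE, h.b₁_mul_rootCE]
  refine mul_left_cancel₀ h.F_add_one_ne ?_
  linear_combination ((τ.F - 1) * (τ.E₂ * (τ.F + 1) + τ.C + τ.E - τ.D)
    - 2 * (τ.C * τ.F - τ.E + τ.D)) * h.E₂_mul + (τ.F + 1) * h.D_sq

theorem Nondegenerate.E₁_sq_sub_one_ne (h : τ.Nondegenerate) : τ.E₁ ^ 2 - 1 ≠ 0 :=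
  left_ne_zero_of_mul (h.E₁_sq_sub_one_mul ▸ mul_ne_zero
    (mul_ne_zero (by norm_num) h.E_sub_E₁_ne) (mul_ne_zero h.b_sub_b₁_ne h.rootCE_ne))

theorem Nondegenerate.E₂_sq_sub_one_ne (h : τ.Nondegenerate) : τ.E₂ ^ 2 - 1 ≠ 0 :=
  left_ne_zero_of_mul (h.E₂_sq_sub_one_mul ▸ mul_ne_zero
    (mul_ne_zero (by norm_num) h.E_sub_E₂_ne) (mul_ne_zero h.b_add_b₁_ne h.rootCE_ne))

theorem Nondegenerate.E₁_sub_one_ne (h : τ.Nondegenerate) : τ.E₁ - 1 ≠ 0 :=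
  sub_one_ne_zero_of_sq_sub_one_ne_zero h.E₁_sq_sub_one_ne

theorem Nondegenerate.E₂_sub_one_ne (h : τ.Nondegenerate) : τ.E₂ - 1 ≠ 0 :=
  sub_one_ne_zero_of_sq_sub_one_ne_zero h.E₂_sq_sub_one_ne

theorem Nondegenerate.m_mul (h : τ.Nondegenerate) : τ.m * (τ.E - 1) = τ.E + 1 :=
  div_mul_cancel₀ _ h.E_sub_one_ne

theorem Nondegenerate.m₁_mul (h : τ.Nondegenerate) : τ.m₁ * (τ.E₁ - 1) = τ.E₁ + 1 :=
  div_mul_cancel₀ _ h.E₁_sub_one_ne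

theorem Nondegenerate.m₂_mul (h : τ.Nondegenerate) : τ.m₂ * (τ.E₂ - 1) = τ.E₂ + 1 :=
  div_mul_cancel₀ _ h.E₂_sub_one_ne

theorem Nondegenerate.m₁_sub_m₂_mul (h : τ.Nondegenerate) :
    (τ.m₁ - τ.m₂) * ((τ.E₁ - 1) * (τ.E₂ - 1)) = 2 * (τ.E₂ - τ.E₁) := by
  linear_combination (τ.E₂ - 1) * h.m₁_mul - (τ.E₁ - 1) * h.m₂_mul

theorem mobius_ne_zero {x : ℂ} (hx : x ^ 2 - 1 ≠ 0) : (x + 1) / (x - 1) ≠ 0 :=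
  div_ne_zero (add_one_ne_zero_of_sq_sub_one_ne_zero hx) (sub_one_ne_zero_of_sq_sub_one_ne_zero hx)

theorem mobius_ne_one {x : ℂ} (hx : x - 1 ≠ 0) : (x + 1) / (x - 1) ≠ 1 := fun h =>
  two_ne_zero (α := ℂ) (by linear_combination (div_eq_one_iff_eq hx).1 h)

theorem mobius_ne_mobius {x y : ℂ} (hx : x - 1 ≠ 0) (hy : y - 1 ≠ 0) (hxy : x - y ≠ 0) :
    (x + 1) / (x - 1) ≠ (y + 1) / (y - 1) := fun h =>
  hxy (by linear_combination (-1 / 2 : ℂ) * (div_eq_div_iff hx hy).1 h)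

theorem Nondegenerate.m₁_ne_m₂ (h : τ.Nondegenerate) : τ.m₁ ≠ τ.m₂ :=
  (mobius_ne_mobius h.E₂_sub_one_ne h.E₁_sub_one_ne h.E₂_sub_E₁_ne).symm

theorem Nondegenerate.m_ne_zero_ne_one_pairwise_ne (h : τ.Nondegenerate) :
    (τ.m ≠ 0 ∧ τ.m₁ ≠ 0 ∧ τ.m₂ ≠ 0) ∧ (τ.m ≠ 1 ∧ τ.m₁ ≠ 1 ∧ τ.m₂ ≠ 1) ∧
      (τ.m ≠ τ.m₁ ∧ τ.m ≠ τ.m₂ ∧ τ.m₁ ≠ τ.m₂) :=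
  ⟨⟨mobius_ne_zero h.E_sq_sub_one_ne, mobius_ne_zero h.E₁_sq_sub_one_ne,
      mobius_ne_zero h.E₂_sq_sub_one_ne⟩,
    ⟨mobius_ne_one h.E_sub_one_ne, mobius_ne_one h.E₁_sub_one_ne, mobius_ne_one h.E₂_sub_one_ne⟩,
    mobius_ne_mobius h.E_sub_one_ne h.E₁_sub_one_ne h.E_sub_E₁_ne,
    mobius_ne_mobius h.E_sub_one_ne h.E₂_sub_one_ne h.E_sub_E₂_ne, h.m₁_ne_m₂⟩

end Parameters

/-! ### The Kummer quartic and the coefficients of the derivatives -/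

section Kummer

variable (τ)

theorem P₁P₂_zero_mul_P₀P₃ (z : ℂ × ℂ) : τ.P₁ 0 * τ.P₂ 0 * (τ.P₀ z * τ.P₃ z)
    = τ.P₀ 0 * τ.P₃ 0 * (τ.P₁ z * τ.P₂ z) + τ.S₀ 0 * τ.S₃ 0 * (τ.S₁ z * τ.S₂ z) := by
  simp only [P₀_mul_P₃, P₁_mul_P₂, S₀_mul_S₃, S₁_mul_S₂]
  ring

theorem P₁P₂_zero_mul_S₀S₃ (z : ℂ × ℂ) : τ.P₁ 0 * τ.P₂ 0 * (τ.S₀ z * τ.S₃ z)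
    = τ.S₀ 0 * τ.S₃ 0 * (τ.P₁ z * τ.P₂ z) + τ.P₀ 0 * τ.P₃ 0 * (τ.S₁ z * τ.S₂ z) := by
  simp only [P₀_mul_P₃, P₁_mul_P₂, S₀_mul_S₃, S₁_mul_S₂]
  ring

theorem P₁P₂_zero_sq : (τ.P₁ 0 * τ.P₂ 0) ^ 2 = τ.denF := by
  rw [mul_pow, P₁_zero_sq, P₂_zero_sq, denF]

theorem P₀P₃_zero_sq : (τ.P₀ 0 * τ.P₃ 0) ^ 2
    = (τ.t ^ 2 + τ.w ^ 2) ^ 2 - (τ.u ^ 2 + τ.v ^ 2) ^ 2 := by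
  rw [mul_pow, P₀_zero_sq, P₃_zero_sq]
  ring

theorem S₀S₃_zero_sq : (τ.S₀ 0 * τ.S₃ 0) ^ 2
    = 4 * ((τ.t * τ.w) ^ 2 - (τ.u * τ.v) ^ 2) := by
  rw [mul_pow, S₀_zero_sq, S₃_zero_sq]
  ring

theorem P₀P₃_zero_mul_S₀S₃_zero : τ.P₀ 0 * τ.P₃ 0 * (τ.S₀ 0 * τ.S₃ 0) = -2 * τ.rootD := by
  rw [rootD, Prod.mk_zero_zero]
  ring

theorem denF_mul_P₀P₃_sq (z : ℂ × ℂ) : τ.denF * (τ.P₀ z * τ.P₃ z) ^ 2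
    = ((τ.t ^ 2 + τ.w ^ 2) ^ 2 - (τ.u ^ 2 + τ.v ^ 2) ^ 2) * (τ.P₁ z * τ.P₂ z) ^ 2
      + 4 * ((τ.t * τ.w) ^ 2 - (τ.u * τ.v) ^ 2) * (τ.S₁ z * τ.S₂ z) ^ 2
      - 4 * τ.rootD * (τ.P₁ z * τ.P₂ z * τ.S₁ z * τ.S₂ z) := by
  rw [← P₁P₂_zero_sq, ← mul_pow, P₁P₂_zero_mul_P₀P₃]
  linear_combination (τ.P₁ z * τ.P₂ z) ^ 2 * τ.P₀P₃_zero_sq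
    + (τ.S₁ z * τ.S₂ z) ^ 2 * τ.S₀S₃_zero_sq
    + 2 * (τ.P₁ z * τ.P₂ z * τ.S₁ z * τ.S₂ z) * τ.P₀P₃_zero_mul_S₀S₃_zero

theorem denF_mul_P₀P₃S₀S₃ (z : ℂ × ℂ) : τ.denF * (τ.P₀ z * τ.P₃ z * τ.S₀ z * τ.S₃ z)
    = -2 * τ.rootD * ((τ.P₁ z * τ.P₂ z) ^ 2 + (τ.S₁ z * τ.S₂ z) ^ 2)
      + ((τ.t ^ 2 + τ.w ^ 2) ^ 2 - (τ.u ^ 2 + τ.v ^ 2) ^ 2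
        + 4 * ((τ.t * τ.w) ^ 2 - (τ.u * τ.v) ^ 2)) * (τ.P₁ z * τ.P₂ z * τ.S₁ z * τ.S₂ z) := by
  rw [← P₁P₂_zero_sq]
  have hprod := congrArg₂ (· * ·) (τ.P₁P₂_zero_mul_P₀P₃ z) (τ.P₁P₂_zero_mul_S₀S₃ z)
  linear_combination hprod
    + (τ.P₁ z * τ.P₂ z * τ.S₁ z * τ.S₂ z) * (τ.P₀P₃_zero_sq + τ.S₀S₃_zero_sq)
    + ((τ.P₁ z * τ.P₂ z) ^ 2 + (τ.S₁ z * τ.S₂ z) ^ 2) * τ.P₀P₃_zero_mul_S₀S₃_zero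

theorem tX₀_add_wX₃ (z : ℂ × ℂ) :
    2 * (τ.t ^ 2 - τ.w ^ 2) * (τ.t * τ.X₀ z + τ.w * τ.X₃ z)
      = (τ.t ^ 2 + τ.w ^ 2) * (τ.P₁ z ^ 2 + τ.P₂ z ^ 2)
        - 2 * (τ.t * τ.w) * (τ.S₁ z ^ 2 + τ.S₂ z ^ 2) := by
  rw [P₁_sq, P₂_sq, S₁_sq, S₂_sq]
  ring

theorem wX₀_add_tX₃ (z : ℂ × ℂ) :
    2 * (τ.t ^ 2 - τ.w ^ 2) * (τ.w * τ.X₀ z + τ.t * τ.X₃ z)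
      = 2 * (τ.t * τ.w) * (τ.P₁ z ^ 2 + τ.P₂ z ^ 2)
        - (τ.t ^ 2 + τ.w ^ 2) * (τ.S₁ z ^ 2 + τ.S₂ z ^ 2) := by
  rw [P₁_sq, P₂_sq, S₁_sq, S₂_sq]
  ring

theorem uX₁_add_vX₂ (z : ℂ × ℂ) :
    2 * (τ.u ^ 2 - τ.v ^ 2) * (τ.u * τ.X₁ z + τ.v * τ.X₂ z)
      = (τ.u ^ 2 + τ.v ^ 2) * (τ.P₁ z ^ 2 - τ.P₂ z ^ 2)
        - 2 * (τ.u * τ.v) * (τ.S₁ z ^ 2 - τ.S₂ z ^ 2) := by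
  rw [P₁_sq, P₂_sq, S₁_sq, S₂_sq]
  ring

theorem vX₁_add_uX₂ (z : ℂ × ℂ) :
    2 * (τ.u ^ 2 - τ.v ^ 2) * (τ.v * τ.X₁ z + τ.u * τ.X₂ z)
      = 2 * (τ.u * τ.v) * (τ.P₁ z ^ 2 - τ.P₂ z ^ 2)
        - (τ.u ^ 2 + τ.v ^ 2) * (τ.S₁ z ^ 2 - τ.S₂ z ^ 2) := by
  rw [P₁_sq, P₂_sq, S₁_sq, S₂_sq]
  ring

theorem P₀P₃_sq (z : ℂ × ℂ) : (τ.P₀ z * τ.P₃ z) ^ 2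
    = (τ.t * τ.X₀ z + τ.w * τ.X₃ z) ^ 2 - (τ.u * τ.X₁ z + τ.v * τ.X₂ z) ^ 2 := by
  rw [mul_pow, P₀_sq, P₃_sq]
  ring

theorem P₃S₃_sq_add_P₀S₀_sq (z : ℂ × ℂ) : (τ.P₃ z * τ.S₃ z) ^ 2 + (τ.P₀ z * τ.S₀ z) ^ 2
    = 2 * ((τ.t * τ.X₀ z + τ.w * τ.X₃ z) * (τ.w * τ.X₀ z + τ.t * τ.X₃ z)
      + (τ.u * τ.X₁ z + τ.v * τ.X₂ z) * (τ.v * τ.X₁ z + τ.u * τ.X₂ z)) := by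
  rw [mul_pow, mul_pow, P₀_sq, P₃_sq, S₀_sq, S₃_sq]
  ring

theorem P₃S₃_sq_sub_P₀S₀_sq (z : ℂ × ℂ) : (τ.P₃ z * τ.S₃ z) ^ 2 - (τ.P₀ z * τ.S₀ z) ^ 2
    = 2 * ((τ.t * τ.X₀ z + τ.w * τ.X₃ z) * (τ.v * τ.X₁ z + τ.u * τ.X₂ z)
      + (τ.u * τ.X₁ z + τ.v * τ.X₂ z) * (τ.w * τ.X₀ z + τ.t * τ.X₃ z)) := by
  rw [mul_pow, mul_pow, P₀_sq, P₃_sq, S₀_sq, S₃_sq]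
  ring

theorem denE_mul_denC : τ.denE * τ.denC
    = (τ.u * τ.v) ^ 2 * (τ.t ^ 2 - τ.w ^ 2) ^ 2 - (τ.t * τ.w) ^ 2 * (τ.u ^ 2 - τ.v ^ 2) ^ 2 := by
  rw [denE, denC]
  ring

variable {τ}

theorem Nondegenerate.E_mul_denE_denC (h : τ.Nondegenerate) : τ.E * (2 * (τ.denE * τ.denC))
    = τ.u * τ.v * (τ.u ^ 2 + τ.v ^ 2) * (τ.t ^ 2 - τ.w ^ 2) ^ 2
      - τ.t * τ.w * (τ.t ^ 2 + τ.w ^ 2) * (τ.u ^ 2 - τ.v ^ 2) ^ 2 := by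
  have hC : τ.denC = τ.u * τ.v * (τ.t ^ 2 + τ.w ^ 2) - τ.t * τ.w * (τ.u ^ 2 + τ.v ^ 2) := by
    rw [denC]
    ring
  rw [← mul_assoc 2, ← mul_assoc, h.E_mul_denE, hC]
  ring

theorem Nondegenerate.C_mul_denE_denC (h : τ.Nondegenerate) : τ.C * (2 * (τ.denE * τ.denC))
    = τ.u * τ.v * (τ.u ^ 2 + τ.v ^ 2) * (τ.t ^ 2 - τ.w ^ 2) ^ 2
      + τ.t * τ.w * (τ.t ^ 2 + τ.w ^ 2) * (τ.u ^ 2 - τ.v ^ 2) ^ 2 := by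
  have hE : τ.denE = τ.u * τ.v * (τ.t ^ 2 + τ.w ^ 2) + τ.t * τ.w * (τ.u ^ 2 + τ.v ^ 2) := by
    rw [denE]
    ring
  rw [mul_comm τ.denE, ← mul_assoc 2, ← mul_assoc, h.C_mul_denC, hE]
  ring

theorem Nondegenerate.numRootCE_mul_P₀P₃_sq (h : τ.Nondegenerate) (z : ℂ × ℂ) :
    τ.numRootCE * (τ.P₀ z * τ.P₃ z) ^ 2 = τ.denE * τ.denC *
      (2 * τ.E * (τ.P₁ z ^ 2 * τ.S₁ z ^ 2 + τ.P₂ z ^ 2 * τ.S₂ z ^ 2)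
        - 2 * τ.C * (τ.P₁ z ^ 2 * τ.S₂ z ^ 2 + τ.P₂ z ^ 2 * τ.S₁ z ^ 2)
        - (τ.P₁ z ^ 4 + τ.S₁ z ^ 4 + τ.P₂ z ^ 4 + τ.S₂ z ^ 4))
      + ((τ.t ^ 2 + τ.w ^ 2) ^ 2 * (τ.u ^ 2 - τ.v ^ 2) ^ 2
        + (τ.t ^ 2 - τ.w ^ 2) ^ 2 * (τ.u ^ 2 + τ.v ^ 2) ^ 2) / 2 * (τ.P₁ z * τ.P₂ z) ^ 2
      + 2 * ((τ.t * τ.w) ^ 2 * (τ.u ^ 2 - τ.v ^ 2) ^ 2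
        + (τ.u * τ.v) ^ 2 * (τ.t ^ 2 - τ.w ^ 2) ^ 2) * (τ.S₁ z * τ.S₂ z) ^ 2 := by
  have h₀ := congrArg (· ^ 2) (τ.tX₀_add_wX₃ z)
  have h₁ := congrArg (· ^ 2) (τ.uX₁_add_vX₂ z)
  rw [P₀P₃_sq, numRootCE]
  linear_combination (τ.u ^ 2 - τ.v ^ 2) ^ 2 / 4 * h₀ - (τ.t ^ 2 - τ.w ^ 2) ^ 2 / 4 * h₁
    - (τ.P₁ z ^ 2 * τ.S₁ z ^ 2 + τ.P₂ z ^ 2 * τ.S₂ z ^ 2) * h.E_mul_denE_denC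
    + (τ.P₁ z ^ 2 * τ.S₂ z ^ 2 + τ.P₂ z ^ 2 * τ.S₁ z ^ 2) * h.C_mul_denE_denC
    + (τ.P₁ z ^ 4 + τ.S₁ z ^ 4 + τ.P₂ z ^ 4 + τ.S₂ z ^ 4) * τ.denE_mul_denC

theorem Nondegenerate.F_mul_denF_denE_denC (h : τ.Nondegenerate) :
    τ.F * (τ.denF * τ.denE * τ.denC) = ((τ.t ^ 2 - τ.w ^ 2) ^ 2 + (τ.u ^ 2 - τ.v ^ 2) ^ 2)
      * ((τ.u * τ.v) ^ 2 * (τ.t ^ 2 - τ.w ^ 2) ^ 2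
        - (τ.t * τ.w) ^ 2 * (τ.u ^ 2 - τ.v ^ 2) ^ 2) := by
  rw [mul_assoc τ.denF, ← mul_assoc, h.F_mul_denF, denE_mul_denC]

theorem Nondegenerate.kummer_quartic (h : τ.Nondegenerate) (z : ℂ × ℂ) :
    τ.P₁ z ^ 4 + τ.S₁ z ^ 4 + τ.P₂ z ^ 4 + τ.S₂ z ^ 4
      - 2 * τ.E * (τ.P₁ z ^ 2 * τ.S₁ z ^ 2 + τ.P₂ z ^ 2 * τ.S₂ z ^ 2)
      - 2 * τ.F * ((τ.P₁ z * τ.P₂ z) ^ 2 + (τ.S₁ z * τ.S₂ z) ^ 2)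
      + 2 * τ.C * (τ.P₁ z ^ 2 * τ.S₂ z ^ 2 + τ.P₂ z ^ 2 * τ.S₁ z ^ 2)
      - 4 * τ.D * (τ.P₁ z * τ.P₂ z * τ.S₁ z * τ.S₂ z) = 0 := by
  have hP : τ.denF * ((τ.t ^ 2 + τ.w ^ 2) ^ 2 * (τ.u ^ 2 - τ.v ^ 2) ^ 2
        + (τ.t ^ 2 - τ.w ^ 2) ^ 2 * (τ.u ^ 2 + τ.v ^ 2) ^ 2) / 2
      = τ.numRootCE * ((τ.t ^ 2 + τ.w ^ 2) ^ 2 - (τ.u ^ 2 + τ.v ^ 2) ^ 2)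
        + 2 * τ.F * (τ.denF * τ.denE * τ.denC) := by
    rw [mul_assoc 2, h.F_mul_denF_denE_denC, denF_eq, numRootCE]
    ring
  have hS : 2 * τ.denF * ((τ.t * τ.w) ^ 2 * (τ.u ^ 2 - τ.v ^ 2) ^ 2
        + (τ.u * τ.v) ^ 2 * (τ.t ^ 2 - τ.w ^ 2) ^ 2)
      = τ.numRootCE * (4 * ((τ.t * τ.w) ^ 2 - (τ.u * τ.v) ^ 2))
        + 2 * τ.F * (τ.denF * τ.denE * τ.denC) := by
    rw [mul_assoc 2 τ.F, h.F_mul_denF_denE_denC, denF_eq, numRootCE]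
    ring
  have hden : τ.denF * τ.denE * τ.denC ≠ 0 :=
    mul_ne_zero (mul_ne_zero h.denF_ne h.denE_ne) h.denC_ne
  refine (mul_eq_zero.1 ?_).resolve_left hden
  linear_combination τ.denF * h.numRootCE_mul_P₀P₃_sq z - τ.numRootCE * τ.denF_mul_P₀P₃_sq z
    + (τ.P₁ z * τ.P₂ z) ^ 2 * hP + (τ.S₁ z * τ.S₂ z) ^ 2 * hS
    - 4 * (τ.P₁ z * τ.P₂ z * τ.S₁ z * τ.S₂ z) * h.D_mul

theorem Nondegenerate.E_mul_C_mul_denE_denC (h : τ.Nondegenerate) :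
    τ.E * τ.C * (4 * (τ.denE * τ.denC))
      = (τ.t ^ 2 + τ.w ^ 2) ^ 2 * (τ.u ^ 2 + τ.v ^ 2) ^ 2
        - 16 * (τ.t * τ.w) ^ 2 * (τ.u * τ.v) ^ 2 := by
  linear_combination congrArg₂ (· * ·) h.E_mul_denE h.C_mul_denC

theorem Nondegenerate.numRootCE_mul_P₃S₃_sq_add_P₀S₀_sq (h : τ.Nondegenerate) (z : ℂ × ℂ) :
    τ.numRootCE * ((τ.P₃ z * τ.S₃ z) ^ 2 + (τ.P₀ z * τ.S₀ z) ^ 2) = 2 * (τ.denE * τ.denC)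
      * (τ.C * (τ.P₁ z ^ 4 + τ.S₁ z ^ 4 + τ.P₂ z ^ 4 + τ.S₂ z ^ 4
          - 2 * τ.E * (τ.P₁ z ^ 2 * τ.S₁ z ^ 2 + τ.P₂ z ^ 2 * τ.S₂ z ^ 2))
        - 2 * τ.E * ((τ.P₁ z * τ.P₂ z) ^ 2 + (τ.S₁ z * τ.S₂ z) ^ 2)
        + 2 * ((τ.S₁ z * τ.P₂ z) ^ 2 + (τ.S₂ z * τ.P₁ z) ^ 2)) := by
  have h₀ := congrArg₂ (· * ·) (τ.tX₀_add_wX₃ z) (τ.wX₀_add_tX₃ z)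
  have h₁ := congrArg₂ (· * ·) (τ.uX₁_add_vX₂ z) (τ.vX₁_add_uX₂ z)
  rw [P₃S₃_sq_add_P₀S₀_sq, numRootCE]
  linear_combination (τ.u ^ 2 - τ.v ^ 2) ^ 2 / 2 * h₀ + (τ.t ^ 2 - τ.w ^ 2) ^ 2 / 2 * h₁
    - (τ.P₁ z ^ 4 + τ.S₁ z ^ 4 + τ.P₂ z ^ 4 + τ.S₂ z ^ 4) * h.C_mul_denE_denC
    + (τ.P₁ z ^ 2 * τ.S₁ z ^ 2 + τ.P₂ z ^ 2 * τ.S₂ z ^ 2) * h.E_mul_C_mul_denE_denC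
    + 2 * ((τ.P₁ z * τ.P₂ z) ^ 2 + (τ.S₁ z * τ.S₂ z) ^ 2) * h.E_mul_denE_denC
    - 4 * ((τ.S₁ z * τ.P₂ z) ^ 2 + (τ.S₂ z * τ.P₁ z) ^ 2) * τ.denE_mul_denC

theorem Nondegenerate.rootCE_mul_P₃S₃_sq_add_P₀S₀_sq (h : τ.Nondegenerate) (z : ℂ × ℂ) :
    τ.rootCE * ((τ.P₃ z * τ.S₃ z) ^ 2 + (τ.P₀ z * τ.S₀ z) ^ 2)
      = (τ.C * τ.F - τ.E) * ((τ.P₁ z * τ.P₂ z) ^ 2 + (τ.S₁ z * τ.S₂ z) ^ 2)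
        - (τ.C ^ 2 - 1) * ((τ.S₁ z * τ.P₂ z) ^ 2 + (τ.S₂ z * τ.P₁ z) ^ 2)
        + 2 * τ.C * τ.D * (τ.P₁ z * τ.P₂ z * τ.S₁ z * τ.S₂ z) := by
  refine mul_left_cancel₀ (mul_ne_zero h.denE_ne h.denC_ne) ?_
  linear_combination ((τ.P₃ z * τ.S₃ z) ^ 2 + (τ.P₀ z * τ.S₀ z) ^ 2) / 4 * h.rootCE_mul
    + h.numRootCE_mul_P₃S₃_sq_add_P₀S₀_sq z / 4
    + τ.denE * τ.denC * τ.C / 2 * h.kummer_quartic z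

theorem Nondegenerate.rootCE_mul_P₀P₃S₀S₃ (h : τ.Nondegenerate) (z : ℂ × ℂ) :
    τ.rootCE * (τ.P₀ z * τ.P₃ z * τ.S₀ z * τ.S₃ z)
      = -τ.D / 2 * ((τ.P₁ z * τ.P₂ z) ^ 2 + (τ.S₁ z * τ.S₂ z) ^ 2)
        + (τ.C * τ.E - τ.F) * (τ.P₁ z * τ.P₂ z * τ.S₁ z * τ.S₂ z) := by
  have hCEF : (τ.C * τ.E - τ.F) * (4 * (τ.denF * τ.denE * τ.denC))
      = τ.numRootCE * ((τ.t ^ 2 + τ.w ^ 2) ^ 2 - (τ.u ^ 2 + τ.v ^ 2) ^ 2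
        + 4 * ((τ.t * τ.w) ^ 2 - (τ.u * τ.v) ^ 2)) := by
    have hCE := congrArg (τ.denF * ·) h.E_mul_C_mul_denE_denC
    rw [numRootCE]
    linear_combination hCE - 4 * h.F_mul_denF_denE_denC
      + ((τ.t ^ 2 + τ.w ^ 2) ^ 2 * (τ.u ^ 2 + τ.v ^ 2) ^ 2
        - 16 * (τ.t * τ.w) ^ 2 * (τ.u * τ.v) ^ 2) * τ.denF_eq
  refine mul_left_cancel₀ (mul_ne_zero (mul_ne_zero h.denF_ne h.denE_ne) h.denC_ne) ?_
  linear_combination τ.denF * (τ.P₀ z * τ.P₃ z * τ.S₀ z * τ.S₃ z) / 4 * h.rootCE_mul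
    + τ.numRootCE / 4 * τ.denF_mul_P₀P₃S₀S₃ z
    + ((τ.P₁ z * τ.P₂ z) ^ 2 + (τ.S₁ z * τ.S₂ z) ^ 2) / 2 * h.D_mul
    - (τ.P₁ z * τ.P₂ z * τ.S₁ z * τ.S₂ z) / 4 * hCEF

theorem Nondegenerate.rootCE_mul_evenν_sq (h : τ.Nondegenerate) (z : ℂ × ℂ) :
    4 * τ.rootCE * τ.evenν z ^ 2
      = (τ.C * τ.F - τ.E + τ.D) * ((τ.P₁ z * τ.P₂ z) ^ 2 + (τ.S₁ z * τ.S₂ z) ^ 2)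
        - (τ.C ^ 2 - 1) * ((τ.S₁ z * τ.P₂ z) ^ 2 + (τ.S₂ z * τ.P₁ z) ^ 2)
        + 2 * (τ.C * τ.D - τ.C * τ.E + τ.F) * (τ.P₁ z * τ.P₂ z * τ.S₁ z * τ.S₂ z) := by
  rw [evenν]
  linear_combination h.rootCE_mul_P₃S₃_sq_add_P₀S₀_sq z - 2 * h.rootCE_mul_P₀P₃S₀S₃ z

theorem Nondegenerate.E₁_mul_CF_sub_E_add_D (h : τ.Nondegenerate) :
    τ.E₁ * (τ.C * τ.F - τ.E + τ.D) = τ.C ^ 2 - 1 - τ.C * τ.D + τ.C * τ.E - τ.F := by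
  refine mul_left_cancel₀ h.F_sub_one_ne ?_
  linear_combination (τ.C * τ.F - τ.E + τ.D) * h.E₁_mul - h.D_sq

theorem Nondegenerate.E₁_sq_sub_one_mul_CF_sub_E_add_D (h : τ.Nondegenerate) :
    (τ.E₁ ^ 2 - 1) * (τ.C * τ.F - τ.E + τ.D) = -2 * (τ.E - τ.E₁) * (τ.C ^ 2 - 1) := by
  have hE₁ := h.E₁_sq_sub_one_mul
  rw [sub_mul τ.b, h.b_mul_rootCE, h.b₁_mul_rootCE] at hE₁
  refine mul_left_cancel₀ h.F_sq_sub_one_ne ?_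
  linear_combination (τ.C * τ.F - τ.E + τ.D) * hE₁
    - 2 * (τ.E - τ.E₁) * h.CF_sub_E_sq_sub_D_sq

theorem Nondegenerate.evenν_sq (h : τ.Nondegenerate) (z : ℂ × ℂ) :
    τ.evenν z ^ 2 = (τ.b + τ.b₁) / (8 * (τ.E - τ.E₁)) *
      (2 * (τ.E - τ.E₁) * ((τ.P₁ z * τ.P₂ z) ^ 2 + (τ.S₁ z * τ.S₂ z) ^ 2)
        + (τ.E₁ ^ 2 - 1) * ((τ.S₁ z * τ.P₂ z) ^ 2 + (τ.S₂ z * τ.P₁ z) ^ 2)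
        + 2 * (τ.E₁ ^ 2 - 2 * τ.E * τ.E₁ + 1) * (τ.P₁ z * τ.P₂ z * τ.S₁ z * τ.S₂ z)) := by
  have hden : 8 * (τ.E - τ.E₁) ≠ 0 := mul_ne_zero (by norm_num) h.E_sub_E₁_ne
  rw [div_mul_eq_mul_div, eq_div_iff hden]
  refine mul_left_cancel₀ h.rootCE_ne ?_
  linear_combination 2 * (τ.E - τ.E₁) * h.rootCE_mul_evenν_sq z
    - (2 * (τ.E - τ.E₁) * ((τ.P₁ z * τ.P₂ z) ^ 2 + (τ.S₁ z * τ.S₂ z) ^ 2)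
        + (τ.E₁ ^ 2 - 1) * ((τ.S₁ z * τ.P₂ z) ^ 2 + (τ.S₂ z * τ.P₁ z) ^ 2)
        + 2 * (τ.E₁ ^ 2 - 2 * τ.E * τ.E₁ + 1) * (τ.P₁ z * τ.P₂ z * τ.S₁ z * τ.S₂ z))
      * (h.b_mul_rootCE + h.b₁_mul_rootCE)
    - (((τ.S₁ z * τ.P₂ z) ^ 2 + (τ.S₂ z * τ.P₁ z) ^ 2)
        - 2 * (τ.P₁ z * τ.P₂ z * τ.S₁ z * τ.S₂ z)) * h.E₁_sq_sub_one_mul_CF_sub_E_add_D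
    + 4 * (τ.E - τ.E₁) * (τ.P₁ z * τ.P₂ z * τ.S₁ z * τ.S₂ z) * h.E₁_mul_CF_sub_E_add_D

variable (τ) in
/-- The square root of `1 / (64 (E² - 1))` in the formula for `evenν * evenμ`. -/
noncomputable def rootE : ℂ := -τ.denE / (4 * (τ.t ^ 2 - τ.w ^ 2) * (τ.u ^ 2 - τ.v ^ 2))

theorem Nondegenerate.rootE_mul (h : τ.Nondegenerate) :
    τ.rootE * (4 * (τ.t ^ 2 - τ.w ^ 2) * (τ.u ^ 2 - τ.v ^ 2)) = -τ.denE :=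
  div_mul_cancel₀ _ (mul_ne_zero (mul_ne_zero (by norm_num) h.tw) h.uv)

theorem Nondegenerate.rootE_sq (h : τ.Nondegenerate) : τ.rootE ^ 2 * (64 * (τ.E ^ 2 - 1)) = 1 := by
  have hE := h.E_sq_sub_one_mul
  have hroot := congrArg (· ^ 2) h.rootE_mul
  rw [numRootCE] at hE
  refine mul_left_cancel₀ (pow_ne_zero 2 h.denE_ne) ?_
  linear_combination 16 * τ.rootE ^ 2 * hE + hroot

theorem Nondegenerate.evenν_mul_evenμ (h : τ.Nondegenerate) (z : ℂ × ℂ) :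
    τ.evenν z * τ.evenμ z = τ.rootE *
      ((τ.P₂ z ^ 4 - 2 * τ.E * τ.P₂ z ^ 2 * τ.S₂ z ^ 2 + τ.S₂ z ^ 4)
        - (τ.P₁ z ^ 4 - 2 * τ.E * τ.P₁ z ^ 2 * τ.S₁ z ^ 2 + τ.S₁ z ^ 4)) := by
  have h₀ := congrArg₂ (· * ·) (τ.tX₀_add_wX₃ z) (τ.vX₁_add_uX₂ z)
  have h₁ := congrArg₂ (· * ·) (τ.uX₁_add_vX₂ z) (τ.wX₀_add_tX₃ z)
  have hprod : τ.evenν z * τ.evenμ z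
      = ((τ.P₃ z * τ.S₃ z) ^ 2 - (τ.P₀ z * τ.S₀ z) ^ 2) / 4 := by
    rw [evenν, evenμ]
    ring
  have hdenE : τ.denE = τ.u * τ.v * (τ.t ^ 2 + τ.w ^ 2) + τ.t * τ.w * (τ.u ^ 2 + τ.v ^ 2) := by
    rw [denE]
    ring
  refine mul_left_cancel₀
    (mul_ne_zero (mul_ne_zero (by norm_num : (4 : ℂ) ≠ 0) h.tw) h.uv) ?_
  rw [hprod, P₃S₃_sq_sub_P₀S₀_sq]
  linear_combination h₀ / 2 + h₁ / 2
    - ((τ.P₂ z ^ 4 - 2 * τ.E * τ.P₂ z ^ 2 * τ.S₂ z ^ 2 + τ.S₂ z ^ 4)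
        - (τ.P₁ z ^ 4 - 2 * τ.E * τ.P₁ z ^ 2 * τ.S₁ z ^ 2 + τ.S₁ z ^ 4)) * h.rootE_mul
    + (τ.P₂ z ^ 4 + τ.S₂ z ^ 4 - τ.P₁ z ^ 4 - τ.S₁ z ^ 4) * hdenE
    + (τ.P₁ z ^ 2 * τ.S₁ z ^ 2 - τ.P₂ z ^ 2 * τ.S₂ z ^ 2) * h.E_mul_denE

end Kummer

/-! ### Independence of `μ` and `ν` -/

section Midpoint

variable {E : Type*} [NormedAddCommGroup E] [NormedSpace ℂ E] {f g : E → ℂ}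

theorem apply_eq_of_fderiv_eq_mul {l φ : E →L[ℂ] ℂ} {e w : E} {r s : ℂ}
    (hf : DifferentiableAt ℂ f 0) (hf₀ : f 0 ≠ 0) (hl : ∀ z, fderiv ℂ f z e = (r + l z) * f z)
    (hw : ∀ z, f (z + w) = exp (s + φ z) * f z) : l w = φ e := by
  have hfactor : HasFDerivAt (fun z => exp (s + φ z) * f z) _ 0 :=
    (φ.hasFDerivAt.const_add s).cexp.mul hf.hasFDerivAt
  have hfderiv := hfactor.fderiv
  rw [← funext hw, fderiv_comp_add_right] at hfderiv
  have hdir := DFunLike.congr_fun hfderiv e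
  simp only [_root_.smul_apply, _root_.add_apply, smul_eq_mul, hl, zero_add, map_zero,
    add_zero] at hdir
  have hw₀ := hw 0
  rw [zero_add, map_zero, add_zero] at hw₀
  refine mul_right_cancel₀ (mul_ne_zero (exp_ne_zero s) hf₀) ?_
  linear_combination hdir - (r + l w) * hw₀

theorem fderiv_eq_of_midpoint {U : Set E} (hU : IsOpen U) (hconv : Convex ℝ U)
    (hg : ∀ z ∈ U, DifferentiableAt ℂ g z)
    (hmid : ∀ x ∈ U, ∀ y ∈ U, g x + g y = 2 * g ((1 / 2 : ℂ) • (x + y))) {x y : E}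
    (hx : x ∈ U) (hy : y ∈ U) : fderiv ℂ g x = fderiv ℂ g y := by
  have hmem : ∀ x ∈ U, ∀ y ∈ U, (1 / 2 : ℂ) • (x + y) ∈ U := fun x hx y hy => by
    have h := hconv hx hy (a := 1 / 2) (b := 1 / 2) (by norm_num) (by norm_num) (by norm_num)
    rwa [← smul_add, ← Complex.coe_smul, show ((1 / 2 : ℝ) : ℂ) = 1 / 2 by norm_num] at h
  have hfderiv_mid : ∀ x ∈ U, ∀ y ∈ U, fderiv ℂ g x = fderiv ℂ g ((1 / 2 : ℂ) • (x + y)) := by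
    intro x hx y hy
    have hline := ((hasFDerivAt_id (𝕜 := ℂ) x).add_const y).const_smul (1 / 2 : ℂ)
    have hleft := (hg x hx).hasFDerivAt.add_const (g y)
    have hright := (HasFDerivAt.comp x (hg _ (hmem x hx y hy)).hasFDerivAt hline).const_mul 2
    have heq : (fun z => g z + g y) =ᶠ[nhds x] fun z => 2 * g ((1 / 2 : ℂ) • (z + y)) := by
      filter_upwards [hU.mem_nhds hx] with z hz using hmid z hz y hy
    rw [hleft.unique (hright.congr_of_eventuallyEq heq)]
    ext e
    simp
  rw [hfderiv_mid x hx y hy, add_comm, ← hfderiv_mid y hy x hx]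

theorem exists_eq_add_apply_of_midpoint {U : Set E} (hU : IsOpen U) (hconv : Convex ℝ U)
    (h₀ : 0 ∈ U) (hg : ∀ z ∈ U, DifferentiableAt ℂ g z)
    (hmid : ∀ x ∈ U, ∀ y ∈ U, g x + g y = 2 * g ((1 / 2 : ℂ) • (x + y))) :
    ∃ l : E →L[ℂ] ℂ, ∀ z ∈ U, g z = g 0 + l z := by
  refine ⟨fderiv ℂ g 0, fun z hz => ?_⟩
  have hdiff : ∀ x ∈ U, HasFDerivAt (fun y => g y - fderiv ℂ g 0 y) 0 x := fun x hx => by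
    have h := (hg x hx).hasFDerivAt.sub (fderiv ℂ g 0).hasFDerivAt
    rwa [fderiv_eq_of_midpoint hU hconv hg hmid hx h₀, sub_self] at h
  have hconst := hU.is_const_of_fderiv_eq_zero (𝕜 := ℂ) hconv.isPreconnected
    (fun x hx => (hdiff x hx).differentiableAt.differentiableWithinAt)
    (fun x hx => (hdiff x hx).fderiv) hz h₀
  rw [map_zero] at hconst
  linear_combination hconst

theorem eq_of_eventuallyEq_of_differentiable (hf : Differentiable ℂ f) (hg : Differentiable ℂ g)
    (h : f =ᶠ[nhds 0] g) (z : E) : f z = g z := by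
  have hline : Differentiable ℂ fun s : ℂ => s • z := differentiable_id.smul_const z
  have hf' : AnalyticOnNhd ℂ (fun s : ℂ => f (s • z)) Set.univ :=
    (hf.comp hline).differentiableOn.analyticOnNhd isOpen_univ
  have hg' : AnalyticOnNhd ℂ (fun s : ℂ => g (s • z)) Set.univ :=
    (hg.comp hline).differentiableOn.analyticOnNhd isOpen_univ
  have htendsto : Filter.Tendsto (fun s : ℂ => s • z) (nhds 0) (nhds 0) := by
    simpa only [zero_smul] using hline.continuous.tendsto 0
  simpa only [one_smul] using
    congrFun (hf'.eq_of_eventuallyEq hg' (z₀ := 0) (htendsto.eventually h)) 1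

end Midpoint

theorem eq_zero_of_fderiv_theta {l : ℂ × ℂ →L[ℂ] ℂ} {e : ℂ × ℂ} {r : ℂ}
    (h₀ : τ.theta 0 0 b d 0 ≠ 0)
    (hl : ∀ z, fderiv ℂ (τ.theta 0 0 b d) z e = (r + l z) * τ.theta 0 0 b d z) : e = 0 := by
  have hdiff := τ.differentiable_theta 0 0 b d 0
  have hlattice : ∀ m n : ℤ, l ((m : ℂ), (n : ℂ)) = 0 := fun m n =>
    apply_eq_of_fderiv_eq_mul (φ := 0) (s := 0) hdiff h₀ hl fun z => by
      rw [theta_zero_zero_add_int, _root_.zero_apply, add_zero, exp_zero, one_mul]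
  have hl_zero : ∀ w, l w = 0 := fun w => by
    have h₁ := hlattice 1 0
    have h₂ := hlattice 0 1
    rw [Int.cast_one, Int.cast_zero] at h₁ h₂
    rw [apply_prod_eq, h₁, h₂, zero_mul, zero_mul, add_zero]
  have hperiod : ∀ m n : ℤ, (m : ℂ) * e.1 + n * e.2 = 0 := fun m n => by
    have h := apply_eq_of_fderiv_eq_mul
      (φ := -(2 * Real.pi * I) • ((m : ℂ) • .fst ℂ ℂ ℂ + (n : ℂ) • .snd ℂ ℂ ℂ)) hdiff h₀ hl
      (s := -(Real.pi * I) * (τ.τ₁₁ * m ^ 2 + 2 * τ.τ₁₂ * m * n + τ.τ₂₂ * n ^ 2)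
        - Real.pi * I * (m * b + n * d))
      (w := (τ.τ₁₁ * m + τ.τ₁₂ * n, τ.τ₁₂ * m + τ.τ₂₂ * n)) fun z => by
        rw [theta_add_int_mul_period]
        congr 2
        simp only [_root_.smul_apply, _root_.add_apply, smul_eq_mul, ContinuousLinearMap.coe_fst',
          ContinuousLinearMap.coe_snd']
        ring
    rw [hl_zero] at h
    exact (mul_eq_zero.1 h.symm).resolve_left (neg_ne_zero.2 two_pi_I_ne_zero)
  exact Prod.ext (by simpa using hperiod 1 0) (by simpa using hperiod 0 1)

theorem Nondegenerate.fderiv_kummer_quartic (h : τ.Nondegenerate) (z e : ℂ × ℂ) :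
    (τ.P₁ z ^ 3 - τ.E * τ.P₁ z * τ.S₁ z ^ 2 - τ.F * τ.P₁ z * τ.P₂ z ^ 2
        + τ.C * τ.P₁ z * τ.S₂ z ^ 2 - τ.D * τ.P₂ z * τ.S₁ z * τ.S₂ z) * fderiv ℂ τ.P₁ z e
      + (τ.P₂ z ^ 3 - τ.E * τ.P₂ z * τ.S₂ z ^ 2 - τ.F * τ.P₁ z ^ 2 * τ.P₂ z
        + τ.C * τ.P₂ z * τ.S₁ z ^ 2 - τ.D * τ.P₁ z * τ.S₁ z * τ.S₂ z) * fderiv ℂ τ.P₂ z e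
      + (τ.S₁ z ^ 3 - τ.E * τ.P₁ z ^ 2 * τ.S₁ z - τ.F * τ.S₁ z * τ.S₂ z ^ 2
        + τ.C * τ.P₂ z ^ 2 * τ.S₁ z - τ.D * τ.P₁ z * τ.P₂ z * τ.S₂ z) * fderiv ℂ τ.S₁ z e
      + (τ.S₂ z ^ 3 - τ.E * τ.P₂ z ^ 2 * τ.S₂ z - τ.F * τ.S₁ z ^ 2 * τ.S₂ z
        + τ.C * τ.P₁ z ^ 2 * τ.S₂ z - τ.D * τ.P₁ z * τ.P₂ z * τ.S₁ z) * fderiv ℂ τ.S₂ z e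
      = 0 := by
  have hP₁ := (τ.differentiable_P₁ z).hasFDerivAt
  have hP₂ := (τ.differentiable_P₂ z).hasFDerivAt
  have hS₁ := (τ.differentiable_S₁ z).hasFDerivAt
  have hS₂ := (τ.differentiable_S₂ z).hasFDerivAt
  have hquartic := ((((((hP₁.pow 4).add (hS₁.pow 4)).add (hP₂.pow 4)).add (hS₂.pow 4)).sub
    ((((hP₁.pow 2).mul (hS₁.pow 2)).add ((hP₂.pow 2).mul (hS₂.pow 2))).const_mul (2 * τ.E))).sub
    ((((hP₁.mul hP₂).pow 2).add ((hS₁.mul hS₂).pow 2)).const_mul (2 * τ.F))).add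
    ((((hP₁.pow 2).mul (hS₂.pow 2)).add ((hP₂.pow 2).mul (hS₁.pow 2))).const_mul (2 * τ.C))
    |>.sub ((((hP₁.mul hP₂).mul hS₁).mul hS₂).const_mul (4 * τ.D))
  have hzero := hquartic.congr_of_eventuallyEq
    (Filter.Eventually.of_forall fun z => (h.kummer_quartic z).symm)
  have hdir := DFunLike.congr_fun (hzero.unique (hasFDerivAt_const (0 : ℂ) z)) e
  simp only [_root_.smul_apply, _root_.add_apply, _root_.sub_apply, _root_.zero_apply,
    smul_eq_mul, nsmul_eq_mul, Pi.mul_apply] at hdir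
  push_cast at hdir
  linear_combination hdir / 4

section CommonKernel

variable {e : ℂ × ℂ}

theorem Nondegenerate.P₁_mul_fderiv_S₁ (h : τ.Nondegenerate) (hν : τ.ν e = 0) (hμ : τ.μ e = 0)
    (z : ℂ × ℂ) : τ.P₁ z * fderiv ℂ τ.S₁ z e = τ.S₁ z * fderiv ℂ τ.P₁ z e := by
  have hwr := h.wronskian₁ z e
  rw [hν, hμ] at hwr
  linear_combination hwr

theorem Nondegenerate.P₂_mul_fderiv_S₂ (h : τ.Nondegenerate) (hν : τ.ν e = 0) (hμ : τ.μ e = 0)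
    (z : ℂ × ℂ) : τ.P₂ z * fderiv ℂ τ.S₂ z e = τ.S₂ z * fderiv ℂ τ.P₂ z e := by
  have hwr := h.wronskian₂ z e
  rw [hν, hμ] at hwr
  linear_combination hwr

theorem Nondegenerate.P₁_mul_fderiv_P₂ (h : τ.Nondegenerate) (hν : τ.ν e = 0) (hμ : τ.μ e = 0)
    {z : ℂ × ℂ} (hne : τ.evenν z * τ.evenμ z ≠ 0) :
    τ.P₁ z * fderiv ℂ τ.P₂ z e = τ.P₂ z * fderiv ℂ τ.P₁ z e := by
  refine mul_left_cancel₀ (right_ne_zero_of_mul (h.evenν_mul_evenμ z ▸ hne)) ?_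
  linear_combination 2 * τ.P₁ z * τ.P₂ z * h.fderiv_kummer_quartic z e
    - 2 * τ.P₂ z * (τ.S₁ z ^ 3 - τ.E * τ.P₁ z ^ 2 * τ.S₁ z - τ.F * τ.S₁ z * τ.S₂ z ^ 2
      + τ.C * τ.P₂ z ^ 2 * τ.S₁ z - τ.D * τ.P₁ z * τ.P₂ z * τ.S₂ z) * h.P₁_mul_fderiv_S₁ hν hμ z
    - 2 * τ.P₁ z * (τ.S₂ z ^ 3 - τ.E * τ.P₂ z ^ 2 * τ.S₂ z - τ.F * τ.S₁ z ^ 2 * τ.S₂ z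
      + τ.C * τ.P₁ z ^ 2 * τ.S₂ z - τ.D * τ.P₁ z * τ.P₂ z * τ.S₁ z) * h.P₂_mul_fderiv_S₂ hν hμ z
    - (fderiv ℂ τ.P₁ z e * τ.P₂ z + τ.P₁ z * fderiv ℂ τ.P₂ z e) * h.kummer_quartic z

theorem Nondegenerate.P₁_mul_fderiv_S₂ (h : τ.Nondegenerate) (hν : τ.ν e = 0) (hμ : τ.μ e = 0)
    {z : ℂ × ℂ} (hne : τ.evenν z * τ.evenμ z ≠ 0) (hP₂ : τ.P₂ z ≠ 0) :
    τ.P₁ z * fderiv ℂ τ.S₂ z e = τ.S₂ z * fderiv ℂ τ.P₁ z e := by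
  refine mul_left_cancel₀ hP₂ ?_
  linear_combination τ.P₁ z * h.P₂_mul_fderiv_S₂ hν hμ z + τ.S₂ z * h.P₁_mul_fderiv_P₂ hν hμ hne

theorem Nondegenerate.exists_P₁_add_mul_P₁_sub_eq (h : τ.Nondegenerate) (w : ℂ × ℂ) :
    ∃ c₁ c₂ c₃ c₄ : ℂ, ∀ z, τ.P₁ (z + w) * τ.P₁ (z - w)
      = c₁ * τ.P₁ z ^ 2 + c₂ * τ.P₂ z ^ 2 + c₃ * τ.S₁ z ^ 2 + c₄ * τ.S₂ z ^ 2 := by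
  have htw := h.tw
  have huv := h.uv
  refine ⟨(τ.t * τ.X₀ w - τ.w * τ.X₃ w) / (2 * (τ.t ^ 2 - τ.w ^ 2))
      + (τ.u * τ.X₁ w - τ.v * τ.X₂ w) / (2 * (τ.u ^ 2 - τ.v ^ 2)),
    (τ.t * τ.X₀ w - τ.w * τ.X₃ w) / (2 * (τ.t ^ 2 - τ.w ^ 2))
      - (τ.u * τ.X₁ w - τ.v * τ.X₂ w) / (2 * (τ.u ^ 2 - τ.v ^ 2)),
    (τ.t * τ.X₃ w - τ.w * τ.X₀ w) / (2 * (τ.t ^ 2 - τ.w ^ 2))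
      + (τ.u * τ.X₂ w - τ.v * τ.X₁ w) / (2 * (τ.u ^ 2 - τ.v ^ 2)),
    (τ.t * τ.X₃ w - τ.w * τ.X₀ w) / (2 * (τ.t ^ 2 - τ.w ^ 2))
      - (τ.u * τ.X₂ w - τ.v * τ.X₁ w) / (2 * (τ.u ^ 2 - τ.v ^ 2)), fun z => ?_⟩
  rw [P₁_add_mul_P₁_sub, P₁_sq, P₂_sq, S₁_sq, S₂_sq]
  field_simp
  ring

theorem Nondegenerate.fderiv_P₁_add_mul_P₁_sub (h : τ.Nondegenerate) (hν : τ.ν e = 0)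
    (hμ : τ.μ e = 0) {z : ℂ × ℂ} (hne : τ.evenν z * τ.evenμ z ≠ 0) (hP₂ : τ.P₂ z ≠ 0)
    (w : ℂ × ℂ) :
    τ.P₁ z * (fderiv ℂ τ.P₁ (z + w) e * τ.P₁ (z - w) + τ.P₁ (z + w) * fderiv ℂ τ.P₁ (z - w) e)
      = 2 * fderiv ℂ τ.P₁ z e * (τ.P₁ (z + w) * τ.P₁ (z - w)) := by
  obtain ⟨c₁, c₂, c₃, c₄, hsq⟩ := h.exists_P₁_add_mul_P₁_sub_eq w
  have hproduct := (((τ.differentiable_P₁ (z + w)).hasFDerivAt.comp z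
      ((hasFDerivAt_id (𝕜 := ℂ) z).add_const w)).mul
    ((τ.differentiable_P₁ (z - w)).hasFDerivAt.comp z ((hasFDerivAt_id (𝕜 := ℂ) z).sub_const w)))
  have hsquares := (((((τ.differentiable_P₁ z).hasFDerivAt.pow 2).const_mul c₁).add
    (((τ.differentiable_P₂ z).hasFDerivAt.pow 2).const_mul c₂)).add
    (((τ.differentiable_S₁ z).hasFDerivAt.pow 2).const_mul c₃)).add
    (((τ.differentiable_S₂ z).hasFDerivAt.pow 2).const_mul c₄)
  have hdir := DFunLike.congr_fun (hproduct.unique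
    (hsquares.congr_of_eventuallyEq (Filter.Eventually.of_forall hsq))) e
  simp only [ContinuousLinearMap.comp_id, _root_.add_apply, _root_.smul_apply, smul_eq_mul,
    nsmul_eq_mul, Function.comp_apply, id] at hdir
  push_cast at hdir
  rw [hsq]
  linear_combination τ.P₁ z * hdir + 2 * c₂ * τ.P₂ z * h.P₁_mul_fderiv_P₂ hν hμ hne
    + 2 * c₃ * τ.S₁ z * h.P₁_mul_fderiv_S₁ hν hμ z
    + 2 * c₄ * τ.S₂ z * h.P₁_mul_fderiv_S₂ hν hμ hne hP₂

theorem Nondegenerate.exists_ball_fderiv_P₁_midpoint (h : τ.Nondegenerate) (hν : τ.ν e = 0)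
    (hμ : τ.μ e = 0) : ∃ ε > 0, (∀ z ∈ Metric.ball (0 : ℂ × ℂ) ε, τ.P₁ z ≠ 0) ∧
      ∀ x ∈ Metric.ball (0 : ℂ × ℂ) ε, ∀ y ∈ Metric.ball (0 : ℂ × ℂ) ε,
        fderiv ℂ τ.P₁ x e / τ.P₁ x + fderiv ℂ τ.P₁ y e / τ.P₁ y
          = 2 * (fderiv ℂ τ.P₁ ((1 / 2 : ℂ) • (x + y)) e / τ.P₁ ((1 / 2 : ℂ) • (x + y))) := by
  have hnear : ∀ᶠ z in nhds (0 : ℂ × ℂ),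
      τ.P₁ z ≠ 0 ∧ τ.evenν z * τ.evenμ z ≠ 0 ∧ τ.P₂ z ≠ 0 :=
    (τ.differentiable_P₁.continuous.continuousAt.eventually_ne h.P₁_zero_ne).and
      (((τ.differentiable_evenν.continuous.mul
        τ.differentiable_evenμ.continuous).continuousAt.eventually_ne
          h.evenν_zero_mul_evenμ_zero_ne).and
        (τ.differentiable_P₂.continuous.continuousAt.eventually_ne h.P₂_zero_ne))
  obtain ⟨ε, hε, hball⟩ := Metric.eventually_nhds_iff_ball.1 hnear
  refine ⟨ε, hε, fun z hz => (hball z hz).1, fun x hx y hy => ?_⟩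
  have hmid : (1 / 2 : ℂ) • (x + y) ∈ Metric.ball (0 : ℂ × ℂ) ε := by
    rw [mem_ball_zero_iff] at *
    rw [norm_smul, show ‖(1 / 2 : ℂ)‖ = 1 / 2 by norm_num]
    linarith [norm_add_le x y]
  obtain ⟨hP₁, hne, hP₂⟩ := hball _ hmid
  have hxy := h.fderiv_P₁_add_mul_P₁_sub hν hμ hne hP₂ ((1 / 2 : ℂ) • (x - y))
  rw [show (1 / 2 : ℂ) • (x + y) + (1 / 2 : ℂ) • (x - y) = x by module,
    show (1 / 2 : ℂ) • (x + y) - (1 / 2 : ℂ) • (x - y) = y by module] at hxy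
  have hPx := (hball x hx).1
  have hPy := (hball y hy).1
  field_simp
  linear_combination hxy

theorem Nondegenerate.eq_zero_of_ν_eq_zero_of_μ_eq_zero (h : τ.Nondegenerate) (hν : τ.ν e = 0)
    (hμ : τ.μ e = 0) : e = 0 := by
  obtain ⟨ε, hε, hP₁, hmid⟩ := h.exists_ball_fderiv_P₁_midpoint hν hμ
  have hdiff : Differentiable ℂ fun z => fderiv ℂ τ.P₁ z e :=
    (τ.differentiable_fderiv_theta 0 0 0 1).clm_apply (differentiable_const e)
  obtain ⟨l, hl⟩ := exists_eq_add_apply_of_midpoint Metric.isOpen_ball (convex_ball 0 ε)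
    (Metric.mem_ball_self hε) (g := fun z => fderiv ℂ τ.P₁ z e / τ.P₁ z)
    (fun z hz => (hdiff z).mul ((τ.differentiable_P₁ z).inv (hP₁ z hz))) hmid
  refine eq_zero_of_fderiv_theta 0 1 h.P₁_zero_ne
    (eq_of_eventuallyEq_of_differentiable hdiff
      ((l.differentiable.const_add (fderiv ℂ τ.P₁ 0 e / τ.P₁ 0)).mul τ.differentiable_P₁) ?_)
  filter_upwards [Metric.ball_mem_nhds (0 : ℂ × ℂ) hε] with z hz
  exact (div_eq_iff (hP₁ z hz)).1 (hl z hz)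

end CommonKernel

/-! ### The functions `x` and `x'` and their differentials -/

variable (τ) in
theorem x_neg (r : ℂ × ℂ → ℂ) : τ.x (-r) = τ.x' r := by
  ext z
  simp [x, x']

variable (τ) in
theorem x'_neg (r : ℂ × ℂ → ℂ) : τ.x' (-r) = τ.x r := by
  ext z
  simp [x, x', sub_eq_add_neg]

variable (τ) in
theorem x_add_x' (r : ℂ × ℂ → ℂ) (z : ℂ × ℂ) :
    τ.x r z + τ.x' r z = 2 * (τ.E * (1 + τ.p z ^ 2 * τ.q z ^ 2) - (τ.p z ^ 2 + τ.q z ^ 2))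
      / ((τ.E + 1) * (τ.p z * τ.q z + 1) ^ 2) := by
  rw [x, x']
  ring

/-- The numerator of the `p`-derivative of the function `x` of `p` and `q`, where `r` is the value
of `Δ(p) Δ(q)`. -/
noncomputable def derivNumerator (τ : Period) (p q r : ℂ) : ℂ :=
  r * (q + τ.E * p - τ.E * p ^ 2 * q - p ^ 3)
    - τ.ΔSq p * (p + τ.E * q - τ.E * q ^ 2 * p - q ^ 3)

theorem hasFDerivAt_ΔSq_comp {X : Type*} [NormedAddCommGroup X] [NormedSpace ℂ X] {f : X → ℂ}
    {f' : X →L[ℂ] ℂ} {z : X} (hf : HasFDerivAt f f' z) :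
    HasFDerivAt (fun w => τ.ΔSq (f w)) ((-4 * τ.E * f z + 4 * f z ^ 3) • f') z := by
  have hΔSq : HasDerivAt τ.ΔSq (-4 * τ.E * f z + 4 * f z ^ 3) (f z) := by
    refine ((((hasDerivAt_pow 2 (f z)).const_mul (2 * τ.E)).const_sub 1).add
      (hasDerivAt_pow 4 (f z))).congr_deriv ?_
    norm_num
    ring
  exact hΔSq.comp_hasFDerivAt z hf

namespace IsBranch

variable {V : Set (ℂ × ℂ)} {r : ℂ × ℂ → ℂ} {z : ℂ × ℂ}

theorem neg (hr : τ.IsBranch V r) : τ.IsBranch V (-r) where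
  isOpen := hr.isOpen
  differentiableOn := hr.differentiableOn.neg
  P₁_ne := hr.P₁_ne
  P₂_ne := hr.P₂_ne
  one_add_pq_ne := hr.one_add_pq_ne
  sq_eq z hz := by rw [Pi.neg_apply, neg_sq, hr.sq_eq z hz]
  ne_zero z hz := neg_ne_zero.2 (hr.ne_zero z hz)
  f₅_x_ne z hz := by simpa only [x_neg] using hr.f₅_x'_ne z hz
  f₅_x'_ne z hz := by simpa only [x'_neg] using hr.f₅_x_ne z hz

theorem mul_x (hr : τ.IsBranch V r) (h : τ.Nondegenerate) (hz : z ∈ V) :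
    (τ.E + 1) * (τ.p z * τ.q z + 1) ^ 2 * τ.x r z
      = τ.E * (1 + τ.p z ^ 2 * τ.q z ^ 2) - (τ.p z ^ 2 + τ.q z ^ 2) - r z :=
  mul_div_cancel₀ _ (mul_ne_zero h.E_add_one_ne (pow_ne_zero 2 (hr.one_add_pq_ne z hz)))

theorem mul_x' (hr : τ.IsBranch V r) (h : τ.Nondegenerate) (hz : z ∈ V) :
    (τ.E + 1) * (τ.p z * τ.q z + 1) ^ 2 * τ.x' r z
      = τ.E * (1 + τ.p z ^ 2 * τ.q z ^ 2) - (τ.p z ^ 2 + τ.q z ^ 2) + r z :=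
  mul_div_cancel₀ _ (mul_ne_zero h.E_add_one_ne (pow_ne_zero 2 (hr.one_add_pq_ne z hz)))

theorem mul_x_sub_x' (hr : τ.IsBranch V r) (h : τ.Nondegenerate) (hz : z ∈ V) :
    (τ.E + 1) * (τ.p z * τ.q z + 1) ^ 2 * (τ.x r z - τ.x' r z) = -2 * r z := by
  linear_combination hr.mul_x h hz - hr.mul_x' h hz

theorem x_sub_x'_ne (hr : τ.IsBranch V r) (h : τ.Nondegenerate) (hz : z ∈ V) :
    τ.x r z - τ.x' r z ≠ 0 :=
  right_ne_zero_of_mul (hr.mul_x_sub_x' h hz ▸ mul_ne_zero (by norm_num) (hr.ne_zero z hz))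

theorem mul_x_mul_x' (hr : τ.IsBranch V r) (h : τ.Nondegenerate) (hz : z ∈ V) :
    (τ.E + 1) * (τ.p z * τ.q z + 1) ^ 2 * (τ.x r z * τ.x' r z)
      = (τ.E - 1) * (1 - τ.p z * τ.q z) ^ 2 := by
  refine mul_left_cancel₀
    (mul_ne_zero h.E_add_one_ne (pow_ne_zero 2 (hr.one_add_pq_ne z hz))) ?_
  have hsq := hr.sq_eq z hz
  rw [ΔSq, ΔSq] at hsq
  linear_combination (τ.E + 1) * (τ.p z * τ.q z + 1) ^ 2 * τ.x' r z * hr.mul_x h hz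
    + (τ.E * (1 + τ.p z ^ 2 * τ.q z ^ 2) - (τ.p z ^ 2 + τ.q z ^ 2) - r z) * hr.mul_x' h hz - hsq

theorem x_add_x'_eq (hr : τ.IsBranch V r) (h : τ.Nondegenerate) (hz : z ∈ V) :
    τ.x r z + τ.x' r z = 2 * τ.E / (τ.E + 1)
      - 2 * (τ.p z ^ 2 + τ.q z ^ 2 + 2 * τ.E * τ.p z * τ.q z)
        / ((τ.E + 1) * (1 + τ.p z * τ.q z) ^ 2) := by
  have hE := h.E_add_one_ne
  have hpq := hr.one_add_pq_ne z hz
  rw [x_add_x', add_comm 1 (τ.p z * τ.q z)]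
  field_simp
  ring

theorem neg_x_mul_x'_eq (hr : τ.IsBranch V r) (h : τ.Nondegenerate) (hz : z ∈ V) :
    -(τ.x r z * τ.x' r z) = -(τ.E - 1) / (τ.E + 1)
      + 4 * (τ.E - 1) * τ.p z * τ.q z / ((τ.E + 1) * (1 + τ.p z * τ.q z) ^ 2) := by
  have hE := h.E_add_one_ne
  have hpq := hr.one_add_pq_ne z hz
  rw [add_comm 1 (τ.p z * τ.q z)]
  field_simp
  linear_combination -hr.mul_x_mul_x' h hz

theorem ΔSq_p_ne (hr : τ.IsBranch V r) (hz : z ∈ V) : τ.ΔSq (τ.p z) ≠ 0 :=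
  left_ne_zero_of_mul (hr.sq_eq z hz ▸ pow_ne_zero 2 (hr.ne_zero z hz))

theorem differentiableOn_p (hr : τ.IsBranch V r) : DifferentiableOn ℂ τ.p V :=
  (τ.differentiable_S₁.differentiableOn.mul
    (τ.differentiable_P₁.differentiableOn.fun_inv hr.P₁_ne)).congr fun _ _ => div_eq_mul_inv _ _

theorem differentiableOn_q (hr : τ.IsBranch V r) : DifferentiableOn ℂ τ.q V :=
  (τ.differentiable_S₂.differentiableOn.mul
    (τ.differentiable_P₂.differentiableOn.fun_inv hr.P₂_ne)).congr fun _ _ => div_eq_mul_inv _ _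

theorem differentiableOn_x (hr : τ.IsBranch V r) (h : τ.Nondegenerate) :
    DifferentiableOn ℂ (τ.x r) V := by
  have hp := hr.differentiableOn_p
  have hq := hr.differentiableOn_q
  have hr' := hr.differentiableOn
  have hnum : DifferentiableOn ℂ (fun z => τ.E * (1 + τ.p z ^ 2 * τ.q z ^ 2)
    - (τ.p z ^ 2 + τ.q z ^ 2) - r z) V := by fun_prop
  have hden : DifferentiableOn ℂ (fun z => (τ.E + 1) * (τ.p z * τ.q z + 1) ^ 2) V := by fun_prop
  refine (hnum.mul (hden.fun_inv fun z hz => ?_)).congr fun z _ => div_eq_mul_inv _ _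
  exact mul_ne_zero h.E_add_one_ne (pow_ne_zero 2 (hr.one_add_pq_ne z hz))

theorem fderiv_p (hr : τ.IsBranch V r) (h : τ.Nondegenerate) (hz : z ∈ V) (e : ℂ × ℂ) :
    fderiv ℂ τ.p z e = (τ.evenν z * τ.ν e + τ.evenμ z * τ.μ e) / τ.P₁ z ^ 2 := by
  have hV := hr.isOpen.mem_nhds hz
  have hP := hr.P₁_ne z hz
  have hmul := (τ.differentiable_P₁ z).hasFDerivAt.mul
    (hr.differentiableOn_p.differentiableAt hV).hasFDerivAt
  have hS := DFunLike.congr_fun (hmul.unique <|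
    (τ.differentiable_S₁ z).hasFDerivAt.congr_of_eventuallyEq <|
      Filter.eventually_of_mem hV fun w hw => mul_div_cancel₀ _ (hr.P₁_ne w hw)) e
  simp only [_root_.add_apply, _root_.smul_apply, smul_eq_mul] at hS
  rw [eq_div_iff (pow_ne_zero 2 hP), ← h.wronskian₁, ← hS, p]
  field_simp
  ring

theorem fderiv_q (hr : τ.IsBranch V r) (h : τ.Nondegenerate) (hz : z ∈ V) (e : ℂ × ℂ) :
    fderiv ℂ τ.q z e = (τ.evenν z * τ.ν e - τ.evenμ z * τ.μ e) / τ.P₂ z ^ 2 := by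
  have hV := hr.isOpen.mem_nhds hz
  have hP := hr.P₂_ne z hz
  have hmul := (τ.differentiable_P₂ z).hasFDerivAt.mul
    (hr.differentiableOn_q.differentiableAt hV).hasFDerivAt
  have hS := DFunLike.congr_fun (hmul.unique <|
    (τ.differentiable_S₂ z).hasFDerivAt.congr_of_eventuallyEq <|
      Filter.eventually_of_mem hV fun w hw => mul_div_cancel₀ _ (hr.P₂_ne w hw)) e
  simp only [_root_.add_apply, _root_.smul_apply, smul_eq_mul] at hS
  rw [eq_div_iff (pow_ne_zero 2 hP), ← h.wronskian₂, ← hS, q]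
  field_simp
  ring

theorem two_mul_r_mul_fderiv_r (hr : τ.IsBranch V r) (hz : z ∈ V) (e : ℂ × ℂ) :
    2 * r z * fderiv ℂ r z e
      = (-4 * τ.E * τ.p z + 4 * τ.p z ^ 3) * fderiv ℂ τ.p z e * τ.ΔSq (τ.q z)
        + τ.ΔSq (τ.p z) * ((-4 * τ.E * τ.q z + 4 * τ.q z ^ 3) * fderiv ℂ τ.q z e) := by
  have hV := hr.isOpen.mem_nhds hz
  have hp := (hr.differentiableOn_p.differentiableAt hV).hasFDerivAt
  have hq := (hr.differentiableOn_q.differentiableAt hV).hasFDerivAt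
  have hr' := (hr.differentiableOn.differentiableAt hV).hasFDerivAt
  have heq := DFunLike.congr_fun ((hr'.pow 2).unique <|
    ((hasFDerivAt_ΔSq_comp hp).mul (hasFDerivAt_ΔSq_comp hq)).congr_of_eventuallyEq <|
      Filter.eventually_of_mem hV hr.sq_eq) e
  simp only [_root_.add_apply, _root_.smul_apply, smul_eq_mul] at heq
  norm_num at heq
  linear_combination heq

theorem mul_fderiv_x (hr : τ.IsBranch V r) (h : τ.Nondegenerate) (hz : z ∈ V) (e : ℂ × ℂ) :
    (τ.E + 1) * (τ.p z * τ.q z + 1) ^ 3 * fderiv ℂ (τ.x r) z e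
      = (τ.E * (2 * τ.p z * fderiv ℂ τ.p z e * τ.q z ^ 2
          + 2 * τ.p z ^ 2 * τ.q z * fderiv ℂ τ.q z e)
        - (2 * τ.p z * fderiv ℂ τ.p z e + 2 * τ.q z * fderiv ℂ τ.q z e) - fderiv ℂ r z e)
          * (τ.p z * τ.q z + 1)
        - 2 * (fderiv ℂ τ.p z e * τ.q z + τ.p z * fderiv ℂ τ.q z e)
          * (τ.E * (1 + τ.p z ^ 2 * τ.q z ^ 2) - (τ.p z ^ 2 + τ.q z ^ 2) - r z) := by
  have hV := hr.isOpen.mem_nhds hz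
  have hp := (hr.differentiableOn_p.differentiableAt hV).hasFDerivAt
  have hq := (hr.differentiableOn_q.differentiableAt hV).hasFDerivAt
  have hr' := (hr.differentiableOn.differentiableAt hV).hasFDerivAt
  have hx := ((hr.differentiableOn_x h).differentiableAt hV).hasFDerivAt
  have hlhs := ((((hp.fun_mul hq).add_const 1).pow 2).const_mul (τ.E + 1)).fun_mul hx
  have hrhs := (((((hp.pow 2).fun_mul (hq.pow 2)).const_add 1).const_mul τ.E).fun_sub
    ((hp.pow 2).fun_add (hq.pow 2))).fun_sub hr'
  have heq := DFunLike.congr_fun (hlhs.unique <| hrhs.congr_of_eventuallyEq <|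
    Filter.eventually_of_mem hV fun w hw => hr.mul_x h hw) e
  simp only [_root_.add_apply, _root_.sub_apply, _root_.smul_apply, smul_eq_mul] at heq
  norm_num at heq
  linear_combination (τ.p z * τ.q z + 1) * heq
    - 2 * (fderiv ℂ τ.p z e * τ.q z + τ.p z * fderiv ℂ τ.q z e) * hr.mul_x h hz

theorem fderiv_x (hr : τ.IsBranch V r) (h : τ.Nondegenerate) (hz : z ∈ V) (e : ℂ × ℂ) :
    fderiv ℂ (τ.x r) z e
      = 2 * τ.derivNumerator (τ.p z) (τ.q z) (r z)
        / ((τ.E + 1) * (τ.p z * τ.q z + 1) ^ 3 * τ.ΔSq (τ.p z))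
        * (fderiv ℂ τ.p z e - τ.ΔSq (τ.p z) / r z * fderiv ℂ τ.q z e) := by
  have hE := h.E_add_one_ne
  have hpq := hr.one_add_pq_ne z hz
  have hr0 := hr.ne_zero z hz
  have hp := hr.ΔSq_p_ne hz
  have hcleared : (τ.E + 1) * (τ.p z * τ.q z + 1) ^ 3 * (r z * τ.ΔSq (τ.p z))
        * fderiv ℂ (τ.x r) z e
      = 2 * τ.derivNumerator (τ.p z) (τ.q z) (r z)
        * (r z * fderiv ℂ τ.p z e - τ.ΔSq (τ.p z) * fderiv ℂ τ.q z e) := by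
    have hsq := hr.sq_eq z hz
    have hr' := hr.two_mul_r_mul_fderiv_r hz e
    rw [derivNumerator]
    rw [ΔSq, ΔSq] at *
    linear_combination r z * (1 - 2 * τ.E * τ.p z ^ 2 + τ.p z ^ 4) * hr.mul_fderiv_x h hz e
      - (1 - 2 * τ.E * τ.p z ^ 2 + τ.p z ^ 4) / 2 * (τ.p z * τ.q z + 1) * hr'
      + (2 * (1 - 2 * τ.E * τ.p z ^ 2 + τ.p z ^ 4)
          * (fderiv ℂ τ.p z e * τ.q z + τ.p z * fderiv ℂ τ.q z e)
        - 2 * (τ.q z + τ.E * τ.p z - τ.E * τ.p z ^ 2 * τ.q z - τ.p z ^ 3)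
          * fderiv ℂ τ.p z e) * hsq
  refine mul_left_cancel₀ (mul_ne_zero (mul_ne_zero hE (pow_ne_zero 3 hpq))
    (mul_ne_zero hr0 hp)) (hcleared.trans ?_)
  field_simp

end IsBranch

/-! ### Factorization of the coefficients of `dx` -/

/-- The right-hand side of the quartic relation between `P₁, S₁, P₂, S₂`, divided by
`2 (P₁ P₂)²`. -/
noncomputable def kummerForm (τ : Period) (z : ℂ × ℂ) : ℂ :=
  τ.F * (1 + τ.p z ^ 2 * τ.q z ^ 2) - τ.C * (τ.p z ^ 2 + τ.q z ^ 2) + 2 * τ.D * (τ.p z * τ.q z)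

/-- The constant factor in the factorization of `evenν ^ 2`. -/
noncomputable def evenScale (τ : Period) : ℂ :=
  (τ.b + τ.b₁) * (τ.E₁ - 1) ^ 2 / (16 * (τ.E - τ.E₁))

theorem Nondegenerate.evenScale_mul (h : τ.Nondegenerate) :
    τ.evenScale * (16 * (τ.E - τ.E₁)) = (τ.b + τ.b₁) * (τ.E₁ - 1) ^ 2 :=
  div_mul_cancel₀ _ (mul_ne_zero (by norm_num) h.E_sub_E₁_ne)

theorem Nondegenerate.evenScale_ne_zero (h : τ.Nondegenerate) : τ.evenScale ≠ 0 :=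
  left_ne_zero_of_mul
    (h.evenScale_mul ▸ mul_ne_zero h.b_add_b₁_ne (pow_ne_zero 2 h.E₁_sub_one_ne))

namespace IsBranch

variable {V : Set (ℂ × ℂ)} {r : ℂ × ℂ → ℂ} {z : ℂ × ℂ}

theorem one_sub_m₁_mul_x_ne (hr : τ.IsBranch V r) (hz : z ∈ V) : 1 - τ.m₁ * τ.x r z ≠ 0 :=
  right_ne_zero_of_mul (left_ne_zero_of_mul (hr.f₅_x_ne z hz))

theorem one_sub_m₁_mul_x'_ne (hr : τ.IsBranch V r) (hz : z ∈ V) : 1 - τ.m₁ * τ.x' r z ≠ 0 :=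
  right_ne_zero_of_mul (left_ne_zero_of_mul (hr.f₅_x'_ne z hz))

theorem derivNumerator_sq (hr : τ.IsBranch V r) (h : τ.Nondegenerate) (hz : z ∈ V) :
    τ.derivNumerator (τ.p z) (τ.q z) (r z) ^ 2
      = -((τ.E ^ 2 - 1) * (τ.E + 1)) / 2 * τ.ΔSq (τ.p z)
        * (τ.x r z * (1 - τ.x r z) * (1 - τ.m * τ.x r z)) * (τ.p z * τ.q z + 1) ^ 6 := by
  have hcleared : -((τ.E ^ 2 - 1) * (τ.E + 1)) / 2 * τ.ΔSq (τ.p z)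
        * (τ.x r z * (1 - τ.x r z) * (1 - τ.m * τ.x r z)) * (τ.p z * τ.q z + 1) ^ 6
      = -(1 / 2) * τ.ΔSq (τ.p z) * ((τ.E + 1) * (τ.p z * τ.q z + 1) ^ 2 * τ.x r z)
        * ((τ.E + 1) * (τ.p z * τ.q z + 1) ^ 2 - (τ.E + 1) * (τ.p z * τ.q z + 1) ^ 2 * τ.x r z)
        * ((τ.E - 1) * (τ.p z * τ.q z + 1) ^ 2
          - (τ.E + 1) * (τ.p z * τ.q z + 1) ^ 2 * τ.x r z) := by
    linear_combination (τ.E + 1) ^ 2 / 2 * τ.ΔSq (τ.p z) * τ.x r z ^ 2 * (1 - τ.x r z)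
      * (τ.p z * τ.q z + 1) ^ 6 * h.m_mul
  have hsq := hr.sq_eq z hz
  rw [hcleared, hr.mul_x h hz, derivNumerator]
  rw [ΔSq, ΔSq] at *
  linear_combination
    ((τ.q z + τ.E * τ.p z - τ.E * τ.p z ^ 2 * τ.q z - τ.p z ^ 3) ^ 2
      + (1 - 2 * τ.E * τ.p z ^ 2 + τ.p z ^ 4) / 2 * (-2 * τ.E * (τ.p z * τ.q z + 1) ^ 2
        + 3 * (τ.E * (1 + τ.p z ^ 2 * τ.q z ^ 2) - (τ.p z ^ 2 + τ.q z ^ 2)) - r z)) * hsq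

theorem mul_one_sub_m₁_x_mul_one_sub_m₁_x' (hr : τ.IsBranch V r) (h : τ.Nondegenerate)
    (hz : z ∈ V) :
    (τ.E₁ - 1) ^ 2 * ((τ.E + 1) * (τ.p z * τ.q z + 1) ^ 2
        * ((1 - τ.m₁ * τ.x r z) * (1 - τ.m₁ * τ.x' r z)))
      = 2 * (2 * (τ.E - τ.E₁) * (1 + τ.p z ^ 2 * τ.q z ^ 2)
        + (τ.E₁ ^ 2 - 1) * (τ.p z ^ 2 + τ.q z ^ 2)
        + 2 * (τ.E₁ ^ 2 - 2 * τ.E * τ.E₁ + 1) * (τ.p z * τ.q z)) := by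
  calc
    _ = (τ.E + 1) * (τ.p z * τ.q z + 1) ^ 2 * (((τ.E₁ - 1) - τ.m₁ * (τ.E₁ - 1) * τ.x r z)
        * ((τ.E₁ - 1) - τ.m₁ * (τ.E₁ - 1) * τ.x' r z)) := by ring
    _ = _ := by
      rw [h.m₁_mul]
      linear_combination -(τ.E₁ ^ 2 - 1) * (hr.mul_x h hz + hr.mul_x' h hz)
        + (τ.E₁ + 1) ^ 2 * hr.mul_x_mul_x' h hz

theorem mul_one_sub_m₂_x_mul_one_sub_m₁_x' (hr : τ.IsBranch V r) (h : τ.Nondegenerate)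
    (hz : z ∈ V) :
    (τ.E + 1) * (τ.p z * τ.q z + 1) ^ 2 * ((1 - τ.m₂ * τ.x r z) * (1 - τ.m₁ * τ.x' r z))
      = (τ.m₁ - τ.m₂) * (τ.kummerForm z - r z) := by
  refine mul_left_cancel₀ (mul_ne_zero h.E₁_sub_one_ne h.E₂_sub_one_ne) ?_
  calc
    _ = (τ.E + 1) * (τ.p z * τ.q z + 1) ^ 2 * (((τ.E₂ - 1) - τ.m₂ * (τ.E₂ - 1) * τ.x r z)
        * ((τ.E₁ - 1) - τ.m₁ * (τ.E₁ - 1) * τ.x' r z)) := by ring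
    _ = 2 * (τ.E₂ - τ.E₁) * (τ.kummerForm z - r z) := by
      rw [h.m₁_mul, h.m₂_mul, kummerForm]
      linear_combination -(τ.E₂ + 1) * (τ.E₁ - 1) * hr.mul_x h hz
        - (τ.E₁ + 1) * (τ.E₂ - 1) * hr.mul_x' h hz
        + (τ.E₁ + 1) * (τ.E₂ + 1) * hr.mul_x_mul_x' h hz
        - 2 * (1 + τ.p z ^ 2 * τ.q z ^ 2) * h.F_mul_E₂_sub_E₁
        + 2 * (τ.p z ^ 2 + τ.q z ^ 2) * h.C_mul_E₂_sub_E₁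
        - 4 * (τ.p z * τ.q z) * h.D_mul_E₂_sub_E₁
    _ = _ := by linear_combination -(τ.kummerForm z - r z) * h.m₁_sub_m₂_mul

theorem mul_one_sub_m₂_x'_mul_one_sub_m₁_x (hr : τ.IsBranch V r) (h : τ.Nondegenerate)
    (hz : z ∈ V) :
    (τ.E + 1) * (τ.p z * τ.q z + 1) ^ 2 * ((1 - τ.m₂ * τ.x' r z) * (1 - τ.m₁ * τ.x r z))
      = (τ.m₁ - τ.m₂) * (τ.kummerForm z + r z) := by
  simpa only [x_neg, x'_neg, Pi.neg_apply, sub_neg_eq_add]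
    using hr.neg.mul_one_sub_m₂_x_mul_one_sub_m₁_x' h hz

theorem kummer_quartic (hr : τ.IsBranch V r) (h : τ.Nondegenerate) (hz : z ∈ V) :
    τ.P₁ z ^ 4 * τ.ΔSq (τ.p z) + τ.P₂ z ^ 4 * τ.ΔSq (τ.q z)
      = 2 * (τ.P₁ z * τ.P₂ z) ^ 2 * τ.kummerForm z := by
  have hP₁ := hr.P₁_ne z hz
  have hP₂ := hr.P₂_ne z hz
  rw [kummerForm, p, q, ΔSq, ΔSq]
  field_simp
  linear_combination h.kummer_quartic z

theorem r_mul_P₂_sq_sub_sq (hr : τ.IsBranch V r) (h : τ.Nondegenerate) (hz : z ∈ V) :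
    (r z * τ.P₂ z ^ 2 - τ.ΔSq (τ.p z) * τ.P₁ z ^ 2) ^ 2
      = 2 * τ.ΔSq (τ.p z) * (τ.P₁ z * τ.P₂ z) ^ 2 * (τ.kummerForm z - r z) := by
  linear_combination τ.P₂ z ^ 4 * hr.sq_eq z hz + τ.ΔSq (τ.p z) * hr.kummer_quartic h hz

theorem r_mul_P₂_sq_add_sq (hr : τ.IsBranch V r) (h : τ.Nondegenerate) (hz : z ∈ V) :
    (r z * τ.P₂ z ^ 2 + τ.ΔSq (τ.p z) * τ.P₁ z ^ 2) ^ 2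
      = 2 * τ.ΔSq (τ.p z) * (τ.P₁ z * τ.P₂ z) ^ 2 * (τ.kummerForm z + r z) := by
  linear_combination τ.P₂ z ^ 4 * hr.sq_eq z hz + τ.ΔSq (τ.p z) * hr.kummer_quartic h hz

theorem evenν_sq (hr : τ.IsBranch V r) (h : τ.Nondegenerate) (hz : z ∈ V) :
    τ.evenν z ^ 2 = τ.evenScale * (τ.P₁ z * τ.P₂ z) ^ 2
      * ((τ.E + 1) * (τ.p z * τ.q z + 1) ^ 2
        * ((1 - τ.m₁ * τ.x r z) * (1 - τ.m₁ * τ.x' r z))) := by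
  have hP₁ := hr.P₁_ne z hz
  have hP₂ := hr.P₂_ne z hz
  have hE := h.E_sub_E₁_ne
  calc
    _ = (τ.b + τ.b₁) / (16 * (τ.E - τ.E₁)) * (τ.P₁ z * τ.P₂ z) ^ 2
        * (2 * (2 * (τ.E - τ.E₁) * (1 + τ.p z ^ 2 * τ.q z ^ 2)
          + (τ.E₁ ^ 2 - 1) * (τ.p z ^ 2 + τ.q z ^ 2)
          + 2 * (τ.E₁ ^ 2 - 2 * τ.E * τ.E₁ + 1) * (τ.p z * τ.q z))) := by
      rw [h.evenν_sq, p, q]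
      field_simp
      ring
    _ = _ := by
      rw [← hr.mul_one_sub_m₁_x_mul_one_sub_m₁_x' h hz, evenScale]
      ring

theorem evenν_ne_zero (hr : τ.IsBranch V r) (h : τ.Nondegenerate) (hz : z ∈ V) :
    τ.evenν z ≠ 0 := by
  refine pow_ne_zero_iff two_ne_zero |>.1 (hr.evenν_sq h hz ▸ ?_)
  exact mul_ne_zero (mul_ne_zero h.evenScale_ne_zero
    (pow_ne_zero 2 (mul_ne_zero (hr.P₁_ne z hz) (hr.P₂_ne z hz))))
    (mul_ne_zero (mul_ne_zero h.E_add_one_ne (pow_ne_zero 2 (hr.one_add_pq_ne z hz)))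
      (mul_ne_zero (hr.one_sub_m₁_mul_x_ne hz) (hr.one_sub_m₁_mul_x'_ne hz)))

theorem ΔSq_p_mul_evenν_mul_evenμ (hr : τ.IsBranch V r) (h : τ.Nondegenerate) (hz : z ∈ V) :
    τ.ΔSq (τ.p z) * (τ.evenν z * τ.evenμ z)
      = τ.rootE * ((r z * τ.P₂ z ^ 2 - τ.ΔSq (τ.p z) * τ.P₁ z ^ 2)
        * (r z * τ.P₂ z ^ 2 + τ.ΔSq (τ.p z) * τ.P₁ z ^ 2)) := by
  have hP₁ := hr.P₁_ne z hz
  have hP₂ := hr.P₂_ne z hz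
  have heven : τ.evenν z * τ.evenμ z
      = τ.rootE * (τ.P₂ z ^ 4 * τ.ΔSq (τ.q z) - τ.P₁ z ^ 4 * τ.ΔSq (τ.p z)) := by
    rw [h.evenν_mul_evenμ, p, q, ΔSq, ΔSq]
    field_simp
  linear_combination τ.ΔSq (τ.p z) * heven - τ.rootE * τ.P₂ z ^ 4 * hr.sq_eq z hz

theorem fderiv_x_eq_ν_add_μ (hr : τ.IsBranch V r) (h : τ.Nondegenerate) (hz : z ∈ V)
    (e : ℂ × ℂ) :
    fderiv ℂ (τ.x r) z e
      = 2 * τ.derivNumerator (τ.p z) (τ.q z) (r z)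
        / ((τ.E + 1) * (τ.p z * τ.q z + 1) ^ 3 * τ.ΔSq (τ.p z) * r z * (τ.P₁ z * τ.P₂ z) ^ 2)
        * ((r z * τ.P₂ z ^ 2 - τ.ΔSq (τ.p z) * τ.P₁ z ^ 2) * τ.evenν z * τ.ν e
          + (r z * τ.P₂ z ^ 2 + τ.ΔSq (τ.p z) * τ.P₁ z ^ 2) * τ.evenμ z * τ.μ e) := by
  have hP₁ := hr.P₁_ne z hz
  have hP₂ := hr.P₂_ne z hz
  have hr0 := hr.ne_zero z hz
  rw [hr.fderiv_x h hz, hr.fderiv_p h hz, hr.fderiv_q h hz]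
  field_simp
  ring

end IsBranch

/-! ### Normalization and the inversion system -/

/-- The constants `κ₁` and `κ₂` for which the coefficients of `κ₁ ν` and `κ₂ μ` in `dx` are
`√f₅(x)` times rational functions of `x` and `x'`. -/
structure IsNormalization (τ : Period) (κ₁ κ₂ : ℂ) : Prop where
  sq_eq : κ₁ ^ 2 = -16 * (τ.E - 1) * (τ.evenScale * (τ.m₁ - τ.m₂))
  mul_eq : κ₂ * (τ.evenScale * (τ.m₁ - τ.m₂)) = -2 * κ₁ * τ.rootE

theorem Nondegenerate.m₁_sub_m₂_ne (h : τ.Nondegenerate) : τ.m₁ - τ.m₂ ≠ 0 :=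
  sub_ne_zero.2 h.m₁_ne_m₂

theorem Nondegenerate.rootE_ne_zero (h : τ.Nondegenerate) : τ.rootE ≠ 0 := fun h₀ => by
  simpa [h₀] using h.rootE_sq

theorem Nondegenerate.exists_isNormalization (h : τ.Nondegenerate) :
    ∃ κ₁ κ₂ : ℂ, τ.IsNormalization κ₁ κ₂ := by
  obtain ⟨κ₁, hκ₁⟩ := IsAlgClosed.exists_pow_nat_eq
    (-16 * (τ.E - 1) * (τ.evenScale * (τ.m₁ - τ.m₂))) two_pos
  exact ⟨κ₁, -2 * κ₁ * τ.rootE / (τ.evenScale * (τ.m₁ - τ.m₂)), hκ₁,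
    div_mul_cancel₀ _ (mul_ne_zero h.evenScale_ne_zero h.m₁_sub_m₂_ne)⟩

namespace IsNormalization

variable {κ₁ κ₂ : ℂ}

theorem κ₁_ne_zero (hκ : τ.IsNormalization κ₁ κ₂) (h : τ.Nondegenerate) : κ₁ ≠ 0 := by
  refine pow_ne_zero_iff two_ne_zero |>.1 (hκ.sq_eq ▸ ?_)
  exact mul_ne_zero (mul_ne_zero (by norm_num) h.E_sub_one_ne)
    (mul_ne_zero h.evenScale_ne_zero h.m₁_sub_m₂_ne)

theorem κ₂_ne_zero (hκ : τ.IsNormalization κ₁ κ₂) (h : τ.Nondegenerate) : κ₂ ≠ 0 := by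
  refine left_ne_zero_of_mul (b := τ.evenScale * (τ.m₁ - τ.m₂)) ?_
  rw [hκ.mul_eq]
  exact mul_ne_zero (mul_ne_zero (by norm_num) (hκ.κ₁_ne_zero h)) h.rootE_ne_zero

theorem κ₁_sq (hκ : τ.IsNormalization κ₁ κ₂) (h : τ.Nondegenerate) :
    κ₁ ^ 2 = 4 * (τ.b + τ.b₁) * ((1 - τ.E) * (1 - τ.E₁) / ((τ.F + 1) * (1 - τ.E₂))) := by
  have hden : (τ.F + 1) * (1 - τ.E₂) ≠ 0 :=
    mul_ne_zero h.F_add_one_ne (sub_ne_zero.2 (sub_ne_zero.1 h.E₂_sub_one_ne).symm)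
  rw [← mul_div_assoc, eq_div_iff hden, hκ.sq_eq]
  refine mul_right_cancel₀ h.E_sub_E₁_ne ?_
  linear_combination -(τ.E - 1) * (τ.m₁ - τ.m₂) * (τ.F + 1) * (1 - τ.E₂) * h.evenScale_mul
    + (τ.E - 1) * (τ.b + τ.b₁) * (τ.E₁ - 1) * (τ.F + 1) * h.m₁_sub_m₂_mul
    + 2 * (τ.E - 1) * (τ.b + τ.b₁) * (τ.E₁ - 1) * h.E₂_sub_E₁_mul

theorem κ₁_sq_mul_κ₂_sq (hκ : τ.IsNormalization κ₁ κ₂) (h : τ.Nondegenerate) :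
    κ₁ ^ 2 * κ₂ ^ 2 * (τ.E + 1) = 16 * (τ.E - 1) := by
  refine mul_right_cancel₀ (mul_ne_zero h.evenScale_ne_zero h.m₁_sub_m₂_ne) ?_
  linear_combination
    (κ₂ ^ 2 * (τ.E + 1) * (τ.evenScale * (τ.m₁ - τ.m₂)) - 1) * hκ.sq_eq
    - 16 * (τ.E ^ 2 - 1) * (κ₂ * (τ.evenScale * (τ.m₁ - τ.m₂)) - 2 * κ₁ * τ.rootE) * hκ.mul_eq
    - κ₁ ^ 2 * h.rootE_sq

theorem κ₂_sq (hκ : τ.IsNormalization κ₁ κ₂) (h : τ.Nondegenerate) :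
    κ₂ ^ 2 = 4 * (τ.b - τ.b₁) * ((1 - τ.E) * (1 - τ.E₂) / ((τ.F - 1) * (1 - τ.E₁))) := by
  have hE₁ : 1 - τ.E₁ ≠ 0 := sub_ne_zero.2 (sub_ne_zero.1 h.E₁_sub_one_ne).symm
  have hE₂ : 1 - τ.E₂ ≠ 0 := sub_ne_zero.2 (sub_ne_zero.1 h.E₂_sub_one_ne).symm
  have hF := h.F_add_one_ne
  have hF' := h.F_sub_one_ne
  set κ₂sq := 4 * (τ.b - τ.b₁) * ((1 - τ.E) * (1 - τ.E₂) / ((τ.F - 1) * (1 - τ.E₁))) with hκ₂sq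
  have hprod : κ₁ ^ 2 * κ₂sq * (τ.F ^ 2 - 1)
      = 16 * ((τ.b + τ.b₁) * (τ.b - τ.b₁)) * (1 - τ.E) ^ 2 := by
    rw [hκ.κ₁_sq h, hκ₂sq]
    field_simp
    ring
  have hprod' : κ₁ ^ 2 * κ₂sq * (τ.E + 1) = 16 * (τ.E - 1) := by
    refine mul_right_cancel₀ h.F_sq_sub_one_ne ?_
    linear_combination (τ.E + 1) * hprod + 16 * (τ.E - 1) * h.b_add_b₁_mul_b_sub_b₁
  refine mul_left_cancel₀
    (mul_ne_zero (pow_ne_zero 2 (hκ.κ₁_ne_zero h)) h.E_add_one_ne) ?_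
  linear_combination hκ.κ₁_sq_mul_κ₂_sq h - hprod'

theorem exists_coordinates (hκ : τ.IsNormalization κ₁ κ₂) (h : τ.Nondegenerate) :
    ∃ L : (ℂ × ℂ) ≃L[ℂ] (ℂ × ℂ),
      ∀ z, L z = ((τ.m₁ * (κ₁ * τ.ν z) - τ.m₂ * (κ₂ * τ.μ z)) / (τ.m₁ - τ.m₂),
        (κ₁ * τ.ν z - κ₂ * τ.μ z) / (τ.m₁ - τ.m₂)) := by
  have hm := h.m₁_sub_m₂_ne
  let L₀ : ℂ × ℂ →L[ℂ] ℂ × ℂ :=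
    ((τ.m₁ - τ.m₂)⁻¹ • (τ.m₁ • κ₁ • τ.ν - τ.m₂ • κ₂ • τ.μ)).prod
      ((τ.m₁ - τ.m₂)⁻¹ • (κ₁ • τ.ν - κ₂ • τ.μ))
  have hL₀ : ∀ z, L₀ z = ((τ.m₁ * (κ₁ * τ.ν z) - τ.m₂ * (κ₂ * τ.μ z)) / (τ.m₁ - τ.m₂),
      (κ₁ * τ.ν z - κ₂ * τ.μ z) / (τ.m₁ - τ.m₂)) := fun z => by
    simp [L₀, div_eq_inv_mul]
  have hinj : Function.Injective (L₀ : ℂ × ℂ →ₗ[ℂ] ℂ × ℂ) := by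
    refine LinearMap.ker_eq_bot.1 (LinearMap.ker_eq_bot'.2 fun z hz => ?_)
    have hz' : L₀ z = 0 := hz
    rw [hL₀, Prod.mk_eq_zero, div_eq_zero_iff, div_eq_zero_iff] at hz'
    have hU₁ := hz'.1.resolve_right hm
    have hU₂ := hz'.2.resolve_right hm
    have hν : (τ.m₁ - τ.m₂) * κ₁ * τ.ν z = 0 := by linear_combination hU₁ - τ.m₂ * hU₂
    have hμ : (τ.m₁ - τ.m₂) * κ₂ * τ.μ z = 0 := by linear_combination hU₁ - τ.m₁ * hU₂
    exact h.eq_zero_of_ν_eq_zero_of_μ_eq_zero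
      ((mul_eq_zero.1 hν).resolve_left (mul_ne_zero hm (hκ.κ₁_ne_zero h)))
      ((mul_eq_zero.1 hμ).resolve_left (mul_ne_zero hm (hκ.κ₂_ne_zero h)))
  exact ⟨(LinearEquiv.ofInjectiveEndo _ hinj).toContinuousLinearEquiv, hL₀⟩

end IsNormalization

/-- The branch of `√f₅(x)` for which the inversion system holds. -/
noncomputable def sqrtf₅ (τ : Period) (κ₁ : ℂ) (r : ℂ × ℂ → ℂ) (z : ℂ × ℂ) : ℂ :=
  -4 * τ.derivNumerator (τ.p z) (τ.q z) (r z)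
    * (r z * τ.P₂ z ^ 2 - τ.ΔSq (τ.p z) * τ.P₁ z ^ 2) * τ.evenν z * (τ.m₁ - τ.m₂)
    / (κ₁ * ((τ.E + 1) ^ 2 * (τ.p z * τ.q z + 1) ^ 5 * τ.ΔSq (τ.p z)
      * (τ.P₁ z * τ.P₂ z) ^ 2 * (1 - τ.m₁ * τ.x' r z)))

namespace IsBranch

variable {V : Set (ℂ × ℂ)} {r : ℂ × ℂ → ℂ} {z : ℂ × ℂ} {κ₁ κ₂ : ℂ}

theorem differentiableOn_x' (hr : τ.IsBranch V r) (h : τ.Nondegenerate) :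
    DifferentiableOn ℂ (τ.x' r) V :=
  τ.x_neg r ▸ hr.neg.differentiableOn_x h

theorem sqrtf₅_den_ne (hr : τ.IsBranch V r) (h : τ.Nondegenerate) (hκ₁ : κ₁ ≠ 0) (hz : z ∈ V) :
    κ₁ * ((τ.E + 1) ^ 2 * (τ.p z * τ.q z + 1) ^ 5 * τ.ΔSq (τ.p z)
      * (τ.P₁ z * τ.P₂ z) ^ 2 * (1 - τ.m₁ * τ.x' r z)) ≠ 0 := by
  have hE := h.E_add_one_ne
  have hpq := hr.one_add_pq_ne z hz
  have hp := hr.ΔSq_p_ne hz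
  have hP₁ := hr.P₁_ne z hz
  have hP₂ := hr.P₂_ne z hz
  have hx' := hr.one_sub_m₁_mul_x'_ne hz
  positivity

theorem differentiableOn_sqrtf₅ (hr : τ.IsBranch V r) (h : τ.Nondegenerate) (hκ₁ : κ₁ ≠ 0) :
    DifferentiableOn ℂ (τ.sqrtf₅ κ₁ r) V := by
  have hp := hr.differentiableOn_p
  have hq := hr.differentiableOn_q
  have hr' := hr.differentiableOn
  have hx' := hr.differentiableOn_x' h
  have hν := τ.differentiable_evenν.differentiableOn (s := V)
  have hP₁ := τ.differentiable_P₁.differentiableOn (s := V)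
  have hP₂ := τ.differentiable_P₂.differentiableOn (s := V)
  have hΔ : DifferentiableOn ℂ (fun z => τ.ΔSq (τ.p z)) V := by
    unfold ΔSq
    fun_prop
  have hJ : DifferentiableOn ℂ (fun z => τ.derivNumerator (τ.p z) (τ.q z) (r z)) V := by
    unfold derivNumerator
    fun_prop
  have hden : DifferentiableOn ℂ (fun z => (κ₁ * ((τ.E + 1) ^ 2 * (τ.p z * τ.q z + 1) ^ 5
      * τ.ΔSq (τ.p z) * (τ.P₁ z * τ.P₂ z) ^ 2 * (1 - τ.m₁ * τ.x' r z)))⁻¹) V :=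
    DifferentiableOn.fun_inv (by fun_prop) fun z hz => hr.sqrtf₅_den_ne h hκ₁ hz
  unfold sqrtf₅
  simp only [div_eq_mul_inv]
  fun_prop

theorem sqrtf₅_sq (hr : τ.IsBranch V r) (h : τ.Nondegenerate) (hκ : τ.IsNormalization κ₁ κ₂)
    (hz : z ∈ V) : τ.sqrtf₅ κ₁ r z ^ 2 = τ.f₅ (τ.x r z) := by
  rw [sqrtf₅, div_pow, div_eq_iff (pow_ne_zero 2 (hr.sqrtf₅_den_ne h (hκ.κ₁_ne_zero h) hz)),
    mul_pow κ₁, hκ.sq_eq, f₅]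
  have hJ := hr.derivNumerator_sq h hz
  have hA := hr.r_mul_P₂_sq_sub_sq h hz
  have hν := hr.evenν_sq h hz
  have hform := hr.mul_one_sub_m₂_x_mul_one_sub_m₁_x' h hz
  generalize τ.p z * τ.q z + 1 = k at hJ hν hform ⊢
  generalize r z * τ.P₂ z ^ 2 - τ.ΔSq (τ.p z) * τ.P₁ z ^ 2 = A at hA ⊢
  generalize τ.P₁ z * τ.P₂ z = Q at hA hν ⊢
  generalize 1 - τ.m₁ * τ.x r z = l at hν ⊢
  generalize 1 - τ.m₁ * τ.x' r z = l' at hν hform ⊢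
  generalize τ.x r z * (1 - τ.x r z) * (1 - τ.m * τ.x r z) = X at hJ ⊢
  calc
    _ = 16 * (τ.m₁ - τ.m₂) ^ 2
        * (τ.derivNumerator (τ.p z) (τ.q z) (r z) ^ 2 * A ^ 2 * τ.evenν z ^ 2) := by ring
    _ = _ := by
      rw [hJ, hA, hν]
      linear_combination 16 * (τ.m₁ - τ.m₂) * (τ.E ^ 2 - 1) * (τ.E + 1) ^ 2 * τ.evenScale
        * τ.ΔSq (τ.p z) ^ 2 * Q ^ 4 * k ^ 8 * X * l * l' * hform

theorem mul_evenμ_eq (hr : τ.IsBranch V r) (h : τ.Nondegenerate)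
    (hκ : τ.IsNormalization κ₁ κ₂) (hz : z ∈ V) :
    (r z * τ.P₂ z ^ 2 + τ.ΔSq (τ.p z) * τ.P₁ z ^ 2) * τ.evenμ z * (κ₁ * (1 - τ.m₁ * τ.x' r z))
      = -((r z * τ.P₂ z ^ 2 - τ.ΔSq (τ.p z) * τ.P₁ z ^ 2) * τ.evenν z
        * (κ₂ * (1 - τ.m₂ * τ.x' r z))) := by
  set Q := (τ.P₁ z * τ.P₂ z) ^ 2 with hQ
  set k := (τ.E + 1) * (τ.p z * τ.q z + 1) ^ 2 with hk
  set A := r z * τ.P₂ z ^ 2 - τ.ΔSq (τ.p z) * τ.P₁ z ^ 2 with hA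
  set B := r z * τ.P₂ z ^ 2 + τ.ΔSq (τ.p z) * τ.P₁ z ^ 2 with hB
  have hprod := hr.ΔSq_p_mul_evenν_mul_evenμ h hz
  have hBsq := hr.r_mul_P₂_sq_add_sq h hz
  have hνsq := hr.evenν_sq h hz
  have hform := hr.mul_one_sub_m₂_x'_mul_one_sub_m₁_x h hz
  rw [← hA, ← hB] at hprod
  rw [← hB, ← hQ] at hBsq
  rw [← hQ, ← hk] at hνsq
  rw [← hk] at hform
  refine mul_left_cancel₀
    (mul_ne_zero (mul_ne_zero (hr.ΔSq_p_ne hz) (hr.evenν_ne_zero h hz)) h.m₁_sub_m₂_ne) ?_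
  linear_combination
    κ₁ * (1 - τ.m₁ * τ.x' r z) * (τ.m₁ - τ.m₂) * B * hprod
    + κ₁ * (1 - τ.m₁ * τ.x' r z) * (τ.m₁ - τ.m₂) * τ.rootE * A * hBsq
    - 2 * κ₁ * (1 - τ.m₁ * τ.x' r z) * τ.rootE * A * τ.ΔSq (τ.p z) * Q * hform
    + A * τ.ΔSq (τ.p z) * (τ.m₁ - τ.m₂) * κ₂ * (1 - τ.m₂ * τ.x' r z) * hνsq
    + A * τ.ΔSq (τ.p z) * Q * k * (1 - τ.m₂ * τ.x' r z)
      * ((1 - τ.m₁ * τ.x r z) * (1 - τ.m₁ * τ.x' r z)) * hκ.mul_eq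

theorem mul_fderiv_x_eq (hr : τ.IsBranch V r) (h : τ.Nondegenerate)
    (hκ : τ.IsNormalization κ₁ κ₂) (hz : z ∈ V) (e : ℂ × ℂ) :
    (τ.m₁ - τ.m₂) * (τ.x r z - τ.x' r z) * fderiv ℂ (τ.x r) z e
      = τ.sqrtf₅ κ₁ r z * ((1 - τ.m₁ * τ.x' r z) * (κ₁ * τ.ν e)
        - (1 - τ.m₂ * τ.x' r z) * (κ₂ * τ.μ e)) := by
  have hE := h.E_add_one_ne
  have hpq := hr.one_add_pq_ne z hz
  have hp := hr.ΔSq_p_ne hz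
  have hr₀ := hr.ne_zero z hz
  have hP₁ := hr.P₁_ne z hz
  have hP₂ := hr.P₂_ne z hz
  have hx' := hr.one_sub_m₁_mul_x'_ne hz
  have hκ₁ := hκ.κ₁_ne_zero h
  have hdiff : τ.x r z - τ.x' r z = -2 * r z / ((τ.E + 1) * (τ.p z * τ.q z + 1) ^ 2) := by
    rw [eq_div_iff (mul_ne_zero hE (pow_ne_zero 2 hpq)), mul_comm]
    exact hr.mul_x_sub_x' h hz
  have hμ := (eq_div_iff (mul_ne_zero hκ₁ hx')).2 (hr.mul_evenμ_eq h hκ hz)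
  rw [hr.fderiv_x_eq_ν_add_μ h hz, hμ, hdiff, sqrtf₅]
  field_simp
  ring

theorem sqrtf₅_ne_zero (hr : τ.IsBranch V r) (h : τ.Nondegenerate)
    (hκ : τ.IsNormalization κ₁ κ₂) (hz : z ∈ V) : τ.sqrtf₅ κ₁ r z ≠ 0 :=
  pow_ne_zero_iff two_ne_zero |>.1 (hr.sqrtf₅_sq h hκ hz ▸ hr.f₅_x_ne z hz)

end IsBranch

theorem div_mul_add_div_mul_eq {c y y' dx dx' A A' g g' ω : ℂ} (hc : c ≠ 0) (hy : y ≠ 0)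
    (hy' : y' ≠ 0) (h : c * dx = y * A) (h' : -c * dx' = y' * A')
    (hω : g * A - g' * A' = c * ω) : g / y * dx + g' / y' * dx' = ω := by
  rw [div_mul_eq_mul_div, div_mul_eq_mul_div, div_add_div _ _ hy hy',
    div_eq_iff (mul_ne_zero hy hy')]
  refine mul_left_cancel₀ hc ?_
  linear_combination g * y' * h - y * g' * h' + y * y' * hω

theorem IsBranch.solvesInversion {V : Set (ℂ × ℂ)} {r : ℂ × ℂ → ℂ} {κ₁ κ₂ : ℂ}
    (hr : τ.IsBranch V r) (h : τ.Nondegenerate) (hκ : τ.IsNormalization κ₁ κ₂) :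
    SolvesInversion τ.f₅ ![fun x => 1 - τ.m₂ * x, fun x => 1 - τ.m₁ * x]
      ![κ₁ • τ.ν, κ₂ • τ.μ] V (τ.x r) (τ.x' r) := by
  have hκ₁ := hκ.κ₁_ne_zero h
  refine ⟨hr.differentiableOn_x h, hr.differentiableOn_x' h, τ.sqrtf₅ κ₁ r, τ.sqrtf₅ κ₁ (-r),
    hr.differentiableOn_sqrtf₅ h hκ₁, hr.neg.differentiableOn_sqrtf₅ h hκ₁, fun z hz => ?_⟩
  have hsq' := hr.neg.sqrtf₅_sq h hκ hz
  have hdx' := hr.neg.mul_fderiv_x_eq h hκ hz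
  simp only [x_neg, x'_neg] at hsq' hdx'
  have hy := hr.sqrtf₅_ne_zero h hκ hz
  have hy' := hr.neg.sqrtf₅_ne_zero h hκ hz
  have hc := mul_ne_zero h.m₁_sub_m₂_ne (hr.x_sub_x'_ne h hz)
  refine ⟨hy, hy', hr.sqrtf₅_sq h hκ hz, hsq', fun i => ContinuousLinearMap.ext fun e => ?_⟩
  have hdx'e : -((τ.m₁ - τ.m₂) * (τ.x r z - τ.x' r z)) * fderiv ℂ (τ.x' r) z e
      = τ.sqrtf₅ κ₁ (-r) z * ((1 - τ.m₁ * τ.x r z) * (κ₁ * τ.ν e)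
        - (1 - τ.m₂ * τ.x r z) * (κ₂ * τ.μ e)) := by
    rw [← hdx' e]
    ring
  refine div_mul_add_div_mul_eq hc hy hy' (hr.mul_fderiv_x_eq h hκ hz e) hdx'e ?_
  fin_cases i
  · change _ = _ * (κ₁ * τ.ν e)
    simp only [Fin.zero_eta, Matrix.cons_val_zero]
    ring
  · change _ = _ * (κ₂ * τ.μ e)
    simp only [Fin.mk_one, Matrix.cons_val_one, Matrix.cons_val_fin_one]
    ring

end Period

namespace SolvesInversion

variable {f : ℂ → ℂ} {g : Fin 2 → ℂ → ℂ} {ω : Fin 2 → ℂ × ℂ →L[ℂ] ℂ} {V : Set (ℂ × ℂ)}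
  {X X' : ℂ × ℂ → ℂ}

theorem matrix_combination (h : SolvesInversion f g ω V X X') (A : Matrix (Fin 2) (Fin 2) ℂ) :
    SolvesInversion f (fun i x => ∑ j, A i j * g j x) (fun i => ∑ j, A i j • ω j) V X X' := by
  obtain ⟨hX, hX', y, y', hy, hy', hsol⟩ := h
  refine ⟨hX, hX', y, y', hy, hy', fun z hz => ?_⟩
  obtain ⟨hyz, hyz', hsq, hsq', hω⟩ := hsol z hz
  refine ⟨hyz, hyz', hsq, hsq', fun i => ?_⟩
  simp only [← hω, Fin.sum_univ_two]
  module

theorem comp_symm (h : SolvesInversion f g ω V X X') (L : (ℂ × ℂ) ≃L[ℂ] (ℂ × ℂ)) :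
    SolvesInversion f g (fun i => (ω i).comp (L.symm : ℂ × ℂ →L[ℂ] ℂ × ℂ)) (L '' V)
      (fun U => X (L.symm U)) (fun U => X' (L.symm U)) := by
  obtain ⟨hX, hX', y, y', hy, hy', hsol⟩ := h
  have hmaps : Set.MapsTo L.symm (L '' V) V := by
    rintro _ ⟨z, hz, rfl⟩
    rwa [L.symm_apply_apply]
  have hcomp {F : ℂ × ℂ → ℂ} (hF : DifferentiableOn ℂ F V) :
      DifferentiableOn ℂ (fun U => F (L.symm U)) (L '' V) :=
    hF.comp L.symm.differentiable.differentiableOn hmaps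
  refine ⟨hcomp hX, hcomp hX', _, _, hcomp hy, hcomp hy', fun U hU => ?_⟩
  obtain ⟨hyz, hyz', hsq, hsq', hω⟩ := hsol _ (hmaps hU)
  refine ⟨hyz, hyz', hsq, hsq', fun i => ?_⟩
  have hdX : fderiv ℂ (fun U => X (L.symm U)) U = _ := L.symm.comp_right_fderiv (f := X)
  have hdX' : fderiv ℂ (fun U => X' (L.symm U)) U = _ := L.symm.comp_right_fderiv (f := X')
  simp only [hdX, hdX', ← hω i, ContinuousLinearMap.add_comp, ContinuousLinearMap.smul_comp]

theorem comp_symm_standard {m₁ m₂ : ℂ} {ω₁ ω₂ : ℂ × ℂ →L[ℂ] ℂ} {L : (ℂ × ℂ) ≃L[ℂ] (ℂ × ℂ)}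
    (h : SolvesInversion f ![fun x => 1 - m₂ * x, fun x => 1 - m₁ * x] ![ω₁, ω₂] V X X')
    (hm : m₁ - m₂ ≠ 0)
    (hL : ∀ z, L z = ((m₁ * ω₁ z - m₂ * ω₂ z) / (m₁ - m₂), (ω₁ z - ω₂ z) / (m₁ - m₂))) :
    SolvesInversion f ![fun _ => 1, fun x => x]
      ![ContinuousLinearMap.fst ℂ ℂ ℂ, ContinuousLinearMap.snd ℂ ℂ ℂ] (L '' V)
      (fun U => X (L.symm U)) (fun U => X' (L.symm U)) := by
  let A : Matrix (Fin 2) (Fin 2) ℂ :=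
    !![m₁ / (m₁ - m₂), -m₂ / (m₁ - m₂); 1 / (m₁ - m₂), -1 / (m₁ - m₂)]
  convert (h.matrix_combination A).comp_symm L using 1
  · ext i x
    simp only [Fin.sum_univ_two]
    fin_cases i
    · change 1 = m₁ / (m₁ - m₂) * (1 - m₂ * x) + -m₂ / (m₁ - m₂) * (1 - m₁ * x)
      field_simp
      ring
    · change x = 1 / (m₁ - m₂) * (1 - m₂ * x) + -1 / (m₁ - m₂) * (1 - m₁ * x)
      field_simp
      ring
  · ext1 i
    refine ContinuousLinearMap.ext fun U => ?_
    have hU := (L.apply_symm_apply U).symm.trans (hL (L.symm U))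
    have hU₁ : U.1 = (m₁ * ω₁ (L.symm U) - m₂ * ω₂ (L.symm U)) / (m₁ - m₂) :=
      congrArg Prod.fst hU
    have hU₂ : U.2 = (ω₁ (L.symm U) - ω₂ (L.symm U)) / (m₁ - m₂) := congrArg Prod.snd hU
    simp only [Fin.sum_univ_two]
    fin_cases i
    · change U.1 = m₁ / (m₁ - m₂) * ω₁ (L.symm U) + -m₂ / (m₁ - m₂) * ω₂ (L.symm U)
      linear_combination hU₁
    · change U.2 = 1 / (m₁ - m₂) * ω₁ (L.symm U) + -1 / (m₁ - m₂) * ω₂ (L.symm U)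
      linear_combination hU₂

end SolvesInversion

theorem mainTheorem1 (τ : Period) (hτ : τ.Nondegenerate) :
    -- the roots of `f₅` are simple, so that `y² = f₅(x)` has genus two
    ((τ.m ≠ 0 ∧ τ.m₁ ≠ 0 ∧ τ.m₂ ≠ 0) ∧ (τ.m ≠ 1 ∧ τ.m₁ ≠ 1 ∧ τ.m₂ ≠ 1) ∧
      (τ.m ≠ τ.m₁ ∧ τ.m ≠ τ.m₂ ∧ τ.m₁ ≠ τ.m₂)) ∧
    ∃ κ₁ κ₂ : ℂ,
      κ₁ ^ 2 = 4 * (τ.b + τ.b₁) * ((1 - τ.E) * (1 - τ.E₁) / ((τ.F + 1) * (1 - τ.E₂))) ∧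
      κ₂ ^ 2 = 4 * (τ.b - τ.b₁) * ((1 - τ.E) * (1 - τ.E₂) / ((τ.F - 1) * (1 - τ.E₁))) ∧
      ∃ L : (ℂ × ℂ) ≃L[ℂ] (ℂ × ℂ),
        -- the coordinates `(U₁, U₂)` as linear functions of `(u, v)`
        (∀ z, L z = ((τ.m₁ * (κ₁ * τ.ν z) - τ.m₂ * (κ₂ * τ.μ z)) / (τ.m₁ - τ.m₂),
          (κ₁ * τ.ν z - κ₂ * τ.μ z) / (τ.m₁ - τ.m₂))) ∧
        ∀ (V : Set (ℂ × ℂ)) (r : ℂ × ℂ → ℂ), τ.IsBranch V r →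
          SolvesInversion τ.f₅ ![fun x => 1 - τ.m₂ * x, fun x => 1 - τ.m₁ * x]
            ![κ₁ • τ.ν, κ₂ • τ.μ] V (τ.x r) (τ.x' r) ∧
          SolvesInversion τ.f₅ ![fun _ => 1, fun x => x]
            ![ContinuousLinearMap.fst ℂ ℂ ℂ, ContinuousLinearMap.snd ℂ ℂ ℂ] (L '' V)
            (fun U => τ.x r (L.symm U)) (fun U => τ.x' r (L.symm U)) ∧
          ∀ U ∈ L '' V, ∀ p q : ℂ, p = τ.p (L.symm U) → q = τ.q (L.symm U) →
            wp₂₂ (fun U => τ.x r (L.symm U)) (fun U => τ.x' r (L.symm U)) U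
                = 2 * (τ.E * (1 + p ^ 2 * q ^ 2) - (p ^ 2 + q ^ 2))
                    / ((τ.E + 1) * (p * q + 1) ^ 2) ∧
            wp₂₂ (fun U => τ.x r (L.symm U)) (fun U => τ.x' r (L.symm U)) U
                = 2 * τ.E / (τ.E + 1)
                    - 2 * (p ^ 2 + q ^ 2 + 2 * τ.E * p * q) / ((τ.E + 1) * (1 + p * q) ^ 2) ∧
            wp₁₂ (fun U => τ.x r (L.symm U)) (fun U => τ.x' r (L.symm U)) U
                = -(τ.E - 1) / (τ.E + 1)
                    + 4 * (τ.E - 1) * p * q / ((τ.E + 1) * (1 + p * q) ^ 2) := by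
  refine ⟨hτ.m_ne_zero_ne_one_pairwise_ne, ?_⟩
  obtain ⟨κ₁, κ₂, hκ⟩ := hτ.exists_isNormalization
  obtain ⟨L, hL⟩ := hκ.exists_coordinates hτ
  refine ⟨κ₁, κ₂, hκ.κ₁_sq hτ, hκ.κ₂_sq hτ, L, hL, fun V r hr => ?_⟩
  have hsol := hr.solvesInversion hτ hκ
  refine ⟨hsol, hsol.comp_symm_standard hτ.m₁_sub_m₂_ne hL, ?_⟩
  rintro _ ⟨z, hz, rfl⟩ p q rfl rfl
  simp only [wp₂₂, wp₁₂, L.symm_apply_apply]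
  exact ⟨τ.x_add_x' r z, hr.x_add_x'_eq hτ hz, hr.neg_x_mul_x'_eq hτ hz⟩
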